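/- **Model.** Fix $T>0$. For individuals $i=1,2,\dots$ let $0<t_{i1}<\dots<t_{in_i}\le T$ with $\sup_i n_i<\infty$, and let $X_i(t)\in\mathbb{R}^{p_\beta}$, $Z_i(t)\in\mathbb{R}^{p_b}$ be non-random and bounded uniformly in $i$ and $t\in[0,T]$. Let $X_i$ and $Z_i$ also denote the matrices with $j$th rows $X_i(t_{ij})^\top$ and $Z_i(t_{ij})^\top$. The parameter is $\theta=(\beta,v)$ with $v=(\gamma,\alpha,\tau,\sigma^2)$, ranging over an open set $\Theta=\Theta_\beta\times\Theta_v$, $\Theta_v=\Theta_\gamma\times\Theta_{(\alpha,\tau,\sigma^2)}$, in $\mathbb{R}^{p_\beta}\times\mathbb{R}^{p_\gamma}\times(0,\infty)^3\subset\mathbb{R}^p$, $p=p_\beta+p_\gamma+3$. Under $P_\theta$, the $i$th individual is observed through $$Y_i=X_i\beta+Z_ib_i+W_i+\epsilon_i\in\mathbb{R}^{n_i},$$ where the $b_i$ are i.i.d. $N_{p_b}(0,G(\gamma))$ for a known covariance-matrix-valued function $G$ on $\Theta_\gamma$; $W_i=(W_i(t_{ij}))_j$ with $W_i(t)=\int_0^t\zeta_i(s)\,ds$,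 where the $\zeta_i$ are i.i.d. stationary Gaussian Ornstein–Uhlenbeck processes (continuous, centered, with covariance $\frac{\tau^2}{2\alpha}e^{-\alpha|s-t|}$); the $\epsilon_i\sim N_{n_i}(0,\sigma^2I)$ are independent; and the families $\{b_i\},\{W_i\},\{\epsilon_i\}$ are mutually independent. Let $Q_i(v)=Z_iG(\gamma)Z_i^\top+H_i(\alpha,\tau)+\sigma^2I_{n_i}$, where $H_i(\alpha,\tau)$ is the matrix with entries $$H_{i;jk}(\alpha,\tau)=\frac{\tau^2}{2\alpha^3}\Big(2\alpha\min(t_{ij},t_{ik})+e^{-\alpha t_{ij}}+e^{-\alpha t_{ik}}-1-e^{-\alpha|t_{ij}-t_{ik}|}\Big),$$ and suppose $\inf_i\lambda_{\min}(Q_i(v))>0$ for every $v\in\Theta_v$. The log-likelihood is $$\ell_N(\theta)=-\frac12\sum_{i=1}^N\Big\{n_i\log(2\pi)+\log|Q_i(v)|+(Y_i-X_i\beta)^\top Q_i(v)^{-1}(Y_i-X_i\beta)\Big\},$$ and $\Delta_N(\theta)=N^{-1/2}\partial_\theta\ell_N(\theta)$. **Theorem 1.** Fix $\theta_0=(\beta_0,v_0)\in\Theta$.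 Assume that $G$ is of class $C^3$ on $\Theta_\gamma$, and that there are symmetric-matrix-valued $C^1$ functions $A(v)$ and $U(v)=(U_{jk}(v))$ on $\Theta_v$ such that, for every $v\in\Theta_v$ and $1\le j,k\le p_\gamma+3$, $$\frac1N\sum_{i=1}^NX_i^\top Q_i(v)^{-1}X_i\to A(v),\qquad \frac1N\sum_{i=1}^N\frac12\operatorname{tr}\big\{Q_i(v)^{-1}(\partial_{v_k}Q_i(v))Q_i(v)^{-1}(\partial_{v_j}Q_i(v))\big\}\to U_{jk}(v)$$ as $N\to\infty$, and that $A(v)$ and $U(v)$ are positive definite uniformly in $v$ over each compact subset of $\Theta_v$. Put $\mathcal I(v)=\operatorname{diag}(A(v),U(v))$. Then, under $P_{\theta_0}$: 1. for every bounded sequence $(u_N)\subset\mathbb{R}^p$, $$\ell_N\Big(\theta_0+\tfrac1{\sqrt N}u_N\Big)-\ell_N(\theta_0)=\Delta_N(\theta_0)^\top u_N-\tfrac12u_N^\top\mathcal I(v_0)u_N+o_p(1),$$ and $\Delta_N(\theta_0)$ converges in law to $N_p(0,\mathcal I(v_0))$; 2. there are measurable functions $\hat\theta_N$ of $(Y_1,\dots,Y_N)$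 such that, with probability tending to $1$, $\hat\theta_N$ lies in $\Theta$ and is a local maximum point of $\ell_N$, and $$\sqrt N(\hat\theta_N-\theta_0)=\mathcal I(v_0)^{-1}\Delta_N(\theta_0)+o_p(1),$$ which converges in law to $N_p(0,\mathcal I(v_0)^{-1})$. -/

import Mathlib

open MeasureTheory ProbabilityTheory Filter Topology Matrix
open scoped NNReal

noncomputable section

namespace IOU

/-- Index set of the components of `v = (γ, α, τ, σ²)`. -/
abbrev CovIdx (pγ : ℕ) : Type := Fin pγ ⊕ Fin 3

/-- Index set of the components of `θ = (β, γ, α, τ, σ²) = (β, v)`. -/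
abbrev ParIdx (pβ pγ : ℕ) : Type := Fin pβ ⊕ CovIdx pγ

/-- The space of covariance parameters `v`. -/
abbrev CovPar (pγ : ℕ) : Type := EuclideanSpace ℝ (CovIdx pγ)

/-- The space `ℝ^p`, `p = pβ + pγ + 3`, of all parameters `θ`. -/
abbrev Par (pβ pγ : ℕ) : Type := EuclideanSpace ℝ (ParIdx pβ pγ)

section Parameters

variable {pβ pγ : ℕ}

/-- The component `β` of `θ`. -/
def betaOf (θ : Par pβ pγ) : EuclideanSpace ℝ (Fin pβ) := WithLp.toLp 2 fun k => θ (Sum.inl k)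

/-- The component `v` of `θ`. -/
def covOf (θ : Par pβ pγ) : CovPar pγ := WithLp.toLp 2 fun k => θ (Sum.inr k)

/-- The component `γ` of `v`. -/
def gammaOf (v : CovPar pγ) : EuclideanSpace ℝ (Fin pγ) := WithLp.toLp 2 fun k => v (Sum.inl k)

/-- The component `(α, τ, σ²)` of `v`. -/
def scaleOf (v : CovPar pγ) : EuclideanSpace ℝ (Fin 3) := WithLp.toLp 2 fun k => v (Sum.inr k)

/-- The component `α` of `v`. -/
def alphaOf (v : CovPar pγ) : ℝ := v (Sum.inr 0)

/-- The component `τ` of `v`. -/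
def tauOf (v : CovPar pγ) : ℝ := v (Sum.inr 1)

/-- The component `σ²` of `v`. -/
def sigmaSqOf (v : CovPar pγ) : ℝ := v (Sum.inr 2)

/-- The set `Θ_v = Θ_γ × Θ_{(α,τ,σ²)}`. -/
def covSet (Θγ : Set (EuclideanSpace ℝ (Fin pγ))) (Θs : Set (EuclideanSpace ℝ (Fin 3))) :
    Set (CovPar pγ) :=
  {v | gammaOf v ∈ Θγ ∧ scaleOf v ∈ Θs}

/-- The set `Θ = Θ_β × Θ_v`. -/
def parSet (Θβ : Set (EuclideanSpace ℝ (Fin pβ))) (Θγ : Set (EuclideanSpace ℝ (Fin pγ)))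
    (Θs : Set (EuclideanSpace ℝ (Fin 3))) : Set (Par pβ pγ) :=
  {θ | betaOf θ ∈ Θβ ∧ covOf θ ∈ covSet Θγ Θs}

end Parameters

/-- The non-random part of the data, for a sequence of individuals `i = 0, 1, 2, …`: the time
horizon, the numbers of observations (bounded), the observation times
`0 < t_{i1} < … < t_{i n_i} ≤ T`, and the explanatory processes, uniformly bounded on `[0, T]`. -/
structure Design (pβ pb : ℕ) where
  T : ℝ
  n : ℕ → ℕ
  t : ∀ i, Fin (n i) → ℝ
  X : ℕ → ℝ → EuclideanSpace ℝ (Fin pβ)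
  Z : ℕ → ℝ → EuclideanSpace ℝ (Fin pb)
  n_bdd : ∃ m, ∀ i, n i ≤ m
  t_pos : ∀ i j, 0 < t i j
  t_le : ∀ i j, t i j ≤ T
  t_strictMono : ∀ i, StrictMono (t i)
  covariates_bdd : ∃ C : ℝ, ∀ i, ∀ s ∈ Set.Icc 0 T, ‖X i s‖ ≤ C ∧ ‖Z i s‖ ≤ C

/-- The value space `ℝ^{n_i}` of the observation `Y_i`. -/
abbrev Design.Obs {pβ pb : ℕ} (D : Design pβ pb) (i : ℕ) : Type := EuclideanSpace ℝ (Fin (D.n i))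

/-- The value space of the observations `(Y_i)` of the first `N` individuals. -/
abbrev Design.Sample {pβ pb : ℕ} (D : Design pβ pb) (N : ℕ) : Type := ∀ i : Fin N, D.Obs i

/-- The covariance function of the integrated stationary Ornstein-Uhlenbeck process. -/
def iouCov (α τ s t : ℝ) : ℝ :=
  τ ^ 2 / (2 * α ^ 3) *
    (2 * α * min s t + Real.exp (-α * s) + Real.exp (-α * t) - 1 - Real.exp (-α * |s - t|))

section Likelihood

variable {pβ pb pγ : ℕ} (D : Design pβ pb)
  (G : EuclideanSpace ℝ (Fin pγ) → Matrix (Fin pb) (Fin pb) ℝ)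

/-- The matrix `X_i = (X_i(t_{ij}))_j`. -/
def XMat (i : ℕ) : Matrix (Fin (D.n i)) (Fin pβ) ℝ := Matrix.of fun j k => D.X i (D.t i j) k

/-- The matrix `Z_i = (Z_i(t_{ij}))_j`. -/
def ZMat (i : ℕ) : Matrix (Fin (D.n i)) (Fin pb) ℝ := Matrix.of fun j k => D.Z i (D.t i j) k

/-- The matrix `H_i(α, τ)`. -/
def HMat (i : ℕ) (α τ : ℝ) : Matrix (Fin (D.n i)) (Fin (D.n i)) ℝ :=
  Matrix.of fun j k => iouCov α τ (D.t i j) (D.t i k)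

/-- The covariance matrix `Q_i(v) = Z_i G(γ) Z_iᵀ + H_i(α, τ) + σ² I`. -/
def QMat (i : ℕ) (v : CovPar pγ) : Matrix (Fin (D.n i)) (Fin (D.n i)) ℝ :=
  ZMat D i * G (gammaOf v) * (ZMat D i)ᵀ + HMat D i (alphaOf v) (tauOf v)
    + sigmaSqOf v • (1 : Matrix (Fin (D.n i)) (Fin (D.n i)) ℝ)

/-- The entrywise partial derivative `∂_{v_k} Q_i(v)`. -/
def dQMat (i : ℕ) (k : CovIdx pγ) (v : CovPar pγ) : Matrix (Fin (D.n i)) (Fin (D.n i)) ℝ :=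
  Matrix.of fun a b => fderiv ℝ (fun w => QMat D G i w a b) v (EuclideanSpace.single k 1)

/-- `N⁻¹ ∑_{i ≤ N} X_iᵀ Q_i(v)⁻¹ X_i`. -/
def avgA (N : ℕ) (v : CovPar pγ) : Matrix (Fin pβ) (Fin pβ) ℝ :=
  (N : ℝ)⁻¹ • ∑ i : Fin N, (XMat D i)ᵀ * (QMat D G i v)⁻¹ * XMat D i

/-- `N⁻¹ ∑_{i ≤ N} ½ tr (Q_i(v)⁻¹ (∂_{v_k} Q_i(v)) Q_i(v)⁻¹ (∂_{v_j} Q_i(v)))`. -/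
def avgU (N : ℕ) (j k : CovIdx pγ) (v : CovPar pγ) : ℝ :=
  (N : ℝ)⁻¹ * ∑ i : Fin N, (1 / 2 : ℝ) *
    Matrix.trace ((QMat D G i v)⁻¹ * dQMat D G i k v * (QMat D G i v)⁻¹ * dQMat D G i j v)

/-- The logarithm of the density of `N_n(m, S)` at `y`. -/
def gaussianLogDensity {n : ℕ} (m : Fin n → ℝ) (S : Matrix (Fin n) (Fin n) ℝ)
    (y : Fin n → ℝ) : ℝ :=
  -((n : ℝ) / 2) * Real.log (2 * Real.pi)
    - (1 / 2 : ℝ) * (Real.log S.det + (y - m) ⬝ᵥ (S⁻¹ *ᵥ (y - m)))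

/-- The log-likelihood `ℓ_N(θ)` of the sample `y`. -/
def logLik (N : ℕ) (y : D.Sample N) (θ : Par pβ pγ) : ℝ :=
  ∑ i : Fin N,
    gaussianLogDensity (XMat D i *ᵥ ⇑(betaOf θ)) (QMat D G i (covOf θ)) (⇑(y i))

/-- The normalized score `Δ_N(θ) = N^{-1/2} ∂_θ ℓ_N(θ)`. -/
def normScore (N : ℕ) (y : D.Sample N) (θ : Par pβ pγ) : Par pβ pγ :=
  (Real.sqrt N)⁻¹ • gradient (logLik D G N y) θ

/-- For each `v ∈ S` the matrices `Q_i(v)` are non-degenerate uniformly in `i`, that is,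
`inf_i λ_min (Q_i(v)) > 0`. -/
def UniformlyNondegenerate (S : Set (CovPar pγ)) : Prop :=
  ∀ v ∈ S, ∃ c : ℝ, 0 < c ∧ ∀ (i : ℕ) (x : Fin (D.n i) → ℝ),
    c * (x ⬝ᵥ x) ≤ x ⬝ᵥ (QMat D G i v *ᵥ x)

end Likelihood

/-- The matrices `M(v)` are positive definite, uniformly in `v` over each compact subset of `S`. -/
def PosDefOnCompacts {E ι : Type*} [TopologicalSpace E] [Fintype ι] (S : Set E)
    (M : E → Matrix ι ι ℝ) : Prop :=
  ∀ K ⊆ S, IsCompact K → ∃ c : ℝ, 0 < c ∧ ∀ v ∈ K, ∀ x : ι → ℝ,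
    c * (x ⬝ᵥ x) ≤ x ⬝ᵥ (M v *ᵥ x)

section Model

variable {Ω : Type*} [MeasurableSpace Ω]

/-- `ζ` is a stationary Gaussian Ornstein-Uhlenbeck process on `[0, ∞)`, the stationary solution
of `dζ = -α ζ dt + τ dw`: a centered Gaussian process with covariance function
`τ² / (2α) * exp (-α |s - t|)` and almost surely continuous paths. -/
structure IsStationaryOU (α τ : ℝ) (ζ : ℝ≥0 → Ω → ℝ) (P : Measure Ω) : Prop where
  measurable : ∀ t, Measurable (ζ t)
  gaussian : IsGaussianProcess ζ P
  mean : ∀ t, ∫ ω, ζ t ω ∂P = 0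
  cov : ∀ s t : ℝ≥0,
    cov[ζ s, ζ t; P] = τ ^ 2 / (2 * α) * Real.exp (-α * |(s : ℝ) - (t : ℝ)|)
  continuous_paths : ∀ᵐ ω ∂P, Continuous fun t => ζ t ω

/-- The integrated process `W(t) = ∫₀ᵗ ζ(s) ds`. -/
def integrated (ζ : ℝ≥0 → Ω → ℝ) (t : ℝ) (ω : Ω) : ℝ :=
  ∫ s in (0 : ℝ)..t, ζ s.toNNReal ω

variable {pβ pb pγ : ℕ}

/-- Under `P`, the random effects `b_i`, the Ornstein-Uhlenbeck processes `ζ_i` and the vectors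
`ε_i = (ε_i(t_{ij}))_j` of measurement errors are distributed as the model with parameter `θ`
prescribes. -/
structure IsModel (D : Design pβ pb) (G : EuclideanSpace ℝ (Fin pγ) → Matrix (Fin pb) (Fin pb) ℝ)
    (θ : Par pβ pγ) (P : Measure Ω) (b : ℕ → Ω → EuclideanSpace ℝ (Fin pb))
    (ζ : ℕ → ℝ≥0 → Ω → ℝ) (ε : ∀ i, Ω → D.Obs i) : Prop where
  b_measurable : ∀ i, Measurable (b i)
  b_law : ∀ i, P.map (b i) = multivariateGaussian 0 (G (gammaOf (covOf θ)))
  b_indep : iIndepFun b P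
  ζ_law : ∀ i, IsStationaryOU (alphaOf (covOf θ)) (tauOf (covOf θ)) (ζ i) P
  ζ_indep : iIndepFun (fun i ω t => ζ i t ω) P
  ε_measurable : ∀ i, Measurable (ε i)
  ε_law : ∀ i, P.map (ε i) = multivariateGaussian 0
    (sigmaSqOf (covOf θ) • (1 : Matrix (Fin (D.n i)) (Fin (D.n i)) ℝ))
  ε_indep : iIndepFun ε P
  /-- The three families are mutually independent. -/
  families_indep : iIndep
    ![MeasurableSpace.comap (fun ω i => b i ω) inferInstance,
      MeasurableSpace.comap (fun ω i t => ζ i t ω) inferInstance,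
      MeasurableSpace.comap (fun ω i => ε i ω) inferInstance] P

/-- The observation `Y_i = X_i β + Z_i b_i + W_i + ε_i` of the `i`th individual. -/
def obs (D : Design pβ pb) (β : EuclideanSpace ℝ (Fin pβ))
    (b : ℕ → Ω → EuclideanSpace ℝ (Fin pb)) (ζ : ℕ → ℝ≥0 → Ω → ℝ)
    (ε : ∀ i, Ω → D.Obs i) (i : ℕ) (ω : Ω) : D.Obs i :=
  WithLp.toLp 2 fun j =>
    (XMat D i *ᵥ ⇑β) j + (ZMat D i *ᵥ ⇑(b i ω)) j + integrated (ζ i) (D.t i j) ω + ε i ω j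

/-- The observations of the first `N` individuals. -/
def sample (D : Design pβ pb) (β : EuclideanSpace ℝ (Fin pβ))
    (b : ℕ → Ω → EuclideanSpace ℝ (Fin pb)) (ζ : ℕ → ℝ≥0 → Ω → ℝ)
    (ε : ∀ i, Ω → D.Obs i) (N : ℕ) (ω : Ω) : D.Sample N :=
  fun i => obs D β b ζ ε i ω

end Model

/-- The matrix `diag (A, U)`. -/
def infoMat {pβ pγ : ℕ} (A : Matrix (Fin pβ) (Fin pβ) ℝ) (U : Matrix (CovIdx pγ) (CovIdx pγ) ℝ) :
    Matrix (ParIdx pβ pγ) (ParIdx pβ pγ) ℝ :=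
  Matrix.fromBlocks A 0 0 U

end IOU

end

/-! Around `θ₀` the log-likelihood is, on a ball of fixed radius, a quadratic function up to a cubic
error, and both assertions are read off from that expansion.

Uniformity in the individuals is the analytic point. Every entry of every `Q_i(v)` is a value of one
`C³` function `entryFun`, evaluated at `v` and at data (covariates, times) that stay in a fixed
bounded set, so Taylor's formula for `Q_i` has constants independent of `i`
(`exists_QMat_expansion`). Together with the uniform bound on `Q_i⁻¹` this expands each Gaussian
log-density with remainder at most `κ (1 + ‖e‖²) ‖h‖³`, where `e` is the residual
(`abs_gaussian_expansion_le`, `exists_gaussianLogDensity_expansion`). After summation, `ℓ_N(θ₀ + h)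
- ℓ_N(θ₀) = √N Δ·h + (N/2) h·M h + error`, with an error of at most `N K_N ‖h‖³`
(`HasIndExpansion.rescaled`).

Under the model the residuals are independent and `N(0, Q_i)`. For this the integrated
Ornstein-Uhlenbeck process is treated as a limit of Riemann sums
(`IsStationaryOU.map_integratedVec`, `IsModel.exists_residuals`). Gaussian moments up to order four
show that each score is centered with covariance the individual information, and that the mean of
the second-order matrix is minus that information; sixth moments are bounded uniformly. Hence a
Lyapunov central limit theorem gives `Δ → N(0, I)`, a Chebyshev law of large numbers gives `M → -I`,
and `K_N` is at most a constant `κ` with probability tending to one.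

Inserting `h = u_N / √N` gives local asymptotic normality (`lan_of_expansion`). For the estimator no
separate consistency proof is needed: the likelihood is maximized over a closed ball whose fixed
radius `ρ` is so small that the quadratic term dominates the cubic error on all of it. The maximizer
is then at distance `O_p(N^{-1/2})` from `θ₀`, hence interior and a local maximum. Comparing its
value with that at `θ₀ + I⁻¹Δ/√N` and using strong concavity of the limiting quadratic gives
asymptotic linearity (`argmax_near_of_quadratic`, `argmax_linear_of_expansion`). A measurable choice
of maximizer comes from `exists_measurable_argmax`. -/

noncomputable section

namespace IOU

/-! ### Measurable selection of maximizers. -/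

section MeasurableArgmax

/-- By continuity the supremum may be taken over a countable dense sequence, where measurability is
immediate. -/
theorem measurable_iSup_of_continuous {Y D : Type*} [MeasurableSpace Y] [TopologicalSpace D]
    [CompactSpace D] [TopologicalSpace.SeparableSpace D] [Nonempty D] (F : Y → D → ℝ)
    (hm : ∀ c, Measurable fun y => F y c) (hc : ∀ y, Continuous (F y)) :
    Measurable fun y => ⨆ c, F y c := by
  have h : (fun y => ⨆ c, F y c) =
      fun y => ⨆ n, F y (TopologicalSpace.denseSeq D n) := by
    funext y
    have hb : BddAbove (Set.range (F y)) := (isCompact_range (hc y)).bddAbove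
    have hb' : BddAbove (Set.range fun n => F y (TopologicalSpace.denseSeq D n)) :=
      hb.mono (Set.range_comp_subset_range _ _)
    apply le_antisymm
    · apply ciSup_le
      have hcl : IsClosed {c | F y c ≤ ⨆ n, F y (TopologicalSpace.denseSeq D n)} :=
        isClosed_le (hc y) continuous_const
      intro c
      have : closure (Set.range (TopologicalSpace.denseSeq D)) ⊆
          {c | F y c ≤ ⨆ n, F y (TopologicalSpace.denseSeq D n)} :=
        closure_minimal (by rintro _ ⟨n, rfl⟩; exact le_ciSup hb' n) hcl
      exact this ((TopologicalSpace.denseRange_denseSeq D) c)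
    · exact ciSup_le fun n => le_ciSup hb _
  rw [h]
  exact Measurable.iSup fun n => hm _

/-- On the real line there is a canonical maximizer, the least one. It is at most `a` exactly when
the supremum over the points of `C` up to `a` reaches the full supremum, and both suprema are
measurable. -/
theorem exists_measurable_argmax_real {Y : Type*} [MeasurableSpace Y] {C : Set ℝ}
    (hC : IsCompact C) (hne : C.Nonempty) (F : Y → C → ℝ)
    (hm : ∀ c, Measurable fun y => F y c) (hc : ∀ y, Continuous (F y)) :
    ∃ g : Y → C, Measurable g ∧ ∀ y c, F y c ≤ F y (g y) := by
  have : CompactSpace C := isCompact_iff_compactSpace.1 hC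
  have : Nonempty C := hne.to_subtype
  set A : Y → Set C := fun y => {c | ∀ c', F y c' ≤ F y c} with hA
  have hAne : ∀ y, (A y).Nonempty := fun y => by
    obtain ⟨c, -, h⟩ := isCompact_univ.exists_isMaxOn Set.univ_nonempty (hc y).continuousOn
    exact ⟨c, fun c' => h (Set.mem_univ c')⟩
  have hAcl : ∀ y, IsClosed (A y) := fun y => by
    simp only [hA, Set.ofPred_forall]
    exact isClosed_iInter fun c' => isClosed_le continuous_const (hc y)
  have hAc : ∀ y, IsCompact (Subtype.val '' A y) := fun y =>
    ((hAcl y).isCompact).image continuous_subtype_val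
  have hmem : ∀ y, sInf (Subtype.val '' A y) ∈ Subtype.val '' A y := fun y =>
    (hAc y).sInf_mem ((hAne y).image _)
  choose g hg hgv using hmem
  refine ⟨g, ?_, fun y c => hg y c⟩
  refine (MeasurableEmbedding.subtype_coe hC.measurableSet).measurable_comp_iff.1 ?_
  refine measurable_of_Iic fun a => ?_
  by_cases hD : ∃ c : C, (c : ℝ) ≤ a
  · have : Nonempty {c : C // (c : ℝ) ≤ a} := by obtain ⟨c, hc⟩ := hD; exact ⟨c, hc⟩
    have : CompactSpace {c : C // (c : ℝ) ≤ a} :=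
      isCompact_iff_compactSpace.1
        ((isClosed_le continuous_subtype_val continuous_const).isCompact)
    have hset : (Subtype.val ∘ g) ⁻¹' Set.Iic a =
        {y | ⨆ c, F y c ≤ ⨆ c : {c : C // (c : ℝ) ≤ a}, F y c} := by
      ext y
      have hb : BddAbove (Set.range (F y)) := (isCompact_range (hc y)).bddAbove
      have hcont : Continuous fun c : {c : C // (c : ℝ) ≤ a} => F y c :=
        (hc y).comp continuous_subtype_val
      have hb' : BddAbove (Set.range fun c : {c : C // (c : ℝ) ≤ a} => F y c) :=
        (isCompact_range hcont).bddAbove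
      constructor
      · intro h
        exact ciSup_le fun c => (hg y c).trans (le_ciSup hb' ⟨g y, h⟩)
      · intro h
        obtain ⟨c, -, hcm⟩ := isCompact_univ.exists_isMaxOn Set.univ_nonempty hcont.continuousOn
        have hcA : (c : C) ∈ A y := fun c' =>
          (le_ciSup hb c').trans (h.trans (ciSup_le fun d => hcm (Set.mem_univ d)))
        have : ((g y : C) : ℝ) ≤ ((c : C) : ℝ) := by
          rw [hgv]
          exact csInf_le (hAc y).bddBelow ⟨c, hcA, rfl⟩
        exact this.trans c.2
    rw [hset]
    exact measurableSet_le (measurable_iSup_of_continuous F hm hc)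
      (measurable_iSup_of_continuous (fun y (c : {c : C // (c : ℝ) ≤ a}) => F y c)
        (fun c => hm _) fun y => (hc y).comp continuous_subtype_val)
  · have : (Subtype.val ∘ g) ⁻¹' Set.Iic a = ∅ := by
      ext y
      simp only [Set.mem_preimage, Set.mem_Iic, Set.mem_empty_iff_false, iff_false]
      exact fun h => hD ⟨g y, h⟩
    rw [this]
    exact MeasurableSet.empty

/-- A measurable family of continuous functions on a compact metric space has a measurable family
of maximizers. -/
theorem exists_measurable_argmax {Y X : Type*} [MeasurableSpace Y] [MetricSpace X]
    [MeasurableSpace X] [BorelSpace X] {K : Set X} (hK : IsCompact K) (hne : K.Nonempty)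
    (f : Y → X → ℝ) (hm : ∀ x ∈ K, Measurable fun y => f y x) (hc : ∀ y, ContinuousOn (f y) K) :
    ∃ g : Y → X, Measurable g ∧ ∀ y, g y ∈ K ∧ ∀ x ∈ K, f y x ≤ f y (g y) := by
  have : CompactSpace K := isCompact_iff_compactSpace.1 hK
  have : Nonempty K := hne.to_subtype
  -- A compact metric space is a continuous image of the Cantor space. Realizing the latter inside
  -- `ℝ` moves the selection problem to a place where an order singles out a maximizer.
  obtain ⟨φ, hφc, hφs⟩ := exists_nat_bool_continuous_surjective_of_compact K
  set ψ : cantorSet → K := φ ∘ cantorSetHomeomorphNatToBool with hψ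
  have hψc : Continuous ψ := hφc.comp cantorSetHomeomorphNatToBool.continuous
  have hψs : Function.Surjective ψ := hφs.comp cantorSetHomeomorphNatToBool.surjective
  have hCne : (cantorSet : Set ℝ).Nonempty := by
    obtain ⟨c, -⟩ := hψs hne.to_subtype.some
    exact ⟨c, c.2⟩
  obtain ⟨g, hgm, hg⟩ := exists_measurable_argmax_real isCompact_cantorSet hCne
    (fun y c => f y (ψ c)) (fun c => hm _ (ψ c).2)
    (fun y => ((hc y).domRestrict).comp hψc)
  refine ⟨fun y => ψ (g y), ?_, fun y => ⟨(ψ (g y)).2, fun x hx => ?_⟩⟩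
  · exact (continuous_subtype_val.comp hψc).measurable.comp hgm
  · obtain ⟨c, hcx⟩ := hψs ⟨x, hx⟩
    have := hg y c
    rwa [hcx] at this

end MeasurableArgmax

end IOU

end

/-! ### Consequences of an approximate quadratic expansion, deterministic and in probability. -/

noncomputable section

namespace IOU

section QuadraticForms

variable {ι : Type*} [Fintype ι]

theorem abs_dotProduct_le (x y : EuclideanSpace ℝ ι) : |⇑x ⬝ᵥ ⇑y| ≤ ‖x‖ * ‖y‖ := by
  have h := abs_real_inner_le_norm y x
  rw [EuclideanSpace.inner_eq_star_dotProduct] at h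
  simpa [mul_comm] using h

theorem dotProduct_self_eq_norm_sq (x : EuclideanSpace ℝ ι) : ⇑x ⬝ᵥ ⇑x = ‖x‖ ^ 2 := by
  rw [EuclideanSpace.real_norm_sq_eq]
  simp [dotProduct, sq]

theorem abs_quadraticForm_le (M : Matrix ι ι ℝ) (x y : EuclideanSpace ℝ ι) :
    |⇑x ⬝ᵥ (M *ᵥ ⇑y)| ≤ (∑ a, ∑ b, |M a b|) * (‖x‖ * ‖y‖) := by
  simp only [dotProduct, mulVec, Finset.mul_sum, Finset.sum_mul]
  refine (Finset.abs_sum_le_sum_abs _ _).trans (Finset.sum_le_sum fun a _ => ?_)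
  refine (Finset.abs_sum_le_sum_abs _ _).trans (Finset.sum_le_sum fun b _ => ?_)
  rw [abs_mul, abs_mul]
  have h1 : |x a| ≤ ‖x‖ := by simpa using PiLp.norm_apply_le x a
  have h2 : |y b| ≤ ‖y‖ := by simpa using PiLp.norm_apply_le y b
  calc |x a| * (|M a b| * |y b|) = |M a b| * (|x a| * |y b|) := by ring
    _ ≤ _ := by gcongr

end QuadraticForms

section Argmax

variable {ι : Type*} [Fintype ι]

/-- The error of replacing a function by its approximate quadratic expansion, in the rescaled
variable. -/
theorem abs_rescaled_sub_le {I M : Matrix ι ι ℝ} {D : EuclideanSpace ℝ ι}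
    {L : EuclideanSpace ℝ ι → ℝ} {s κ η r : ℝ} (hs : 0 < s)
    (hexp : ∀ h, ‖h‖ ≤ r →
      |L h - (s * (⇑D ⬝ᵥ ⇑h) + s ^ 2 / 2 * (⇑h ⬝ᵥ (M *ᵥ ⇑h)))| ≤ s ^ 2 * κ * ‖h‖ ^ 3)
    (hM : ∑ a, ∑ b, |M a b + I a b| ≤ η) (u : EuclideanSpace ℝ ι) (hu : ‖u‖ ≤ s * r) :
    |L (s⁻¹ • u) - ((⇑D ⬝ᵥ ⇑u) - 1 / 2 * (⇑u ⬝ᵥ (I *ᵥ ⇑u)))| ≤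
      κ * ‖u‖ ^ 3 / s + η / 2 * ‖u‖ ^ 2 := by
  have hn : ‖s⁻¹ • u‖ = ‖u‖ / s := by
    rw [norm_smul, norm_inv, Real.norm_of_nonneg hs.le]; ring
  have h1 := hexp (s⁻¹ • u) (by rw [hn, div_le_iff₀ hs]; linarith)
  have h2 : |⇑u ⬝ᵥ ((M + I) *ᵥ ⇑u)| ≤ η * ‖u‖ ^ 2 := by
    refine (abs_quadraticForm_le (M + I) u u).trans ?_
    rw [← sq]
    exact mul_le_mul_of_nonneg_right hM (sq_nonneg _)
  have h3 : s * (⇑D ⬝ᵥ ⇑(s⁻¹ • u)) + s ^ 2 / 2 * (⇑(s⁻¹ • u) ⬝ᵥ (M *ᵥ ⇑(s⁻¹ • u))) =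
      (⇑D ⬝ᵥ ⇑u) + 1 / 2 * (⇑u ⬝ᵥ (M *ᵥ ⇑u)) := by
    simp only [WithLp.ofLp_smul, mulVec_smul, dotProduct_smul, smul_dotProduct,
      smul_eq_mul]
    field_simp
  rw [h3, hn] at h1
  rw [add_mulVec, dotProduct_add] at h2
  have h4 : s ^ 2 * κ * (‖u‖ / s) ^ 3 = κ * ‖u‖ ^ 3 / s := by field_simp
  rw [h4] at h1
  rw [abs_le] at *
  constructor <;> linarith [h1.1, h1.2, h2.1, h2.2]

/-- A maximizer of a function with an approximate quadratic expansion is close to the maximizer of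
the limiting quadratic function. -/
theorem argmax_near_of_quadratic [DecidableEq ι] {I M : Matrix ι ι ℝ} {D : EuclideanSpace ℝ ι}
    {L : EuclideanSpace ℝ ι → ℝ} {s κ η ρ c B : ℝ} (hs : 0 < s) (hκ : 0 ≤ κ) (hρ : 0 < ρ)
    (hc : 0 < c) (hIsymm : I.IsSymm) (hI : ∀ x : ι → ℝ, c * (x ⬝ᵥ x) ≤ x ⬝ᵥ (I *ᵥ x))
    (hexp : ∀ h, ‖h‖ ≤ ρ →
      |L h - (s * (⇑D ⬝ᵥ ⇑h) + s ^ 2 / 2 * (⇑h ⬝ᵥ (M *ᵥ ⇑h)))| ≤ s ^ 2 * κ * ‖h‖ ^ 3)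
    (hM : ∑ a, ∑ b, |M a b + I a b| ≤ η) (hη : η ≤ c / 8) (hκρ : κ * ρ ≤ c / 8)
    (hD : ‖D‖ ≤ B) {g : EuclideanSpace ℝ ι} (hg : ‖g‖ ≤ ρ) (hmax : ∀ h, ‖h‖ ≤ ρ → L h ≤ L g) :
    ‖s • g‖ ≤ 4 * B / c ∧ (4 * B / c ≤ s * ρ →
      ‖s • g - WithLp.toLp 2 (I⁻¹ *ᵥ ⇑D)‖ ^ 2 ≤
        4 / c * (κ * (4 * B / c) ^ 3 / s + η / 2 * (4 * B / c) ^ 2)) := by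
  have hB : 0 ≤ B := (norm_nonneg _).trans hD
  have hη0 : 0 ≤ η := le_trans (by positivity) hM
  have hI' : ∀ x : EuclideanSpace ℝ ι, c * ‖x‖ ^ 2 ≤ ⇑x ⬝ᵥ (I *ᵥ ⇑x) := fun x => by
    rw [← dotProduct_self_eq_norm_sq]; exact hI _
  have hunit : IsUnit I := by
    rw [← Matrix.mulVec_injective_iff_isUnit]
    intro x y hxy
    have h := hI (x - y)
    rw [mulVec_sub, hxy, sub_self, dotProduct_zero] at h
    have h0 : (x - y) ⬝ᵥ (x - y) = 0 :=
      le_antisymm (by nlinarith) (by simpa using dotProduct_star_self_nonneg (x - y))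
    exact sub_eq_zero.1 (dotProduct_self_eq_zero.1 h0)
  set u : EuclideanSpace ℝ ι := s • g with hu
  have hgu : s⁻¹ • u = g := by rw [hu, smul_smul, inv_mul_cancel₀ hs.ne', one_smul]
  have hun : ‖u‖ = s * ‖g‖ := by rw [hu, norm_smul, Real.norm_of_nonneg hs.le]
  have hus : ‖u‖ ≤ s * ρ := by rw [hun]; gcongr
  have key := abs_rescaled_sub_le hs hexp hM
  have hL0 : L 0 = 0 := by
    have := hexp 0 (by simpa using hρ.le)
    simpa using this
  -- Compare with `h = 0`: `0 ≤ L g`, while the expansion bounds `L g` by `B ‖u‖ - (c/2 - c/8 -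
  -- c/16) ‖u‖²`. The coefficient in brackets exceeds `c/4`.
  have hu1 : ‖u‖ ≤ 4 * B / c := by
    have h1 := key u hus
    rw [hgu] at h1
    have h2 : 0 ≤ L g := hL0 ▸ hmax 0 (by simpa using hρ.le)
    have h3 := abs_dotProduct_le D u
    -- One factor `‖u‖ / s = ‖g‖` of the cubic error is at most `ρ`, so the smallness of `κ * ρ`
    -- turns the error into a small multiple of `‖u‖²`.
    have h4 : κ * ‖u‖ ^ 3 / s ≤ c / 8 * ‖u‖ ^ 2 := by
      calc κ * ‖u‖ ^ 3 / s = κ * (‖u‖ / s) * ‖u‖ ^ 2 := by ring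
        _ ≤ κ * ρ * ‖u‖ ^ 2 := by
          gcongr
          rw [div_le_iff₀ hs]; linarith
        _ ≤ _ := by gcongr
    have h5 : η / 2 * ‖u‖ ^ 2 ≤ c / 16 * ‖u‖ ^ 2 :=
      mul_le_mul_of_nonneg_right (by linarith) (sq_nonneg _)
    have h6 : ‖D‖ * ‖u‖ ≤ B * ‖u‖ := by gcongr
    have h7 : c / 4 * ‖u‖ ^ 2 ≤ B * ‖u‖ := by
      have := hI' u
      nlinarith [(abs_le.1 h1).2, (abs_le.1 h3).2, sq_nonneg ‖u‖]
    rw [le_div_iff₀ hc]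
    rcases (norm_nonneg u).eq_or_lt with h0 | h0
    · rw [← h0]; linarith
    · have : c / 4 * ‖u‖ ≤ B := le_of_mul_le_mul_right (by linarith) h0
      linarith
  refine ⟨hu1, fun hBs => ?_⟩
  -- The exact maximizer of the limiting quadratic function; it obeys the same bound as `u`, so the
  -- expansion may be used at both points.
  set w : EuclideanSpace ℝ ι := WithLp.toLp 2 (I⁻¹ *ᵥ ⇑D) with hw
  have hIw : I *ᵥ ⇑w = ⇑D := by
    rw [hw]
    simp only [mulVec_mulVec]
    rw [Matrix.mul_nonsing_inv _ ((Matrix.isUnit_iff_isUnit_det _).1 hunit), one_mulVec]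
  have hwB : ‖w‖ ≤ 4 * B / c := by
    have h1 := hI' w
    rw [hIw] at h1
    have h2 := (abs_le.1 (abs_dotProduct_le w D)).2
    have h3 : ‖w‖ * ‖D‖ ≤ ‖w‖ * B := by gcongr
    rw [le_div_iff₀ hc]
    rcases (norm_nonneg w).eq_or_lt with h0 | h0
    · rw [← h0]; linarith
    · have : c * ‖w‖ ≤ B := le_of_mul_le_mul_right (by nlinarith) h0
      linarith
  have hδ : ∀ v : EuclideanSpace ℝ ι, ‖v‖ ≤ 4 * B / c →
      |L (s⁻¹ • v) - ((⇑D ⬝ᵥ ⇑v) - 1 / 2 * (⇑v ⬝ᵥ (I *ᵥ ⇑v)))| ≤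
        κ * (4 * B / c) ^ 3 / s + η / 2 * (4 * B / c) ^ 2 := fun v hv =>
    (key v (hv.trans hBs)).trans (by gcongr)
  have h1 := (abs_le.1 (hδ u hu1)).2
  have h2 := (abs_le.1 (hδ w hwB)).1
  rw [hgu] at h1
  have h3 : L (s⁻¹ • w) ≤ L g := by
    refine hmax _ ?_
    rw [norm_smul, norm_inv, Real.norm_of_nonneg hs.le, inv_mul_le_iff₀ hs]
    exact hwB.trans hBs
  have h4 := hI' (u - w)
  -- Completing the square: the limiting quadratic function drops from `w` to `u` by half of this
  -- form. Since `L` is at least as large at `g` as at `s⁻¹ • w`, the drop is at most twice the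
  -- approximation error.
  have h5 : ⇑(u - w) ⬝ᵥ (I *ᵥ ⇑(u - w)) =
      ⇑u ⬝ᵥ (I *ᵥ ⇑u) - 2 * (⇑D ⬝ᵥ ⇑u) + ⇑D ⬝ᵥ ⇑w := by
    have h6 : ⇑w ⬝ᵥ (I *ᵥ ⇑u) = ⇑D ⬝ᵥ ⇑u := by
      rw [dotProduct_mulVec, ← mulVec_transpose, hIsymm.eq, hIw]
    simp only [WithLp.ofLp_sub, mulVec_sub, sub_dotProduct, dotProduct_sub, hIw, h6]
    rw [dotProduct_comm u.ofLp D.ofLp, dotProduct_comm w.ofLp D.ofLp]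
    ring
  have h7 : ⇑w ⬝ᵥ (I *ᵥ ⇑w) = ⇑D ⬝ᵥ ⇑w := by rw [hIw, dotProduct_comm]
  rw [h7] at h2
  rw [h5] at h4
  rw [div_mul_eq_mul_div, le_div_iff₀ hc]
  linarith

end Argmax

section Probability

variable {ι : Type*} [Fintype ι] {Ω : Type*} [MeasurableSpace Ω] {P : Measure Ω}

theorem tendsto_measure_sum_abs {J : Type*} (s : Finset J) {f : J → ℕ → Ω → ℝ}
    (hf : ∀ j ∈ s, TendstoInMeasure P (f j) atTop fun _ => (0 : ℝ)) {η : ℝ} (hη : 0 < η) :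
    Tendsto (fun N => P {ω | η < ∑ j ∈ s, |f j N ω|}) atTop (𝓝 0) := by
  classical
  induction s using Finset.induction_on generalizing η with
  | empty => simp [hη.not_gt]
  | insert a s ha ih =>
    have h1 := ih (fun j hj => hf j (Finset.mem_insert_of_mem hj)) (half_pos hη)
    have h2 := (tendstoInMeasure_iff_norm.1 (hf a (Finset.mem_insert_self _ _))) _ (half_pos hη)
    have h3 := h2.add h1
    rw [add_zero] at h3
    refine tendsto_of_tendsto_of_tendsto_of_le_of_le tendsto_const_nhds h3 (fun _ => zero_le)
      fun N => (measure_mono ?_).trans (measure_union_le _ _)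
    intro ω hω
    simp only [Set.mem_ofPred_eq, Finset.sum_insert ha, Set.mem_union, sub_zero,
      Real.norm_eq_abs] at hω ⊢
    by_contra h
    push Not at h
    linarith

theorem tendsto_measure_sum_abs_add {M : ℕ → Ω → Matrix ι ι ℝ} {I : Matrix ι ι ℝ}
    (hM : ∀ a b, TendstoInMeasure P (fun N ω => M N ω a b) atTop fun _ => - I a b)
    {η : ℝ} (hη : 0 < η) :
    Tendsto (fun N => P {ω | η < ∑ a, ∑ b, |M N ω a b + I a b|}) atTop (𝓝 0) := by
  have := tendsto_measure_sum_abs (P := P) (Finset.univ : Finset (ι × ι))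
    (f := fun j N ω => M N ω j.1 j.2 + I j.1 j.2) (fun j _ => by
      have := hM j.1 j.2
      rw [tendstoInMeasure_iff_norm] at this ⊢
      simpa using this) hη
  simpa only [Fintype.sum_prod_type] using this

variable {L : ℕ → Ω → EuclideanSpace ℝ ι → ℝ} {Δ : ℕ → Ω → EuclideanSpace ℝ ι}
  {M : ℕ → Ω → Matrix ι ι ℝ} {I : Matrix ι ι ℝ} {K : ℕ → Ω → ℝ} {r κ : ℝ}

/-- For bounded `u` the rescaled cubic error is of order `1 / √N`, and the matrix error is small
outside an event of vanishing probability. -/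
theorem lan_of_expansion (hr : 0 < r)
    (hexp : ∀ N ω h, ‖h‖ ≤ r →
      |L N ω h - (√N * (⇑(Δ N ω) ⬝ᵥ ⇑h) + √N ^ 2 / 2 * (⇑h ⬝ᵥ (M N ω *ᵥ ⇑h)))| ≤
        √N ^ 2 * K N ω * ‖h‖ ^ 3)
    (hM : ∀ a b, TendstoInMeasure P (fun N ω => M N ω a b) atTop fun _ => - I a b)
    (hK : Tendsto (fun N => P {ω | κ < K N ω}) atTop (𝓝 0))
    (u : ℕ → EuclideanSpace ℝ ι) (hu : ∃ C : ℝ, ∀ N, ‖u N‖ ≤ C) :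
    TendstoInMeasure P
      (fun N ω => L N ω ((√N)⁻¹ • u N) -
        ((⇑(Δ N ω) ⬝ᵥ ⇑(u N)) - (1 / 2 : ℝ) * (⇑(u N) ⬝ᵥ (I *ᵥ ⇑(u N)))))
      atTop (fun _ => (0 : ℝ)) := by
  obtain ⟨C, hC⟩ := hu
  have hC0 : 0 ≤ C := (norm_nonneg _).trans (hC 0)
  rw [tendstoInMeasure_iff_norm]
  intro δ hδ
  -- With this `η` the matrix error `η / 2 * ‖u N‖ ^ 2` uses at most half of `δ`; the `+ 1` avoids
  -- division by zero.
  set η : ℝ := δ / (C ^ 2 + 1) with hη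
  have hηpos : 0 < η := by positivity
  have h1 := (tendsto_measure_sum_abs_add hM hηpos).add hK
  rw [add_zero] at h1
  refine tendsto_of_tendsto_of_tendsto_of_le_of_le' tendsto_const_nhds h1
    (Eventually.of_forall fun _ => zero_le) ?_
  have hs : Tendsto (fun N : ℕ => √(N : ℝ)) atTop atTop :=
    Real.tendsto_sqrt_atTop.comp tendsto_natCast_atTop_atTop
  have hs0 : Tendsto (fun N : ℕ => |κ| * C ^ 3 / √(N : ℝ)) atTop (𝓝 0) :=
    hs.const_div_atTop _
  filter_upwards [hs.eventually_gt_atTop 0, hs.eventually_ge_atTop (C / r),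
    hs0.eventually_lt_const (half_pos hδ)] with N hN1 hN2 hN3
  refine (measure_mono ?_).trans (measure_union_le _ _)
  intro ω hω
  simp only [Set.mem_ofPred_eq, sub_zero, Real.norm_eq_abs, Set.mem_union] at hω ⊢
  by_contra h
  push Not at h
  have h2 := abs_rescaled_sub_le (κ := |κ|) hN1 (fun h' hh' => (hexp N ω h' hh').trans (by
    gcongr; exact h.2.trans (le_abs_self _))) h.1 (u N) ((hC N).trans (by
      rwa [div_le_iff₀ hr] at hN2))
  have h3 : |κ| * ‖u N‖ ^ 3 / √(N : ℝ) ≤ |κ| * C ^ 3 / √(N : ℝ) := by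
    gcongr; exact hC N
  have h4 : η / 2 * ‖u N‖ ^ 2 ≤ δ / 2 := by
    calc η / 2 * ‖u N‖ ^ 2 ≤ η / 2 * (C ^ 2 + 1) := by
          gcongr
          have := hC N
          nlinarith [norm_nonneg (u N)]
      _ = δ / 2 := by rw [hη]; field_simp
  linarith

/-- The radius `ρ` does not depend on `N`. Tightness of `Δ` supplies the bound `B` of the
deterministic lemma outside an event of small probability; there the maximizer is interior and close
to its linearization at once. -/
theorem argmax_linear_of_expansion [DecidableEq ι] (hκ : 0 ≤ κ) {ρ c : ℝ} (hρ : 0 < ρ) (hc : 0 < c)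
    (hκρ : κ * ρ ≤ c / 8)
    (hIsymm : I.IsSymm) (hI : ∀ x : ι → ℝ, c * (x ⬝ᵥ x) ≤ x ⬝ᵥ (I *ᵥ x))
    (hexp : ∀ N ω h, ‖h‖ ≤ ρ →
      |L N ω h - (√N * (⇑(Δ N ω) ⬝ᵥ ⇑h) + √N ^ 2 / 2 * (⇑h ⬝ᵥ (M N ω *ᵥ ⇑h)))| ≤
        √N ^ 2 * K N ω * ‖h‖ ^ 3)
    (hM : ∀ a b, TendstoInMeasure P (fun N ω => M N ω a b) atTop fun _ => - I a b)
    (hK : Tendsto (fun N => P {ω | κ < K N ω}) atTop (𝓝 0))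
    (hΔ : ∀ δ : ENNReal, 0 < δ → ∃ B : ℝ, ∀ N, P {ω | B < ‖Δ N ω‖} ≤ δ)
    (g : ℕ → Ω → EuclideanSpace ℝ ι) (hg : ∀ N ω, ‖g N ω‖ ≤ ρ)
    (hmax : ∀ N ω h, ‖h‖ ≤ ρ → L N ω h ≤ L N ω (g N ω)) :
    Tendsto (fun N => P {ω | ρ ≤ ‖g N ω‖}) atTop (𝓝 0) ∧
    TendstoInMeasure P (fun (N : ℕ) ω => √N • g N ω - WithLp.toLp 2 (I⁻¹ *ᵥ ⇑(Δ N ω)))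
      atTop (fun _ => (0 : EuclideanSpace ℝ ι)) := by
  have hs : Tendsto (fun N : ℕ => √(N : ℝ)) atTop atTop :=
    Real.tendsto_sqrt_atTop.comp tendsto_natCast_atTop_atTop
  have main : ∀ ε : ℝ, 0 < ε → Tendsto (fun N => P ({ω | ρ ≤ ‖g N ω‖} ∪
      {ω | ε ≤ ‖√(N : ℝ) • g N ω - WithLp.toLp 2 (I⁻¹ *ᵥ ⇑(Δ N ω))‖})) atTop (𝓝 0) := by
    intro ε hε
    rw [ENNReal.tendsto_nhds_zero]
    intro δ hδ
    obtain ⟨B, hB⟩ := hΔ (δ / 2) (ENNReal.half_pos hδ.ne')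
    set B' : ℝ := 4 * |B| / c with hB'
    -- The first term meets the requirement of `argmax_near_of_quadratic`; the second makes the
    -- contribution of `η` to the final error smaller than half of `ε ^ 2`.
    set η : ℝ := min (c / 8) (c * ε ^ 2 / (8 * (B' ^ 2 + 1))) with hη
    have hηpos : 0 < η := by positivity
    have h1 := (tendsto_measure_sum_abs_add hM hηpos).add hK
    rw [add_zero] at h1
    have hs0 : Tendsto (fun N : ℕ => κ * B' ^ 3 / √(N : ℝ)) atTop (𝓝 0) :=
      hs.const_div_atTop _
    filter_upwards [hs.eventually_gt_atTop 0, hs.eventually_gt_atTop (B' / ρ),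
      hs0.eventually_lt_const (show 0 < c * ε ^ 2 / 8 by positivity),
      h1.eventually_le_const (ENNReal.half_pos hδ.ne')] with N hN1 hN2 hN3 hN4
    have hsub : ({ω | ρ ≤ ‖g N ω‖} ∪
        {ω | ε ≤ ‖√(N : ℝ) • g N ω - WithLp.toLp 2 (I⁻¹ *ᵥ ⇑(Δ N ω))‖}) ⊆
        ({ω | η < ∑ a, ∑ b, |M N ω a b + I a b|} ∪ {ω | κ < K N ω}) ∪ {ω | B < ‖Δ N ω‖} := by
      intro ω hω
      by_contra h
      simp only [Set.mem_union, Set.mem_ofPred_eq, not_or, not_lt] at h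
      obtain ⟨⟨hm, hk⟩, hd⟩ := h
      obtain ⟨r1, r2⟩ := argmax_near_of_quadratic (B := |B|) hN1 hκ hρ hc hIsymm hI
        (fun h' hh' => (hexp N ω h' hh').trans (by gcongr)) hm (min_le_left _ _) hκρ
        (hd.trans (le_abs_self _)) (hg N ω) (hmax N ω)
      rw [div_lt_iff₀ hρ] at hN2
      rcases hω with hω | hω
      · simp only [Set.mem_ofPred_eq] at hω
        rw [norm_smul, Real.norm_of_nonneg hN1.le] at r1
        have : √(N : ℝ) * ρ ≤ √(N : ℝ) * ‖g N ω‖ := by gcongr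
        linarith
      · simp only [Set.mem_ofPred_eq] at hω
        have r3 := r2 hN2.le
        have r4 : η / 2 * B' ^ 2 < c * ε ^ 2 / 8 := by
          have : η ≤ c * ε ^ 2 / (8 * (B' ^ 2 + 1)) := min_le_right _ _
          rw [le_div_iff₀ (by positivity)] at this
          nlinarith
        have r5 : 4 / c * (κ * B' ^ 3 / √(N : ℝ) + η / 2 * B' ^ 2) < ε ^ 2 := by
          calc _ < 4 / c * (c * ε ^ 2 / 8 + c * ε ^ 2 / 8) := by gcongr
            _ = ε ^ 2 := by field_simp; norm_num
        have r6 : ε ^ 2 ≤ ‖√(N : ℝ) • g N ω - WithLp.toLp 2 (I⁻¹ *ᵥ ⇑(Δ N ω))‖ ^ 2 := by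
          gcongr
        linarith
    calc _ ≤ _ := measure_mono hsub
      _ ≤ _ := measure_union_le _ _
      _ ≤ δ / 2 + δ / 2 := add_le_add ((measure_union_le _ _).trans hN4) (hB N)
      _ = δ := ENNReal.add_halves δ
  constructor
  · exact tendsto_of_tendsto_of_tendsto_of_le_of_le tendsto_const_nhds (main 1 one_pos)
      (fun _ => zero_le) fun N => measure_mono Set.subset_union_left
  · rw [tendstoInMeasure_iff_norm]
    intro ε hε
    simp only [sub_zero]
    exact tendsto_of_tendsto_of_tendsto_of_le_of_le tendsto_const_nhds (main ε hε)
      (fun _ => zero_le) fun N => measure_mono Set.subset_union_right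

end Probability

end IOU

end

/-! ### Limit theorems for independent, not identically distributed variables. -/

noncomputable section

namespace IOU

section LimitTheorems

variable {Ω : Type*} [MeasurableSpace Ω] {P : Measure Ω}

/-- A weak law of large numbers for independent, not identically distributed random variables. -/
theorem tendstoInMeasure_average [IsProbabilityMeasure P] {X : ℕ → Ω → ℝ} (hind : iIndepFun X P)
    (h2 : ∀ i, MemLp (X i) 2 P) {C : ℝ} (hC : ∀ i, ∫ ω, X i ω ^ 2 ∂P ≤ C) {a : ℝ}
    (ha : Tendsto (fun N : ℕ => (N : ℝ)⁻¹ * ∑ i : Fin N, ∫ ω, X i ω ∂P) atTop (𝓝 a)) :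
    TendstoInMeasure P (fun (N : ℕ) ω => (N : ℝ)⁻¹ * ∑ i : Fin N, X i ω) atTop fun _ => a := by
  rw [tendstoInMeasure_iff_norm]
  intro ε hε
  have hC0 : 0 ≤ C := (integral_nonneg fun ω => sq_nonneg _).trans (hC 0)
  have hlim : Tendsto (fun N : ℕ => ENNReal.ofReal (C / N / (ε / 2) ^ 2)) atTop (𝓝 0) := by
    rw [← ENNReal.ofReal_zero]
    apply ENNReal.tendsto_ofReal
    have := (tendsto_const_div_atTop_nhds_zero_nat C).div_const ((ε / 2) ^ 2)
    simpa using this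
  have hm := (tendsto_iff_norm_sub_tendsto_zero.1 ha).eventually_lt_const (half_pos hε)
  refine tendsto_of_tendsto_of_tendsto_of_le_of_le' tendsto_const_nhds hlim
    (Eventually.of_forall fun _ => zero_le) ?_
  filter_upwards [hm, eventually_gt_atTop 0] with N hN hN0
  have hN0' : (0 : ℝ) < N := by exact_mod_cast hN0
  have hsum2 : MemLp (∑ i : Fin N, X i) 2 P := memLp_finsetSum' _ fun i _ => h2 i
  have hA2 : MemLp (fun ω => (N : ℝ)⁻¹ * ∑ i : Fin N, X i ω) 2 P := by
    have := hsum2.const_mul (N : ℝ)⁻¹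
    simpa [Finset.sum_apply] using this
  have hmean : ∫ ω, (N : ℝ)⁻¹ * ∑ i : Fin N, X i ω ∂P = (N : ℝ)⁻¹ * ∑ i : Fin N, ∫ ω, X i ω ∂P := by
    rw [integral_const_mul, integral_finsetSum]
    exact fun i _ => (h2 i).integrable one_le_two
  have hvar : Var[fun ω => (N : ℝ)⁻¹ * ∑ i : Fin N, X i ω; P] ≤ C / N := by
    rw [variance_const_mul]
    have h3 : Var[fun ω => ∑ i : Fin N, X i ω; P] = ∑ i : Fin N, Var[X i; P] := by
      have := IndepFun.variance_sum (μ := P) (X := fun i : Fin N => X i) (s := Finset.univ)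
        (fun i _ => h2 i) (fun i _ j _ hij => hind.indepFun (fun h => hij (Fin.ext h)))
      rw [← this]
      congr 1
      ext ω
      simp
    rw [h3]
    have h4 : ∑ i : Fin N, Var[X i; P] ≤ N * C := by
      calc _ ≤ ∑ i : Fin N, C := Finset.sum_le_sum fun i _ =>
            (variance_le_expectation_sq (h2 i).aestronglyMeasurable).trans (hC i)
        _ = N * C := by simp
    calc (N : ℝ)⁻¹ ^ 2 * ∑ i : Fin N, Var[X i; P] ≤ (N : ℝ)⁻¹ ^ 2 * (N * C) := by gcongr
      _ = C / N := by field_simp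
  calc _ ≤ P {ω | ε / 2 ≤ |(N : ℝ)⁻¹ * ∑ i : Fin N, X i ω -
        ∫ ω, (N : ℝ)⁻¹ * ∑ i : Fin N, X i ω ∂P|} := by
        apply measure_mono
        intro ω hω
        simp only [Set.mem_ofPred_eq, Real.norm_eq_abs] at hω hN ⊢
        rw [hmean]
        have := abs_sub_le ((N : ℝ)⁻¹ * ∑ i : Fin N, X i ω)
          ((N : ℝ)⁻¹ * ∑ i : Fin N, ∫ ω, X i ω ∂P) a
        linarith
    _ ≤ _ := meas_ge_le_variance_div_sq hA2 (half_pos hε)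
    _ ≤ _ := by gcongr

/-- Telescoping in the closed unit disc. It allows the characteristic function of a sum to be
compared with its Gaussian counterpart factor by factor. -/
theorem norm_prod_sub_prod_le {J : Type*} (s : Finset J) (a b : J → ℂ) (ha : ∀ j ∈ s, ‖a j‖ ≤ 1)
    (hb : ∀ j ∈ s, ‖b j‖ ≤ 1) : ‖∏ j ∈ s, a j - ∏ j ∈ s, b j‖ ≤ ∑ j ∈ s, ‖a j - b j‖ := by
  classical
  induction s using Finset.induction_on with
  | empty => simp
  | insert x s hx ih =>
    rw [Finset.prod_insert hx, Finset.prod_insert hx, Finset.sum_insert hx]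
    have h1 := ih (fun j hj => ha j (Finset.mem_insert_of_mem hj))
      fun j hj => hb j (Finset.mem_insert_of_mem hj)
    have h2 : ‖∏ j ∈ s, a j‖ ≤ 1 := by
      rw [norm_prod]
      exact Finset.prod_le_one (fun _ _ => norm_nonneg _)
        fun j hj => ha j (Finset.mem_insert_of_mem hj)
    have h3 := hb x (Finset.mem_insert_self _ _)
    calc ‖a x * ∏ j ∈ s, a j - b x * ∏ j ∈ s, b j‖
        = ‖(a x - b x) * ∏ j ∈ s, a j + b x * (∏ j ∈ s, a j - ∏ j ∈ s, b j)‖ := by ring_nf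
      _ ≤ ‖a x - b x‖ * ‖∏ j ∈ s, a j‖ + ‖b x‖ * ‖∏ j ∈ s, a j - ∏ j ∈ s, b j‖ := by
          rw [← norm_mul, ← norm_mul]; exact norm_add_le _ _
      _ ≤ ‖a x - b x‖ * 1 + 1 * ∑ j ∈ s, ‖a j - b j‖ := by gcongr
      _ = _ := by ring

/-- For `|x| ≤ 1` this is the remainder of the power series; for `|x| > 1` the separate terms are
already of cubic size. A bound valid for all `x` lets third absolute moments suffice without
truncation. -/
theorem norm_exp_mul_I_sub_taylor_le (x : ℝ) :
    ‖Complex.exp (x * Complex.I) - (1 + x * Complex.I - x ^ 2 / 2)‖ ≤ 4 * |x| ^ 3 := by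
  have hn : ‖(x : ℂ) * Complex.I‖ = |x| := by simp
  have hsum : ∑ m ∈ Finset.range 3, ((x : ℂ) * Complex.I) ^ m / (m.factorial : ℂ) =
      1 + x * Complex.I - x ^ 2 / 2 := by
    simp [Finset.sum_range_succ, mul_pow, Nat.factorial]
    ring
  rcases le_or_gt |x| 1 with h | h
  · have := Complex.exp_bound (x := (x : ℂ) * Complex.I) (by rwa [hn]) (n := 3) (by norm_num)
    rw [hsum, hn] at this
    refine this.trans ?_
    have h3 : 0 ≤ |x| ^ 3 := by positivity
    norm_num [Nat.factorial]
    nlinarith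
  · have h1 : ‖Complex.exp (x * Complex.I)‖ = 1 := Complex.norm_exp_ofReal_mul_I x
    have h2 : ‖(1 : ℂ) + x * Complex.I - x ^ 2 / 2‖ ≤ 1 + |x| + |x| ^ 2 / 2 := by
      refine (norm_sub_le _ _).trans (add_le_add ((norm_add_le _ _).trans ?_) ?_)
      · rw [hn]; simp
      · simp
    refine (norm_sub_le _ _).trans ?_
    rw [h1]
    nlinarith [sq_nonneg (|x| - 1), mul_pos (sub_pos.2 h) (sub_pos.2 h),
      mul_pos (mul_pos (sub_pos.2 h) (sub_pos.2 h)) (sub_pos.2 h)]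

theorem norm_integral_exp_sub_le [IsProbabilityMeasure P] {ξ : Ω → ℝ} (h3 : MemLp ξ 3 P)
    (h0 : ∫ ω, ξ ω ∂P = 0) (s : ℝ) :
    ‖∫ ω, Complex.exp ((s * ξ ω : ℝ) * Complex.I) ∂P -
      (1 - s ^ 2 * (∫ ω, ξ ω ^ 2 ∂P) / 2 : ℝ)‖ ≤ 4 * |s| ^ 3 * ∫ ω, |ξ ω| ^ 3 ∂P := by
  have hm := h3.aestronglyMeasurable
  have i1 : Integrable ξ P := h3.integrable (by norm_num)
  have i2 : Integrable (fun ω => ξ ω ^ 2) P :=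
    (h3.mono_exponent (show (2 : ENNReal) ≤ 3 by norm_num)).integrable_sq
  have i3 : Integrable (fun ω => |ξ ω| ^ 3) P := by
    simpa using h3.integrable_norm_pow (by norm_num)
  have ie : Integrable (fun ω => Complex.exp ((s * ξ ω : ℝ) * Complex.I)) P := by
    refine Integrable.of_bound (C := 1) ?_ (Eventually.of_forall fun ω => ?_)
    · exact Complex.continuous_exp.comp_aestronglyMeasurable
        ((Complex.continuous_ofReal.comp_aestronglyMeasurable (hm.const_mul s)).mul_const _)
    · rw [Complex.norm_exp_ofReal_mul_I]
  have i1' : Integrable (fun ω => ((s * ξ ω : ℝ) : ℂ) * Complex.I) P :=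
    ((i1.const_mul s).ofReal).mul_const _
  have i2' : Integrable (fun ω => (((s * ξ ω : ℝ) : ℂ)) ^ 2 / 2) P := by
    have : Integrable (fun ω => (((s ^ 2 / 2 * ξ ω ^ 2 : ℝ)) : ℂ)) P := (i2.const_mul _).ofReal
    refine this.congr (Eventually.of_forall fun ω => ?_)
    push_cast
    ring
  have i01 : Integrable (fun ω => (1 : ℂ) + ((s * ξ ω : ℝ) : ℂ) * Complex.I) P :=
    (integrable_const _).add i1'
  have i012 : Integrable (fun ω => (1 : ℂ) + ((s * ξ ω : ℝ) : ℂ) * Complex.I -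
      (((s * ξ ω : ℝ) : ℂ)) ^ 2 / 2) P := i01.sub i2'
  have hT : ∫ ω, ((1 : ℂ) + ((s * ξ ω : ℝ) : ℂ) * Complex.I - (((s * ξ ω : ℝ) : ℂ)) ^ 2 / 2) ∂P =
      ((1 - s ^ 2 * (∫ ω, ξ ω ^ 2 ∂P) / 2 : ℝ) : ℂ) := by
    rw [integral_sub i01 i2', integral_add (integrable_const _) i1',
      integral_mul_const, integral_complex_ofReal, integral_const_mul, h0]
    have : ∫ ω, (((s * ξ ω : ℝ) : ℂ)) ^ 2 / 2 ∂P =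
        ((s ^ 2 / 2 * ∫ ω, ξ ω ^ 2 ∂P : ℝ) : ℂ) := by
      rw [← integral_const_mul, ← integral_complex_ofReal]
      congr 1
      ext ω
      push_cast
      ring
    rw [this]
    simp
    ring
  rw [← hT, ← integral_sub ie i012]
  refine (norm_integral_le_integral_norm _).trans ?_
  rw [← integral_const_mul]
  refine integral_mono (ie.sub i012).norm
    (i3.const_mul _) fun ω => ?_
  refine (norm_exp_mul_I_sub_taylor_le _).trans_eq ?_
  simp only [abs_mul]
  ring

variable {ι : Type*} [Fintype ι]

/-- A central limit theorem of Lyapunov type for independent random vectors. -/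
theorem tendstoInDistribution_inv_sqrt_smul_sum [DecidableEq ι] [IsProbabilityMeasure P]
    {S : ℕ → Ω → EuclideanSpace ℝ ι} (hind : iIndepFun S P) (hS : ∀ i, Measurable (S i))
    (h3 : ∀ i, MemLp (S i) 3 P) {C : ℝ} (hC : ∀ i, ∫ ω, ‖S i ω‖ ^ 3 ∂P ≤ C)
    (h0 : ∀ i u, ∫ ω, inner ℝ (S i ω) u ∂P = 0) {I : Matrix ι ι ℝ} (hI : I.PosSemidef)
    (hvar : ∀ u : EuclideanSpace ℝ ι,
      Tendsto (fun N : ℕ => (N : ℝ)⁻¹ * ∑ i : Fin N, ∫ ω, inner ℝ (S i ω) u ^ 2 ∂P) atTop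
        (𝓝 (⇑u ⬝ᵥ (I *ᵥ ⇑u)))) :
    TendstoInDistribution (fun (N : ℕ) ω => (√N)⁻¹ • ∑ i : Fin N, S i ω) atTop id (fun _ => P)
      (multivariateGaussian 0 I) where
  forall_aemeasurable N := by fun_prop
  aemeasurable_limit := aemeasurable_id
  tendsto := by
    refine ProbabilityMeasure.tendsto_iff_tendsto_charFun.2 fun u => ?_
    simp only [ProbabilityMeasure.coe_mk, Measure.map_id, charFun_multivariateGaussian hI]
    set σ : ℕ → ℝ := fun i => ∫ ω, inner ℝ (S i ω) u ^ 2 ∂P with hσ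
    have hξ3 : ∀ i, MemLp (fun ω => inner ℝ (S i ω) u) 3 P := fun i => by
      refine ((h3 i).norm.mul_const ‖u‖).mono (by fun_prop) (Eventually.of_forall fun ω => ?_)
      simpa using abs_real_inner_le_norm (S i ω) u
    have hC0 : 0 ≤ C := (integral_nonneg fun ω => by positivity).trans (hC 0)
    have hξC : ∀ i, ∫ ω, |inner ℝ (S i ω) u| ^ 3 ∂P ≤ C * ‖u‖ ^ 3 := fun i => by
      have i3 : Integrable (fun ω => ‖S i ω‖ ^ 3) P := (h3 i).integrable_norm_pow (by norm_num)
      calc _ ≤ ∫ ω, ‖S i ω‖ ^ 3 * ‖u‖ ^ 3 ∂P := by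
            refine integral_mono ?_ (i3.mul_const _) fun ω => ?_
            · simpa using (hξ3 i).integrable_norm_pow (by norm_num)
            · simp only [← mul_pow]
              gcongr
              exact abs_real_inner_le_norm _ _
        _ = (∫ ω, ‖S i ω‖ ^ 3 ∂P) * ‖u‖ ^ 3 := integral_mul_const _ _
        _ ≤ _ := by gcongr; exact hC i
    -- A common bound for the third absolute moments and the variances; the `+ 1` comes from `x² ≤
    -- |x|³ + 1`.
    set D : ℝ := C * ‖u‖ ^ 3 + 1 with hD
    have hD1 : 1 ≤ D := by
      have : 0 ≤ C * ‖u‖ ^ 3 := by positivity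
      linarith
    have hσ0 : ∀ i, 0 ≤ σ i := fun i => integral_nonneg fun ω => sq_nonneg _
    have hσD : ∀ i, σ i ≤ D := fun i => by
      have i2 : Integrable (fun ω => inner ℝ (S i ω) u ^ 2) P :=
        ((hξ3 i).mono_exponent (show (2 : ENNReal) ≤ 3 by norm_num)).integrable_sq
      have i3 : Integrable (fun ω => |inner ℝ (S i ω) u| ^ 3) P := by
        simpa using (hξ3 i).integrable_norm_pow (by norm_num)
      calc σ i ≤ ∫ ω, (|inner ℝ (S i ω) u| ^ 3 + 1) ∂P := by
            refine integral_mono i2 (i3.add (integrable_const _)) fun ω => ?_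
            change inner ℝ (S i ω) u ^ 2 ≤ |inner ℝ (S i ω) u| ^ 3 + 1
            rw [← sq_abs]
            rcases le_total |inner ℝ (S i ω) u| 1 with h | h
            · have := pow_le_one₀ (n := 2) (abs_nonneg (inner ℝ (S i ω) u)) h
              have := pow_nonneg (abs_nonneg (inner ℝ (S i ω) u)) 3
              linarith
            · have := pow_le_pow_right₀ h (show 2 ≤ 3 by norm_num)
              linarith
        _ = (∫ ω, |inner ℝ (S i ω) u| ^ 3 ∂P) + 1 := by
            rw [integral_add i3 (integrable_const _)]; simp
        _ ≤ D := by linarith [hξC i]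
    have hchar : ∀ N : ℕ, charFun (P.map fun ω => (√N)⁻¹ • ∑ i : Fin N, S i ω) u =
        ∏ i : Fin N, ∫ ω, Complex.exp (((√N)⁻¹ * inner ℝ (S i ω) u : ℝ) * Complex.I) ∂P := by
      intro N
      rw [charFun_map_smul_comp (by fun_prop), iIndepFun.charFun_map_fun_sum_eq_prod (X := fun i : Fin N => S i)
          (fun i => (hS i).aemeasurable) (hind.precomp Fin.val_injective),
        Finset.prod_apply]
      refine Finset.prod_congr rfl fun i _ => ?_
      rw [charFun_apply, integral_map (hS i).aemeasurable (by fun_prop)]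
      simp only [inner_smul_right]
    have hexp_prod : ∀ N : ℕ, (∏ i : Fin N, Complex.exp ((-((√N)⁻¹ ^ 2 * σ i / 2) : ℝ) : ℂ)) =
        Complex.exp ((-((N : ℝ)⁻¹ * ∑ i : Fin N, σ i) / 2 : ℝ) : ℂ) := by
      intro N
      rw [← Complex.exp_sum, ← Complex.ofReal_sum]
      congr 2
      rw [inv_pow, Real.sq_sqrt (Nat.cast_nonneg N), Finset.sum_neg_distrib, ← Finset.sum_div,
        ← Finset.mul_sum, neg_div]
    have hlim2 : Tendsto (fun N : ℕ =>
        Complex.exp ((-((N : ℝ)⁻¹ * ∑ i : Fin N, σ i) / 2 : ℝ) : ℂ)) atTop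
        (𝓝 (Complex.exp (-(⇑u ⬝ᵥ (I *ᵥ ⇑u) : ℝ) / 2))) := by
      have := (Complex.continuous_exp.comp Complex.continuous_ofReal).continuousAt.tendsto.comp
        ((hvar u).neg.div_const 2)
      simpa [Function.comp_def] using this
    -- Replacing one factor by `exp (-σ i / (2N))` costs a multiple of `N^{-3/2}`, and there are `N`
    -- factors. The single variances need not converge; only their average enters the limit.
    have hdiff : Tendsto (fun N : ℕ => charFun (P.map fun ω => (√N)⁻¹ • ∑ i : Fin N, S i ω) u -
        Complex.exp ((-((N : ℝ)⁻¹ * ∑ i : Fin N, σ i) / 2 : ℝ) : ℂ)) atTop (𝓝 0) := by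
      have hs : Tendsto (fun N : ℕ => √(N : ℝ)) atTop atTop :=
        Real.tendsto_sqrt_atTop.comp tendsto_natCast_atTop_atTop
      have hb : Tendsto (fun N : ℕ => 5 * D ^ 2 / √(N : ℝ)) atTop (𝓝 0) := hs.const_div_atTop _
      refine squeeze_zero_norm' ?_ hb
      -- For `√N ≥ D` the exponents lie in the range where `exp (-z) - 1 + z` is bounded by `z ^ 2`.
      filter_upwards [hs.eventually_ge_atTop D] with N hN
      have hsN : 0 < √(N : ℝ) := by linarith
      have hsq : √(N : ℝ) ^ 2 = N := Real.sq_sqrt (Nat.cast_nonneg N)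
      rw [hchar, ← hexp_prod]
      refine (norm_prod_sub_prod_le _ _ _ (fun i _ => ?_) fun i _ => ?_).trans ?_
      · refine (norm_integral_le_integral_norm _).trans_eq ?_
        simp [-Complex.ofReal_mul, Complex.norm_exp_ofReal_mul_I]
      · rw [Complex.norm_exp, Complex.ofReal_re, Real.exp_le_one_iff, neg_nonpos]
        have := hσ0 i
        positivity
      · have hterm : ∀ i : Fin N,
            ‖∫ ω, Complex.exp (((√N)⁻¹ * inner ℝ (S i ω) u : ℝ) * Complex.I) ∂P -
              Complex.exp ((-((√N)⁻¹ ^ 2 * σ i / 2) : ℝ) : ℂ)‖ ≤ 5 * D ^ 2 * (√(N : ℝ))⁻¹ ^ 3 := by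
          intro i
          have h1 := norm_integral_exp_sub_le (hξ3 i) (h0 i u) (√(N : ℝ))⁻¹
          set s := (√(N : ℝ))⁻¹ with hsdef
          have hs0 : 0 < s := by positivity
          have hsD : s * D ≤ 1 := by
            rw [hsdef, inv_mul_le_iff₀ hsN]; linarith
          have hs1 : s ≤ 1 := by nlinarith
          set z := s ^ 2 * σ i / 2 with hz
          have hz0 : 0 ≤ z := by have := hσ0 i; positivity
          have hzs : z ≤ s ^ 2 * D / 2 := by rw [hz]; gcongr; exact hσD i
          have hz1 : z ≤ 1 := by nlinarith
          have h2 := Real.abs_exp_sub_one_sub_id_le (x := -z) (by rw [abs_neg, abs_of_nonneg hz0]; exact hz1)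
          have h3 : ‖((1 - z : ℝ) : ℂ) - Complex.exp ((-z : ℝ) : ℂ)‖ ≤ z ^ 2 := by
            rw [← Complex.ofReal_exp, ← Complex.ofReal_sub, Complex.norm_real, Real.norm_eq_abs,
              abs_sub_comm]
            have e : Real.exp (-z) - (1 - z) = Real.exp (-z) - 1 - -z := by ring
            rw [e]
            simpa using h2
          have h4 : z ^ 2 ≤ s ^ 3 * D ^ 2 := by
            calc z ^ 2 ≤ (s ^ 2 * D / 2) ^ 2 := by gcongr
              _ = s ^ 3 * D ^ 2 * (s / 4) := by ring
              _ ≤ s ^ 3 * D ^ 2 * 1 := by gcongr; linarith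
              _ = _ := mul_one _
          have h5 : 4 * |s| ^ 3 * ∫ ω, |inner ℝ (S i ω) u| ^ 3 ∂P ≤ 4 * s ^ 3 * D ^ 2 := by
            rw [abs_of_pos hs0]
            gcongr
            have := hξC i
            nlinarith
          calc _ ≤ _ := norm_sub_le_norm_sub_add_norm_sub _ ((1 - z : ℝ) : ℂ) _
            _ ≤ 4 * s ^ 3 * D ^ 2 + s ^ 3 * D ^ 2 := add_le_add (h1.trans h5) (h3.trans h4)
            _ = _ := by ring
        calc _ ≤ ∑ i : Fin N, 5 * D ^ 2 * (√(N : ℝ))⁻¹ ^ 3 := Finset.sum_le_sum fun i _ => hterm i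
          _ = (√(N : ℝ) ^ 2) * (5 * D ^ 2 * (√(N : ℝ))⁻¹ ^ 3) := by rw [hsq]; simp
          _ = _ := by field_simp
    have := hdiff.add hlim2
    simp only [sub_add_cancel, zero_add] at this
    convert this using 2
    simp [neg_div]

/-- A sequence that converges in distribution is bounded in probability. -/
theorem exists_measure_norm_gt_le_of_tendstoInDistribution [IsProbabilityMeasure P]
    {X : ℕ → Ω → EuclideanSpace ℝ ι} {Ω' : Type*} [MeasurableSpace Ω'] {P' : Measure Ω'}
    [IsProbabilityMeasure P'] {Z : Ω' → EuclideanSpace ℝ ι}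
    (h : TendstoInDistribution X atTop Z (fun _ => P) P') (δ : ENNReal) (hδ : 0 < δ) :
    ∃ B : ℝ, ∀ N, P {ω | B < ‖X N ω‖} ≤ δ := by
  have h1 := ProbabilityMeasure.tendsto_iff_tendsto_charFun.1 h.tendsto
  have : ∀ N, IsProbabilityMeasure (P.map (X N)) := fun N =>
    Measure.isProbabilityMeasure_map (h.forall_aemeasurable N)
  have : IsProbabilityMeasure (P'.map Z) := Measure.isProbabilityMeasure_map h.aemeasurable_limit
  -- Pointwise convergence of the characteristic functions to a function continuous at `0` makes the
  -- whole sequence tight, so one `B` serves every `N`, not only large ones.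
  have h2 : IsTightMeasureSet (Set.range fun N => P.map (X N)) :=
    isTightMeasureSet_of_tendsto_charFun (f := charFun (P'.map Z)) (by fun_prop) h1
  rw [isTightMeasureSet_iff_tendsto_measure_norm_gt] at h2
  obtain ⟨B, hB⟩ := (h2.eventually_le_const hδ).exists
  refine ⟨B, fun N => ?_⟩
  have h3 : P.map (X N) {x | B < ‖x‖} ≤ δ :=
    (le_iSup₂ (f := fun (μ : Measure (EuclideanSpace ℝ ι)) (_ : μ ∈ Set.range fun N => P.map (X N))
      => μ {x | B < ‖x‖}) _ ⟨N, rfl⟩).trans hB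
  rwa [Measure.map_apply_of_aemeasurable (h.forall_aemeasurable N)
    (measurableSet_lt measurable_const measurable_norm)] at h3

end LimitTheorems

end IOU

end

/-! ### Moments of linear and quadratic forms in Gaussian vectors. -/

noncomputable section

namespace IOU

section GaussianMoments

/-- Repeated differentiation of `f' = v t f`. Since `f` is the moment generating function of `N(0,
v)`, the value at `t = 0` is the recursion for Gaussian moments. -/
theorem iteratedDeriv_exp_sq_succ_succ (v : ℝ) (k : ℕ) (t : ℝ) :
    iteratedDeriv (k + 2) (fun t => Real.exp (v * t ^ 2 / 2)) t =
      v * t * iteratedDeriv (k + 1) (fun t => Real.exp (v * t ^ 2 / 2)) t +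
        (k + 1) * v * iteratedDeriv k (fun t => Real.exp (v * t ^ 2 / 2)) t := by
  set f : ℝ → ℝ := fun t => Real.exp (v * t ^ 2 / 2) with hf
  have hsmooth : ContDiff ℝ ⊤ f := by fun_prop
  have hd : ∀ k t, HasDerivAt (iteratedDeriv k f) (iteratedDeriv (k + 1) f t) t := fun k t => by
    rw [iteratedDeriv_succ]
    exact ((hsmooth.differentiable_iteratedDeriv k (by exact_mod_cast WithTop.coe_lt_top _)) t).hasDerivAt
  have h1 : ∀ t, iteratedDeriv 1 f t = v * t * f t := fun t => by
    rw [iteratedDeriv_one]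
    have : HasDerivAt f (Real.exp (v * t ^ 2 / 2) * (v * (2 * t) / 2)) t := by
      have := (((hasDerivAt_pow 2 t).const_mul v).div_const 2).exp
      simpa using this
    rw [this.deriv]
    simp only [hf]
    ring
  induction k generalizing t with
  | zero =>
    have h2 : HasDerivAt (iteratedDeriv 1 f) (v * f t + v * t * iteratedDeriv 1 f t) t := by
      have e : iteratedDeriv 1 f = fun t => v * t * f t := funext h1
      have h0 := hd 0 t
      rw [iteratedDeriv_zero, zero_add] at h0
      have := ((hasDerivAt_id t).const_mul v).mul h0
      rw [e]
      convert! this using 1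
      rw [← e]
      simp
    have := (hd 1 t).unique h2
    simp only [iteratedDeriv_zero]
    rw [this]
    push_cast
    ring
  | succ k ih =>
    have e : iteratedDeriv (k + 2) f = fun t => v * t * iteratedDeriv (k + 1) f t +
        (k + 1) * v * iteratedDeriv k f t := funext ih
    have h2 : HasDerivAt (iteratedDeriv (k + 2) f) (v * iteratedDeriv (k + 1) f t +
        v * t * iteratedDeriv (k + 2) f t + (k + 1) * v * iteratedDeriv (k + 1) f t) t := by
      have := (((hasDerivAt_id t).const_mul v).mul (hd (k + 1) t)).add
        ((hd k t).const_mul ((k + 1) * v))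
      rw [e]
      convert! this using 1
      rw [← e]
      simp
    have := (hd (k + 2) t).unique h2
    rw [show k + 1 + 2 = k + 2 + 1 by ring, this]
    push_cast
    ring

theorem integral_pow_gaussianReal_succ_succ (v : ℝ≥0) (k : ℕ) :
    ∫ x, x ^ (k + 2) ∂(gaussianReal 0 v) = (k + 1) * v * ∫ x, x ^ k ∂(gaussianReal 0 v) := by
  have h : ∀ k, iteratedDeriv k (fun t => Real.exp (v * t ^ 2 / 2)) 0 =
      ∫ x, x ^ k ∂(gaussianReal 0 v) := fun k => by
    have h1 := iteratedDeriv_mgf_zero (X := id) (μ := gaussianReal 0 v)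
      (by simp [integrableExpSet_id_gaussianReal]) k
    rw [mgf_id_gaussianReal] at h1
    simpa using h1
  rw [← h, ← h, iteratedDeriv_exp_sq_succ_succ]
  simp

theorem integral_pow_three_gaussianReal (v : ℝ≥0) : ∫ x, x ^ 3 ∂(gaussianReal 0 v) = 0 := by
  rw [integral_pow_gaussianReal_succ_succ]
  simp [integral_id_gaussianReal]

theorem integral_pow_four_gaussianReal (v : ℝ≥0) :
    ∫ x, x ^ 4 ∂(gaussianReal 0 v) = 3 * (v : ℝ) ^ 2 := by
  rw [integral_pow_gaussianReal_succ_succ, integral_pow_gaussianReal_succ_succ]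
  simp
  ring

theorem integral_pow_six_gaussianReal (v : ℝ≥0) :
    ∫ x, x ^ 6 ∂(gaussianReal 0 v) = 15 * (v : ℝ) ^ 3 := by
  rw [integral_pow_gaussianReal_succ_succ, integral_pow_four_gaussianReal]
  push_cast
  ring

variable {ι : Type*} [Fintype ι] {S : Matrix ι ι ℝ}

theorem abs_dotProduct_coe_le (x : ι → ℝ) (e : EuclideanSpace ℝ ι) :
    |x ⬝ᵥ ⇑e| ≤ ‖WithLp.toLp 2 x‖ * ‖e‖ := abs_dotProduct_le (WithLp.toLp 2 x) e

theorem quadraticForm_nonneg (hS : S.PosSemidef) (x : ι → ℝ) : 0 ≤ x ⬝ᵥ (S *ᵥ x) := by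
  simpa using hS.dotProduct_mulVec_nonneg x

variable [DecidableEq ι]

theorem map_dotProduct_multivariateGaussian (hS : S.PosSemidef) (x : ι → ℝ) :
    (multivariateGaussian 0 S).map (fun e : EuclideanSpace ℝ ι => x ⬝ᵥ ⇑e) =
      gaussianReal 0 (x ⬝ᵥ (S *ᵥ x)).toNNReal := by
  set L : StrongDual ℝ (EuclideanSpace ℝ ι) := innerSL ℝ (WithLp.toLp 2 x) with hL
  have hLx : (fun e : EuclideanSpace ℝ ι => x ⬝ᵥ ⇑e) = L := by
    ext e
    simp [hL, EuclideanSpace.inner_eq_star_dotProduct, dotProduct_comm]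
  rw [hLx, IsGaussian.map_eq_gaussianReal]
  congr 1
  · rw [IsGaussian.integral_dual]; simp
  · congr 1
    have := covarianceBilin_multivariateGaussian (μ := 0) hS (WithLp.toLp 2 x) (WithLp.toLp 2 x)
    rw [← this, covarianceBilin_self IsGaussian.memLp_two_id]
    rfl

theorem integral_dotProduct_pow (hS : S.PosSemidef) (x : ι → ℝ) (k : ℕ) :
    ∫ e : EuclideanSpace ℝ ι, (x ⬝ᵥ ⇑e) ^ k ∂(multivariateGaussian 0 S) =
      ∫ y, y ^ k ∂(gaussianReal 0 (x ⬝ᵥ (S *ᵥ x)).toNNReal) := by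
  rw [← map_dotProduct_multivariateGaussian hS, integral_map]
  · exact (by fun_prop : Measurable fun e : EuclideanSpace ℝ ι => x ⬝ᵥ ⇑e).aemeasurable
  · fun_prop

theorem integrable_one_add_norm_sq_pow (k : ℕ) :
    Integrable (fun e : EuclideanSpace ℝ ι => (1 + ‖e‖ ^ 2) ^ k) (multivariateGaussian 0 S) := by
  have h : (fun e : EuclideanSpace ℝ ι => (1 + ‖e‖ ^ 2) ^ k) =
      fun e => ∑ m ∈ Finset.range (k + 1), ‖e‖ ^ (2 * m) * (k.choose m) := by
    ext e
    rw [add_comm, add_pow]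
    simp [pow_mul]
  rw [h]
  refine integrable_finsetSum _ fun m _ => Integrable.mul_const ?_ _
  rcases Nat.eq_zero_or_pos m with rfl | hm
  · simp
  · have := IsGaussian.memLp_id (multivariateGaussian (0 : EuclideanSpace ℝ ι) S)
      ((2 * m : ℕ) : ENNReal) (ENNReal.natCast_ne_top _)
    exact this.integrable_norm_pow (by omega)

theorem integrable_of_abs_le {f : EuclideanSpace ℝ ι → ℝ} (hf : Continuous f) (C : ℝ) (k : ℕ)
    (h : ∀ e, |f e| ≤ C * (1 + ‖e‖ ^ 2) ^ k) : Integrable f (multivariateGaussian 0 S) :=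
  ((integrable_one_add_norm_sq_pow k).const_mul C).mono' hf.aestronglyMeasurable
    (Eventually.of_forall h)

theorem integrable_dotProduct_pow (x : ι → ℝ) (k : ℕ) :
    Integrable (fun e : EuclideanSpace ℝ ι => (x ⬝ᵥ ⇑e) ^ k) (multivariateGaussian 0 S) := by
  refine integrable_of_abs_le (by fun_prop) (‖WithLp.toLp 2 x‖ ^ k) k fun e => ?_
  rw [abs_pow, ← mul_pow]
  gcongr
  refine (abs_dotProduct_coe_le x e).trans ?_
  gcongr
  nlinarith [sq_nonneg (‖e‖ - 1)]

/-- Polarization: a product of `k` linear forms is a signed sum of `2^(k-1)` powers of order `k` of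
linear forms, divided by `2^(k-1) k!`. Thus the one-dimensional moments determine the mixed ones;
the same device serves for three and four factors. -/
theorem integral_mul_two (hS : S.PosSemidef) (p q : ι → ℝ) :
    ∫ e : EuclideanSpace ℝ ι, (p ⬝ᵥ ⇑e) * (q ⬝ᵥ ⇑e) ∂(multivariateGaussian 0 S) =
      p ⬝ᵥ (S *ᵥ q) := by
  have h : ∀ e : EuclideanSpace ℝ ι, (p ⬝ᵥ ⇑e) * (q ⬝ᵥ ⇑e) =
      ∑ i : Fin 2, ((![1, -1] : Fin 2 → ℝ) i / 4) *
        ((![p + q, p - q] : Fin 2 → ι → ℝ) i ⬝ᵥ ⇑e) ^ 2 := fun e => by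
    simp only [Fin.sum_univ_two, add_dotProduct, sub_dotProduct, Matrix.cons_val]
    ring
  have hsymm : q ⬝ᵥ (S *ᵥ p) = p ⬝ᵥ (S *ᵥ q) := by
    rw [dotProduct_mulVec, ← mulVec_transpose, dotProduct_comm]
    congr 2
    simpa using hS.isHermitian.eq
  have h2 : ∀ x : ι → ℝ, ∫ e : EuclideanSpace ℝ ι, (x ⬝ᵥ ⇑e) ^ 2 ∂(multivariateGaussian 0 S) =
      x ⬝ᵥ (S *ᵥ x) := fun x => by
    rw [integral_dotProduct_pow hS, integral_pow_gaussianReal_succ_succ _ 0]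
    simp [quadraticForm_nonneg hS x]
  simp_rw [h]
  rw [integral_finsetSum _ fun i _ => (integrable_dotProduct_pow _ _).const_mul _]
  simp_rw [integral_const_mul, h2]
  simp only [Fin.sum_univ_two, add_dotProduct, sub_dotProduct, mulVec_add, mulVec_sub,
    dotProduct_add, dotProduct_sub, Matrix.cons_val, hsymm]
  ring

theorem integral_mul_three (hS : S.PosSemidef) (p q r : ι → ℝ) :
    ∫ e : EuclideanSpace ℝ ι, (p ⬝ᵥ ⇑e) * (q ⬝ᵥ ⇑e) * (r ⬝ᵥ ⇑e)
      ∂(multivariateGaussian 0 S) = 0 := by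
  have h : ∀ e : EuclideanSpace ℝ ι, (p ⬝ᵥ ⇑e) * (q ⬝ᵥ ⇑e) * (r ⬝ᵥ ⇑e) =
      ∑ i : Fin 4, ((![1, -1, -1, 1] : Fin 4 → ℝ) i / 24) *
        ((![p + q + r, p + q - r, p - q + r, p - q - r] : Fin 4 → ι → ℝ) i ⬝ᵥ ⇑e) ^ 3 :=
    fun e => by
      simp only [Fin.sum_univ_four, add_dotProduct, sub_dotProduct, Matrix.cons_val]
      ring
  simp_rw [h]
  rw [integral_finsetSum _ fun i _ => (integrable_dotProduct_pow _ _).const_mul _]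
  simp_rw [integral_const_mul, integral_dotProduct_pow hS, integral_pow_three_gaussianReal]
  simp

/-- The three terms are the three pairings of the factors, as in Isserlis' formula. -/
theorem integral_mul_four (hS : S.PosSemidef) (p q r s : ι → ℝ) :
    ∫ e : EuclideanSpace ℝ ι, (p ⬝ᵥ ⇑e) * (q ⬝ᵥ ⇑e) * ((r ⬝ᵥ ⇑e) * (s ⬝ᵥ ⇑e))
      ∂(multivariateGaussian 0 S) =
      (p ⬝ᵥ (S *ᵥ q)) * (r ⬝ᵥ (S *ᵥ s)) + (p ⬝ᵥ (S *ᵥ r)) * (q ⬝ᵥ (S *ᵥ s)) +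
        (p ⬝ᵥ (S *ᵥ s)) * (q ⬝ᵥ (S *ᵥ r)) := by
  have h : ∀ e : EuclideanSpace ℝ ι, (p ⬝ᵥ ⇑e) * (q ⬝ᵥ ⇑e) * ((r ⬝ᵥ ⇑e) * (s ⬝ᵥ ⇑e)) =
      ∑ i : Fin 8, ((![1, -1, -1, 1, -1, 1, 1, -1] : Fin 8 → ℝ) i / 192) *
        ((![p + q + r + s, p + q + r - s, p + q - r + s, p + q - r - s,
          p - q + r + s, p - q + r - s, p - q - r + s, p - q - r - s] :
            Fin 8 → ι → ℝ) i ⬝ᵥ ⇑e) ^ 4 := fun e => by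
    simp only [Fin.sum_univ_eight, add_dotProduct, sub_dotProduct, Matrix.cons_val]
    ring
  have hsymm : ∀ p q : ι → ℝ, q ⬝ᵥ (S *ᵥ p) = p ⬝ᵥ (S *ᵥ q) := fun p q => by
    rw [dotProduct_mulVec, ← mulVec_transpose, dotProduct_comm]
    congr 2
    simpa using hS.isHermitian.eq
  have h4 : ∀ x : ι → ℝ, ∫ e : EuclideanSpace ℝ ι, (x ⬝ᵥ ⇑e) ^ 4 ∂(multivariateGaussian 0 S) =
      3 * (x ⬝ᵥ (S *ᵥ x)) ^ 2 := fun x => by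
    rw [integral_dotProduct_pow hS, integral_pow_four_gaussianReal,
      Real.coe_toNNReal _ (quadraticForm_nonneg hS x)]
  simp_rw [h]
  rw [integral_finsetSum _ fun i _ => (integrable_dotProduct_pow _ _).const_mul _]
  simp_rw [integral_const_mul, h4]
  simp only [Fin.sum_univ_eight, add_dotProduct, sub_dotProduct, mulVec_add, mulVec_sub,
    dotProduct_add, dotProduct_sub, Matrix.cons_val, hsymm p q, hsymm p r, hsymm p s, hsymm q r,
    hsymm q s, hsymm r s]
  ring

theorem quadraticForm_eq_sum (M : Matrix ι ι ℝ) (x : ι → ℝ) :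
    x ⬝ᵥ (M *ᵥ x) = ∑ k : ι × ι, M k.1 k.2 *
      ((Pi.single k.1 1 ⬝ᵥ x) * (Pi.single k.2 1 ⬝ᵥ x)) := by
  simp only [dotProduct, mulVec, Finset.mul_sum, Fintype.sum_prod_type]
  refine Finset.sum_congr rfl fun a _ => Finset.sum_congr rfl fun b _ => ?_
  simp [Pi.single_apply]
  ring

theorem single_dotProduct_mulVec_single (a b : ι) :
    (Pi.single a 1 : ι → ℝ) ⬝ᵥ (S *ᵥ Pi.single b 1) = S a b := by simp

theorem integrable_mul_two (p q : ι → ℝ) :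
    Integrable (fun e : EuclideanSpace ℝ ι => (p ⬝ᵥ ⇑e) * (q ⬝ᵥ ⇑e))
      (multivariateGaussian 0 S) := by
  refine integrable_of_abs_le (by fun_prop) (‖WithLp.toLp 2 p‖ * ‖WithLp.toLp 2 q‖) 1 fun e => ?_
  rw [abs_mul]
  calc _ ≤ (‖WithLp.toLp 2 p‖ * ‖e‖) * (‖WithLp.toLp 2 q‖ * ‖e‖) := by
        gcongr <;> exact abs_dotProduct_coe_le _ e
    _ = ‖WithLp.toLp 2 p‖ * ‖WithLp.toLp 2 q‖ * ‖e‖ ^ 2 := by ring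
    _ ≤ _ := by gcongr; rw [pow_one]; linarith

theorem integral_quadraticForm (hS : S.PosSemidef) (M : Matrix ι ι ℝ) :
    ∫ e : EuclideanSpace ℝ ι, ⇑e ⬝ᵥ (M *ᵥ ⇑e) ∂(multivariateGaussian 0 S) = (M * S).trace := by
  simp_rw [quadraticForm_eq_sum M]
  rw [integral_finsetSum _ fun i _ => (integrable_mul_two _ _).const_mul _]
  simp_rw [integral_const_mul, integral_mul_two hS, single_dotProduct_mulVec_single]
  simp only [trace, diag, Matrix.mul_apply, Fintype.sum_prod_type]
  have := hS.isHermitian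
  refine Finset.sum_congr rfl fun a _ => Finset.sum_congr rfl fun b _ => ?_
  rw [← this.apply a b]
  simp

theorem integrable_quadraticForm (M : Matrix ι ι ℝ) :
    Integrable (fun e : EuclideanSpace ℝ ι => ⇑e ⬝ᵥ (M *ᵥ ⇑e)) (multivariateGaussian 0 S) := by
  simp_rw [quadraticForm_eq_sum M]
  exact integrable_finsetSum _ fun i _ => (integrable_mul_two _ _).const_mul _

theorem integral_dotProduct (hS : S.PosSemidef) (l : ι → ℝ) :
    ∫ e : EuclideanSpace ℝ ι, l ⬝ᵥ ⇑e ∂(multivariateGaussian 0 S) = 0 := by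
  have := integral_dotProduct_pow hS l 1
  simpa [integral_id_gaussianReal] using this

theorem integrable_mul_three (p q r : ι → ℝ) :
    Integrable (fun e : EuclideanSpace ℝ ι => (p ⬝ᵥ ⇑e) * (q ⬝ᵥ ⇑e) * (r ⬝ᵥ ⇑e))
      (multivariateGaussian 0 S) := by
  refine integrable_of_abs_le (by fun_prop)
    (‖WithLp.toLp 2 p‖ * ‖WithLp.toLp 2 q‖ * ‖WithLp.toLp 2 r‖) 2 fun e => ?_
  rw [abs_mul, abs_mul]
  calc _ ≤ (‖WithLp.toLp 2 p‖ * ‖e‖) * (‖WithLp.toLp 2 q‖ * ‖e‖) *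
        (‖WithLp.toLp 2 r‖ * ‖e‖) := by
        gcongr <;> exact abs_dotProduct_coe_le _ e
    _ = ‖WithLp.toLp 2 p‖ * ‖WithLp.toLp 2 q‖ * ‖WithLp.toLp 2 r‖ * ‖e‖ ^ 3 := by ring
    _ ≤ _ := by
      gcongr
      have := norm_nonneg e
      nlinarith [mul_nonneg this (sq_nonneg (‖e‖ - 1)), sq_nonneg (‖e‖ - 1), sq_nonneg (‖e‖ ^ 2 - ‖e‖),
        sq_nonneg (‖e‖ ^ 2)]

theorem integrable_mul_four (p q r s : ι → ℝ) :
    Integrable (fun e : EuclideanSpace ℝ ι => (p ⬝ᵥ ⇑e) * (q ⬝ᵥ ⇑e) * ((r ⬝ᵥ ⇑e) * (s ⬝ᵥ ⇑e)))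
      (multivariateGaussian 0 S) := by
  refine integrable_of_abs_le (by fun_prop)
    (‖WithLp.toLp 2 p‖ * ‖WithLp.toLp 2 q‖ * ‖WithLp.toLp 2 r‖ * ‖WithLp.toLp 2 s‖) 2 fun e => ?_
  rw [abs_mul, abs_mul, abs_mul]
  calc _ ≤ (‖WithLp.toLp 2 p‖ * ‖e‖) * (‖WithLp.toLp 2 q‖ * ‖e‖) *
        ((‖WithLp.toLp 2 r‖ * ‖e‖) * (‖WithLp.toLp 2 s‖ * ‖e‖)) := by
        gcongr <;> exact abs_dotProduct_coe_le _ e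
    _ = ‖WithLp.toLp 2 p‖ * ‖WithLp.toLp 2 q‖ * ‖WithLp.toLp 2 r‖ * ‖WithLp.toLp 2 s‖ *
        ‖e‖ ^ 4 := by ring
    _ ≤ _ := by
      gcongr
      nlinarith [sq_nonneg ‖e‖]

theorem integral_add_add_add_sub_sub {α : Type*} [MeasurableSpace α] {μ : Measure α}
    [IsProbabilityMeasure μ] {f₁ f₂ f₃ f₄ f₅ : α → ℝ} (h₁ : Integrable f₁ μ) (h₂ : Integrable f₂ μ)
    (h₃ : Integrable f₃ μ) (h₄ : Integrable f₄ μ) (h₅ : Integrable f₅ μ) (c : ℝ) :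
    ∫ x, (f₁ x + f₂ x + f₃ x + c - f₄ x - f₅ x) ∂μ =
      ∫ x, f₁ x ∂μ + ∫ x, f₂ x ∂μ + ∫ x, f₃ x ∂μ + c - ∫ x, f₄ x ∂μ - ∫ x, f₅ x ∂μ := by
  have h₁₂ : Integrable (fun x => f₁ x + f₂ x) μ := h₁.add h₂
  have h₁₂₃ : Integrable (fun x => f₁ x + f₂ x + f₃ x) μ := h₁₂.add h₃
  have h' : Integrable (fun x => f₁ x + f₂ x + f₃ x + c) μ := h₁₂₃.add (integrable_const c)
  have h'' : Integrable (fun x => f₁ x + f₂ x + f₃ x + c - f₄ x) μ := h'.sub h₄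
  rw [integral_sub h'' h₅, integral_sub h' h₄, integral_add h₁₂₃ (integrable_const c),
    integral_add h₁₂ h₃, integral_add h₁ h₂]
  simp

/-- The second moment of a centered quadratic statistic of a Gaussian vector. -/
theorem integral_sq_linear_add_quadratic (hS : S.PosSemidef) (l : ι → ℝ) {M : Matrix ι ι ℝ}
    (hM : M.IsSymm) :
    ∫ e : EuclideanSpace ℝ ι, (l ⬝ᵥ ⇑e + (⇑e ⬝ᵥ (M *ᵥ ⇑e) - (M * S).trace)) ^ 2
      ∂(multivariateGaussian 0 S) = l ⬝ᵥ (S *ᵥ l) + 2 * (M * S * M * S).trace := by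
  have hSs : ∀ a b, S a b = S b a := fun a b => by
    have := hS.isHermitian.apply a b
    simpa using this.symm
  have hMs : ∀ a b, M a b = M b a := fun a b => hM.apply b a
  have hexp : ∀ e : EuclideanSpace ℝ ι, (l ⬝ᵥ ⇑e + (⇑e ⬝ᵥ (M *ᵥ ⇑e) - (M * S).trace)) ^ 2 =
      (l ⬝ᵥ ⇑e) * (l ⬝ᵥ ⇑e) + 2 * ∑ k : ι × ι, M k.1 k.2 *
        ((Pi.single k.1 1 ⬝ᵥ ⇑e) * (Pi.single k.2 1 ⬝ᵥ ⇑e) * (l ⬝ᵥ ⇑e)) +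
      ∑ k : ι × ι, ∑ m : ι × ι, M k.1 k.2 * M m.1 m.2 *
        ((Pi.single k.1 1 ⬝ᵥ ⇑e) * (Pi.single k.2 1 ⬝ᵥ ⇑e) *
          ((Pi.single m.1 1 ⬝ᵥ ⇑e) * (Pi.single m.2 1 ⬝ᵥ ⇑e))) +
      (M * S).trace ^ 2 - 2 * (M * S).trace * (⇑e ⬝ᵥ (M *ᵥ ⇑e)) -
      2 * (M * S).trace * (l ⬝ᵥ ⇑e) := fun e => by
    have h1 : ∑ k : ι × ι, M k.1 k.2 *
        ((Pi.single k.1 1 ⬝ᵥ ⇑e) * (Pi.single k.2 1 ⬝ᵥ ⇑e) * (l ⬝ᵥ ⇑e)) =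
        (⇑e ⬝ᵥ (M *ᵥ ⇑e)) * (l ⬝ᵥ ⇑e) := by
      rw [quadraticForm_eq_sum M, Finset.sum_mul]
      exact Finset.sum_congr rfl fun _ _ => by ring
    have h2 : ∑ k : ι × ι, ∑ m : ι × ι, M k.1 k.2 * M m.1 m.2 *
        ((Pi.single k.1 1 ⬝ᵥ ⇑e) * (Pi.single k.2 1 ⬝ᵥ ⇑e) *
          ((Pi.single m.1 1 ⬝ᵥ ⇑e) * (Pi.single m.2 1 ⬝ᵥ ⇑e))) =
        (⇑e ⬝ᵥ (M *ᵥ ⇑e)) * (⇑e ⬝ᵥ (M *ᵥ ⇑e)) := by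
      rw [quadraticForm_eq_sum M, Finset.sum_mul_sum]
      exact Finset.sum_congr rfl fun _ _ => Finset.sum_congr rfl fun _ _ => by ring
    rw [h1, h2]
    ring
  have i1 := integrable_mul_two (S := S) l l
  have i2 : Integrable (fun e : EuclideanSpace ℝ ι => 2 * ∑ k : ι × ι, M k.1 k.2 *
        ((Pi.single k.1 1 ⬝ᵥ ⇑e) * (Pi.single k.2 1 ⬝ᵥ ⇑e) * (l ⬝ᵥ ⇑e)))
      (multivariateGaussian 0 S) :=
    (integrable_finsetSum _ fun k _ => (integrable_mul_three _ _ _).const_mul _).const_mul _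
  have i3 : Integrable (fun e : EuclideanSpace ℝ ι =>
      ∑ k : ι × ι, ∑ m : ι × ι, M k.1 k.2 * M m.1 m.2 *
        ((Pi.single k.1 1 ⬝ᵥ ⇑e) * (Pi.single k.2 1 ⬝ᵥ ⇑e) *
          ((Pi.single m.1 1 ⬝ᵥ ⇑e) * (Pi.single m.2 1 ⬝ᵥ ⇑e)))) (multivariateGaussian 0 S) :=
    integrable_finsetSum _ fun k _ => integrable_finsetSum _ fun m _ =>
      (integrable_mul_four _ _ _ _).const_mul _
  have i4 := (integrable_quadraticForm (S := S) M).const_mul (2 * (M * S).trace)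
  have i5 : Integrable (fun e : EuclideanSpace ℝ ι => 2 * (M * S).trace * (l ⬝ᵥ ⇑e))
      (multivariateGaussian 0 S) := by
    have := (integrable_dotProduct_pow (S := S) l 1).const_mul (2 * (M * S).trace)
    simpa using this
  simp_rw [hexp]
  refine (integral_add_add_add_sub_sub i1 i2 i3 i4 i5 _).trans ?_
  rw [integral_const_mul, integral_const_mul, integral_const_mul,
    integral_quadraticForm hS, integral_dotProduct hS, integral_mul_two hS,
    integral_finsetSum _ fun k _ => (integrable_mul_three _ _ _).const_mul _,
    integral_finsetSum _ fun k _ => integrable_finsetSum _ fun m _ =>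
      (integrable_mul_four _ _ _ _).const_mul _]
  simp_rw [integral_finsetSum _ fun m _ => (integrable_mul_four (S := S) _ _ _ _).const_mul _,
    integral_const_mul, integral_mul_three hS, integral_mul_four hS,
    single_dotProduct_mulVec_single]
  -- Of the three pairings this one cancels against the squared mean, while the other two both equal
  -- `tr (M S M S)`, whence the factor 2 in the result.
  have t1 : ∑ k : ι × ι, ∑ m : ι × ι, M k.1 k.2 * M m.1 m.2 * (S k.1 k.2 * S m.1 m.2) =
      (M * S).trace ^ 2 := by
    have : (M * S).trace = ∑ k : ι × ι, M k.1 k.2 * S k.1 k.2 := by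
      simp only [trace, diag, Matrix.mul_apply, Fintype.sum_prod_type]
      exact Finset.sum_congr rfl fun a _ => Finset.sum_congr rfl fun b _ => by rw [hSs b a]
    rw [this, sq, Finset.sum_mul_sum]
    exact Finset.sum_congr rfl fun _ _ => Finset.sum_congr rfl fun _ _ => by ring
  have ttr : (M * S * M * S).trace = ∑ a, ∑ d, ∑ c, ∑ b, M a b * S b c * M c d * S d a := by
    simp only [trace, diag, Matrix.mul_apply, Finset.sum_mul]
  have t2 : ∑ k : ι × ι, ∑ m : ι × ι, M k.1 k.2 * M m.1 m.2 * (S k.1 m.1 * S k.2 m.2) =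
      (M * S * M * S).trace := by
    rw [ttr]
    simp only [Fintype.sum_prod_type]
    refine Finset.sum_congr rfl fun a _ => ?_
    rw [Finset.sum_comm]
    refine Finset.sum_congr rfl fun d _ => ?_
    rw [Finset.sum_comm]
    refine Finset.sum_congr rfl fun c _ => Finset.sum_congr rfl fun b _ => ?_
    rw [hSs a d, hMs d c]
    ring
  have t3 : ∑ k : ι × ι, ∑ m : ι × ι, M k.1 k.2 * M m.1 m.2 * (S k.1 m.2 * S k.2 m.1) =
      (M * S * M * S).trace := by
    rw [← t2]
    refine Finset.sum_congr rfl fun k _ => ?_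
    rw [← (Equiv.prodComm ι ι).sum_comp]
    refine Finset.sum_congr rfl fun m _ => ?_
    simp only [Equiv.prodComm_apply, Prod.fst_swap, Prod.snd_swap]
    rw [hMs m.2 m.1]
  simp only [mul_add, Finset.sum_add_distrib, t1, t2, t3]
  simp
  ring

/-- The power mean inequality reduces the norm to its coordinates. Sixth moments are needed because
the score grows quadratically in the residual and the central limit theorem asks for its third
moment. -/
theorem integral_norm_pow_six_le (hS : S.PosSemidef) {C : ℝ} (hC : ∀ a, S a a ≤ C) :
    ∫ e : EuclideanSpace ℝ ι, ‖e‖ ^ 6 ∂(multivariateGaussian 0 S) ≤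
      15 * (Fintype.card ι) ^ 3 * C ^ 3 := by
  have h6 : ∀ a, ∫ e : EuclideanSpace ℝ ι, (Pi.single a 1 ⬝ᵥ ⇑e) ^ 6
      ∂(multivariateGaussian 0 S) ≤ 15 * C ^ 3 := fun a => by
    have h0 : 0 ≤ S a a := by simpa using quadraticForm_nonneg hS (Pi.single a 1)
    rw [integral_dotProduct_pow hS, integral_pow_six_gaussianReal,
      single_dotProduct_mulVec_single, Real.coe_toNNReal _ h0]
    gcongr
    exact hC a
  have hb : ∀ e : EuclideanSpace ℝ ι, ‖e‖ ^ 6 ≤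
      (Fintype.card ι) ^ 2 * ∑ a, (Pi.single a 1 ⬝ᵥ ⇑e) ^ 6 := fun e => by
    have h := pow_sum_div_card_le_sum_pow (s := Finset.univ) (f := fun a => e a ^ 2)
      (fun a _ => sq_nonneg _) 2
    rw [← EuclideanSpace.real_norm_sq_eq] at h
    rcases isEmpty_or_nonempty ι with hι | hι
    · have : e = 0 := Subsingleton.elim _ _
      simp [this]
    rw [div_le_iff₀ (by simp [Fintype.card_pos])] at h
    simp only [← pow_mul, single_one_dotProduct] at h ⊢
    norm_num at h
    linarith
  have hint : Integrable (fun e : EuclideanSpace ℝ ι => (Fintype.card ι : ℝ) ^ 2 *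
      ∑ a, (Pi.single a 1 ⬝ᵥ ⇑e) ^ 6) (multivariateGaussian 0 S) :=
    (integrable_finsetSum _ fun a _ => integrable_dotProduct_pow _ _).const_mul _
  calc _ ≤ ∫ e : EuclideanSpace ℝ ι, (Fintype.card ι : ℝ) ^ 2 * ∑ a, (Pi.single a 1 ⬝ᵥ ⇑e) ^ 6
        ∂(multivariateGaussian 0 S) := by
        refine integral_mono ?_ hint hb
        refine integrable_of_abs_le (by fun_prop) 1 3 fun e => ?_
        rw [abs_of_nonneg (by positivity), one_mul, show ‖e‖ ^ 6 = (‖e‖ ^ 2) ^ 3 by ring]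
        gcongr
        linarith
    _ = (Fintype.card ι : ℝ) ^ 2 * ∑ a, ∫ e : EuclideanSpace ℝ ι, (Pi.single a 1 ⬝ᵥ ⇑e) ^ 6
        ∂(multivariateGaussian 0 S) := by
        rw [integral_const_mul, integral_finsetSum _ fun a _ => integrable_dotProduct_pow _ _]
    _ ≤ (Fintype.card ι : ℝ) ^ 2 * ∑ a : ι, 15 * C ^ 3 := by
        gcongr with a
        exact h6 a
    _ = _ := by simp; ring

end GaussianMoments

end IOU

end

/-! ### Second-order perturbation of a Gaussian log-density. -/

noncomputable section

namespace IOU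

section AbsSum

variable {m n k : Type*} [Fintype m] [Fintype n] [Fintype k]

/-- The sum of the absolute values of the entries of a matrix. -/
def absSum (A : Matrix m n ℝ) : ℝ := ∑ a, ∑ b, |A a b|

theorem absSum_nonneg (A : Matrix m n ℝ) : 0 ≤ absSum A := by unfold absSum; positivity

theorem absSum_add_le (A B : Matrix m n ℝ) : absSum (A + B) ≤ absSum A + absSum B := by
  simp only [absSum, ← Finset.sum_add_distrib]
  exact Finset.sum_le_sum fun a _ => Finset.sum_le_sum fun b _ => abs_add_le _ _

theorem absSum_neg (A : Matrix m n ℝ) : absSum (-A) = absSum A := by simp [absSum]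

theorem absSum_sub_le (A B : Matrix m n ℝ) : absSum (A - B) ≤ absSum A + absSum B := by
  rw [sub_eq_add_neg, ← absSum_neg B]
  exact absSum_add_le _ _

theorem absSum_transpose (A : Matrix m n ℝ) : absSum Aᵀ = absSum A := by
  simp only [absSum, transpose_apply]
  exact Finset.sum_comm

/-- Submultiplicativity without a dimensional factor, also for rectangular matrices, is the reason
for working with this norm: bounds pass through long products. -/
theorem absSum_mul_le (A : Matrix m n ℝ) (B : Matrix n k ℝ) :
    absSum (A * B) ≤ absSum A * absSum B := by
  have h1 : ∀ c, ∑ b, |B c b| ≤ absSum B := fun c =>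
    Finset.single_le_sum (f := fun c => ∑ b, |B c b|) (fun _ _ => by positivity) (Finset.mem_univ c)
  calc absSum (A * B) ≤ ∑ a, ∑ b, ∑ c, |A a c| * |B c b| := by
        refine Finset.sum_le_sum fun a _ => Finset.sum_le_sum fun b _ => ?_
        rw [Matrix.mul_apply]
        refine (Finset.abs_sum_le_sum_abs _ _).trans_eq ?_
        simp only [abs_mul]
    _ = ∑ a, ∑ c, |A a c| * ∑ b, |B c b| := by
        refine Finset.sum_congr rfl fun a _ => ?_
        rw [Finset.sum_comm]
        simp only [Finset.mul_sum]
    _ ≤ ∑ a, ∑ c, |A a c| * absSum B := by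
        gcongr with a _ c _
        exact h1 c
    _ = _ := by simp only [absSum, Finset.sum_mul]

theorem absSum_le_of_le {A : Matrix m n ℝ} {C : ℝ} (h : ∀ a b, |A a b| ≤ C) :
    absSum A ≤ Fintype.card m * (Fintype.card n * C) := by
  calc absSum A ≤ ∑ _a : m, ∑ _b : n, C :=
        Finset.sum_le_sum fun a _ => Finset.sum_le_sum fun b _ => h a b
    _ = _ := by simp

theorem abs_trace_le (A : Matrix n n ℝ) : |A.trace| ≤ absSum A := by
  refine (Finset.abs_sum_le_sum_abs _ _).trans (Finset.sum_le_sum fun a _ => ?_)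
  exact Finset.single_le_sum (f := fun b => |A a b|) (fun _ _ => abs_nonneg _) (Finset.mem_univ a)

theorem abs_apply_le_absSum (A : Matrix m n ℝ) (a : m) (b : n) : |A a b| ≤ absSum A :=
  (Finset.single_le_sum (f := fun b => |A a b|) (fun _ _ => abs_nonneg _)
    (Finset.mem_univ b)).trans (Finset.single_le_sum (f := fun a => ∑ b, |A a b|)
      (fun _ _ => by positivity) (Finset.mem_univ a))

theorem abs_bilin_le (A : Matrix m n ℝ) (x : EuclideanSpace ℝ m) (y : EuclideanSpace ℝ n) :
    |⇑x ⬝ᵥ (A *ᵥ ⇑y)| ≤ absSum A * (‖x‖ * ‖y‖) := by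
  simp only [absSum, dotProduct, mulVec, Finset.mul_sum, Finset.sum_mul]
  refine (Finset.abs_sum_le_sum_abs _ _).trans (Finset.sum_le_sum fun a _ => ?_)
  refine (Finset.abs_sum_le_sum_abs _ _).trans (Finset.sum_le_sum fun b _ => ?_)
  rw [abs_mul, abs_mul]
  have h1 : |x a| ≤ ‖x‖ := by simpa using PiLp.norm_apply_le x a
  have h2 : |y b| ≤ ‖y‖ := by simpa using PiLp.norm_apply_le y b
  calc |x a| * (|A a b| * |y b|) = |A a b| * (|x a| * |y b|) := by ring
    _ ≤ _ := by gcongr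

theorem norm_mulVec_le (A : Matrix m n ℝ) (y : EuclideanSpace ℝ n) :
    ‖(WithLp.toLp 2 (A *ᵥ ⇑y) : EuclideanSpace ℝ m)‖ ≤ absSum A * ‖y‖ := by
  have h := abs_bilin_le A (WithLp.toLp 2 (A *ᵥ ⇑y)) y
  set z : EuclideanSpace ℝ m := WithLp.toLp 2 (A *ᵥ ⇑y)
  have h2 : ‖z‖ ^ 2 ≤ absSum A * (‖z‖ * ‖y‖) := by
    rw [← dotProduct_self_eq_norm_sq]
    exact (le_abs_self _).trans h
  rcases (norm_nonneg z).eq_or_lt with h0 | h0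
  · rw [← h0]; have := absSum_nonneg A; positivity
  · exact le_of_mul_le_mul_left (by nlinarith) h0

end AbsSum

section LogDet

variable {n : Type*} [Fintype n]

theorem exists_eigenvalue_sums [DecidableEq n] {E : Matrix n n ℝ} (hE : E.IsHermitian) :
    ∃ d : n → ℝ, (1 + E).det = ∏ a, (1 + d a) ∧ E.trace = ∑ a, d a ∧
      (E * E).trace = ∑ a, d a ^ 2 := by
  obtain ⟨V, d, hVV, hspec⟩ : ∃ (V : Matrix n n ℝ) (d : n → ℝ), star V * V = 1 ∧
      E = V * (diagonal d * star V) := by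
    refine ⟨hE.eigenvectorUnitary, hE.eigenvalues,
      Unitary.coe_star_mul_self hE.eigenvectorUnitary, ?_⟩
    have := hE.spectral_theorem
    rw [Unitary.conjStarAlgAut_apply] at this
    rw [← mul_assoc]
    exact this
  refine ⟨d, ?_, ?_, ?_⟩
  · rw [hspec, det_one_add_mul_comm, mul_assoc, hVV, mul_one, ← diagonal_one, diagonal_add,
      det_diagonal]
  · rw [hspec, trace_mul_comm, mul_assoc, hVV, mul_one, trace_diagonal]
  · have : E * E = V * (diagonal d * diagonal d * star V) := by
      rw [hspec]
      calc _ = V * (diagonal d * (star V * V) * (diagonal d * star V)) := by simp only [mul_assoc]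
        _ = _ := by rw [hVV, mul_one, mul_assoc]
    rw [this, trace_mul_comm, mul_assoc, hVV, mul_one, diagonal_mul_diagonal, trace_diagonal]
    simp only [sq]

/-- The logarithmic series has remainder at most `|d|³ / (1 - |d|) ≤ 2 |d|³`, and `∑ |d a|³ ≤ δ ∑ d
a²`. Nothing depends on the number of terms. -/
theorem abs_sum_log_sub_le (d : n → ℝ) {δ : ℝ} (hδ : 0 ≤ δ) (hδ2 : δ ≤ 1 / 2)
    (h : ∑ a, d a ^ 2 ≤ δ ^ 2) :
    (∀ a, 0 < 1 + d a) ∧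
      |∑ a, Real.log (1 + d a) - ∑ a, d a + 1 / 2 * ∑ a, d a ^ 2| ≤ 2 * δ ^ 3 := by
  have hd : ∀ a, |d a| ≤ δ := fun a => abs_le_of_sq_le_sq
    ((Finset.single_le_sum (f := fun a => d a ^ 2) (fun _ _ => sq_nonneg _)
      (Finset.mem_univ a)).trans h) hδ
  refine ⟨fun a => by linarith [(abs_le.1 (hd a)).1], ?_⟩
  have e : ∑ a, Real.log (1 + d a) - ∑ a, d a + 1 / 2 * ∑ a, d a ^ 2 =
      ∑ a, (Real.log (1 + d a) - d a + 1 / 2 * d a ^ 2) := by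
    rw [Finset.mul_sum, ← Finset.sum_sub_distrib, ← Finset.sum_add_distrib]
  rw [e]
  calc _ ≤ ∑ a, |Real.log (1 + d a) - d a + 1 / 2 * d a ^ 2| := Finset.abs_sum_le_sum_abs _ _
    _ ≤ ∑ a, 2 * δ * d a ^ 2 := by
        refine Finset.sum_le_sum fun a _ => ?_
        have h1 := Real.abs_log_sub_add_sum_range_le (x := -d a)
          (by rw [abs_neg]; linarith [hd a]) 2
        have e1 : (∑ i ∈ Finset.range 2, (-d a) ^ (i + 1) / ((i : ℝ) + 1)) + Real.log (1 - -d a) =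
            Real.log (1 + d a) - d a + 1 / 2 * d a ^ 2 := by
          simp [Finset.sum_range_succ]
          ring
        rw [e1, abs_neg] at h1
        refine h1.trans ?_
        rw [div_le_iff₀ (by linarith [hd a])]
        have h2 : |d a| ^ (2 + 1) = |d a| * d a ^ 2 := by rw [pow_succ, sq_abs, mul_comm]
        rw [h2]
        have h3 := hd a
        have h4 := abs_nonneg (d a)
        have h5 := sq_nonneg (d a)
        calc |d a| * d a ^ 2 ≤ δ * d a ^ 2 := by gcongr
          _ = 2 * δ * d a ^ 2 * (1 / 2) := by ring
          _ ≤ 2 * δ * d a ^ 2 * (1 - |d a|) := by gcongr; linarith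
    _ = 2 * δ * ∑ a, d a ^ 2 := by rw [Finset.mul_sum]
    _ ≤ 2 * δ * δ ^ 2 := by gcongr
    _ = _ := by ring

open scoped MatrixOrder in
theorem exists_symm_sqrt [DecidableEq n] {P : Matrix n n ℝ} (hP : P.PosSemidef) :
    ∃ B : Matrix n n ℝ, Bᵀ = B ∧ B * B = P := by
  refine ⟨CFC.sqrt P, ?_, CFC.sqrt_mul_sqrt_self P hP.nonneg⟩
  have := (CFC.sqrt_nonneg P).isSelfAdjoint.star_eq
  rwa [star_eq_conjTranspose, conjTranspose_eq_transpose_of_trivial] at this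

/-- The matrix `Q⁻¹ * Δ` need not be symmetric, but `B * Δ * B` with `B` the square root of `Q⁻¹`
is. Both have the same traces, and `det (1 + XY) = det (1 + YX)` transfers the determinant, so the
scalar estimate for eigenvalues applies. -/
theorem abs_log_det_add_sub_le [DecidableEq n] {Q Δ : Matrix n n ℝ} (hQ : Q.PosDef) (hΔ : Δ.IsSymm) {δ : ℝ}
    (hδ : 0 ≤ δ) (hδ2 : δ ≤ 1 / 2) (h : (Q⁻¹ * Δ * (Q⁻¹ * Δ)).trace ≤ δ ^ 2) :
    |Real.log (Q + Δ).det - Real.log Q.det - (Q⁻¹ * Δ).trace +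
      1 / 2 * (Q⁻¹ * Δ * (Q⁻¹ * Δ)).trace| ≤ 2 * δ ^ 3 := by
  obtain ⟨B, hBt, hBB⟩ := exists_symm_sqrt hQ.inv.posSemidef
  have hE : (B * Δ * B).IsHermitian := by
    rw [IsHermitian, conjTranspose_eq_transpose_of_trivial, transpose_mul, transpose_mul, hBt,
      hΔ.eq, mul_assoc]
  obtain ⟨d, h1, h2, h3⟩ := exists_eigenvalue_sums hE
  have hu : IsUnit Q.det := (isUnit_iff_isUnit_det _).1 hQ.isUnit
  have hdet : (Q + Δ).det = Q.det * ∏ a, (1 + d a) := by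
    rw [← h1, ← det_one_add_mul_comm, ← mul_assoc, hBB, ← det_mul, mul_add, ← mul_assoc,
      mul_nonsing_inv _ hu, one_mul, mul_one]
  have ht1 : (Q⁻¹ * Δ).trace = ∑ a, d a := by
    rw [← h2, ← hBB, mul_assoc, trace_mul_comm]
  have ht2 : (Q⁻¹ * Δ * (Q⁻¹ * Δ)).trace = ∑ a, d a ^ 2 := by
    rw [← h3, ← hBB]
    have : B * B * Δ * (B * B * Δ) = B * (B * Δ * B * (B * Δ)) := by simp only [mul_assoc]
    rw [this, trace_mul_comm]
    simp only [mul_assoc]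
  rw [ht2] at h
  obtain ⟨hpos, hmain⟩ := abs_sum_log_sub_le d hδ hδ2 h
  rw [hdet, Real.log_mul hQ.det_pos.ne' (Finset.prod_ne_zero_iff.2 fun a _ => (hpos a).ne'),
    Real.log_prod fun a _ => (hpos a).ne', ht1, ht2]
  convert hmain using 2
  ring

end LogDet

section Expansion

variable {n : Type*} [Fintype n] [DecidableEq n]

theorem absSum_mul_le_of_le {l m k : Type*} [Fintype l] [Fintype m] [Fintype k]
    {A : Matrix l m ℝ} {B : Matrix m k ℝ} {a b : ℝ} (hA : absSum A ≤ a) (hB : absSum B ≤ b) :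
    absSum (A * B) ≤ a * b :=
  (absSum_mul_le A B).trans
    (mul_le_mul hA hB (absSum_nonneg B) ((absSum_nonneg A).trans hA))

/-- Second-order expansion of the logarithm of a Gaussian density, with a remainder that is uniform
in the matrices that satisfy given bounds. -/
theorem abs_gaussian_expansion_le {Q Q' D F : Matrix n n ℝ} (hQ : Q.PosDef) (hQ' : Q'.PosDef)
    {K t : ℝ} (hK : 1 ≤ K) (ht : 0 ≤ t) (htK : 6 * K ^ 2 * t ≤ 1) (hP : absSum Q⁻¹ ≤ K)
    (hD : absSum D ≤ K * t) (hF : absSum F ≤ K * t ^ 2)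
    (hR : absSum (Q' - Q - D - F) ≤ K * t ^ 3) (e w : EuclideanSpace ℝ n) (hw : ‖w‖ ≤ K * t) :
    |(-(1 / 2) * (Real.log Q'.det + (⇑e - ⇑w) ⬝ᵥ (Q'⁻¹ *ᵥ (⇑e - ⇑w))) +
        1 / 2 * (Real.log Q.det + ⇑e ⬝ᵥ (Q⁻¹ *ᵥ ⇑e))) -
      ((⇑e ⬝ᵥ (Q⁻¹ *ᵥ ⇑w) +
          1 / 2 * (⇑e ⬝ᵥ ((Q⁻¹ * D * Q⁻¹) *ᵥ ⇑e) - (Q⁻¹ * D).trace)) +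
        (-(1 / 2) * (⇑w ⬝ᵥ (Q⁻¹ *ᵥ ⇑w)) - ⇑e ⬝ᵥ ((Q⁻¹ * D * Q⁻¹) *ᵥ ⇑w) +
          1 / 2 * (⇑e ⬝ᵥ ((Q⁻¹ * F * Q⁻¹) *ᵥ ⇑e) - (Q⁻¹ * F).trace) +
          1 / 4 * (Q⁻¹ * D * (Q⁻¹ * D)).trace -
          1 / 2 * (⇑e ⬝ᵥ ((Q⁻¹ * D * Q⁻¹ * D * Q⁻¹) *ᵥ ⇑e))))| ≤
      200 * K ^ 8 * (1 + ‖e‖ ^ 2) * t ^ 3 := by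
  have hK0 : 0 < K := by linarith
  have hK2 : 1 ≤ K ^ 2 := one_le_pow₀ hK
  have ht1 : t ≤ 1 := by nlinarith
  have hKp : ∀ j ≤ 8, K ^ j ≤ K ^ 8 := fun j hj => pow_le_pow_right₀ hK hj
  have hKp7 : ∀ j ≤ 7, K ^ j ≤ K ^ 7 := fun j hj => pow_le_pow_right₀ hK hj
  have hu : IsUnit Q.det := (isUnit_iff_isUnit_det _).1 hQ.isUnit
  have hu' : IsUnit Q'.det := (isUnit_iff_isUnit_det _).1 hQ'.isUnit
  have hP's : Q'⁻¹ᵀ = Q'⁻¹ := by simpa using hQ'.inv.isHermitian.eq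
  have hΔs : (Q' - Q).IsSymm := by
    have h1 := hQ.isHermitian.eq
    have h2 := hQ'.isHermitian.eq
    rw [conjTranspose_eq_transpose_of_trivial] at h1 h2
    rw [IsSymm, transpose_sub, h1, h2]
  obtain ⟨P, hPdef⟩ : ∃ P, P = Q⁻¹ := ⟨_, rfl⟩
  obtain ⟨P', hP'def⟩ : ∃ P', P' = Q'⁻¹ := ⟨_, rfl⟩
  obtain ⟨Δ, hΔdef⟩ : ∃ Δ, Δ = Q' - Q := ⟨_, rfl⟩
  obtain ⟨R, hRdef⟩ : ∃ R, R = Q' - Q - D - F := ⟨_, rfl⟩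
  have hinv : P' = P - P' * Δ * P := by
    rw [hΔdef, hPdef, hP'def, mul_sub, sub_mul, nonsing_inv_mul _ hu', one_mul, mul_assoc,
      mul_nonsing_inv _ hu, mul_one]
    abel
  have hΔ : Δ = D + F + R := by rw [hΔdef, hRdef]; abel
  have hlog : ∀ δ : ℝ, 0 ≤ δ → δ ≤ 1 / 2 → (P * Δ * (P * Δ)).trace ≤ δ ^ 2 →
      |Real.log Q'.det - Real.log Q.det - (P * Δ).trace + 1 / 2 * (P * Δ * (P * Δ)).trace| ≤
        2 * δ ^ 3 := fun δ h1 h2 h3 => by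
    have := abs_log_det_add_sub_le hQ hΔs h1 h2 (by rwa [← hPdef, ← hΔdef])
    rwa [add_sub_cancel, ← hPdef, ← hΔdef] at this
  rw [← hP'def] at hP's ⊢
  rw [← hPdef] at hP ⊢
  rw [← hRdef] at hR
  have hG : absSum (F + R) ≤ 2 * K * t ^ 2 := by
    refine (absSum_add_le _ _).trans ((add_le_add hF hR).trans ?_)
    have : K * t ^ 3 ≤ K * t ^ 2 := by
      gcongr K * ?_
      exact pow_le_pow_of_le_one ht ht1 (by norm_num)
    linarith
  have hΔb : absSum Δ ≤ 3 * K * t := by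
    rw [hΔ, add_assoc]
    refine (absSum_add_le _ _).trans ((add_le_add hD hG).trans ?_)
    have : K * t ^ 2 ≤ K * t := by
      gcongr K * ?_
      nlinarith
    linarith
  -- The identity `P' = P - P'ΔP` bounds `P'` by `K` plus half of its own norm, because `htK` gives
  -- `3 K² t ≤ 1/2`.
  have hP' : absSum P' ≤ 2 * K := by
    have h1 : absSum P' ≤ K + absSum P' * (3 * K * t) * K := by
      conv_lhs => rw [hinv]
      exact (absSum_sub_le _ _).trans (add_le_add hP
        (absSum_mul_le_of_le (absSum_mul_le_of_le le_rfl hΔb) hP))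
    have h2 := absSum_nonneg P'
    have h3 : absSum P' * (3 * K * t) * K ≤ absSum P' * (1 / 2) := by
      rw [mul_assoc]; gcongr; linarith
    linarith
  have hPΔ : absSum (P * Δ) ≤ 3 * K ^ 2 * t :=
    (absSum_mul_le_of_le hP hΔb).trans_eq (by ring)
  -- the logarithm of the determinant
  have l1 : |Real.log Q'.det - Real.log Q.det - (P * Δ).trace +
      1 / 2 * (P * Δ * (P * Δ)).trace| ≤ 54 * (K ^ 8 * t ^ 3) := by
    refine (hlog (3 * K ^ 2 * t) (by positivity) (by linarith) ?_).trans ?_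
    · refine ((le_abs_self _).trans (abs_trace_le _)).trans
        ((absSum_mul_le_of_le hPΔ hPΔ).trans_eq (by ring))
    · calc _ = 54 * (K ^ 6 * t ^ 3) := by ring
        _ ≤ _ := by gcongr ?_ * (?_ * ?_); exact hKp 6 (by norm_num)
  have l2 : |(P * R).trace| ≤ K ^ 8 * t ^ 3 := by
    refine (abs_trace_le _).trans ((absSum_mul_le_of_le hP hR).trans ?_)
    calc _ = K ^ 2 * t ^ 3 := by ring
      _ ≤ _ := by gcongr ?_ * ?_; exact hKp 2 (by norm_num)
  have l2' : (P * Δ).trace = (P * D).trace + (P * F).trace + (P * R).trace := by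
    rw [hΔ, mul_add, mul_add, trace_add, trace_add]
  have l3 : |(P * D * (P * (F + R))).trace + (P * (F + R) * (P * Δ)).trace| ≤
      8 * (K ^ 8 * t ^ 3) := by
    refine (abs_add_le _ _).trans ((add_le_add ((abs_trace_le _).trans (absSum_mul_le_of_le
      (absSum_mul_le_of_le hP hD) (absSum_mul_le_of_le hP hG)))
      ((abs_trace_le _).trans (absSum_mul_le_of_le
      (absSum_mul_le_of_le hP hG) hPΔ))).trans ?_)
    calc _ = 8 * (K ^ 4 * t ^ 3) := by ring
      _ ≤ _ := by gcongr ?_ * (?_ * ?_); exact hKp 4 (by norm_num)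
  have l3' : (P * Δ * (P * Δ)).trace = (P * D * (P * D)).trace +
      ((P * D * (P * (F + R))).trace + (P * (F + R) * (P * Δ)).trace) := by
    rw [← trace_add, ← trace_add, hΔ]
    congr 1
    noncomm_ring
  -- the inverse matrix
  set E₃ : Matrix n n ℝ := -(P * R * P) + P * (F + R) * (P * Δ) * P + P * D * (P * (F + R)) * P -
    P' * (Δ * P) * (Δ * P) * (Δ * P) with hE₃
  have hexp : P' = P - P * D * P - P * F * P + P * D * P * D * P + E₃ := by
    -- The identity `hinv` is substituted into itself until the unexpanded `P'` stands next to three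
    -- factors `Δ`, which makes that term of order `t ^ 3`.
    have h1 : P' = P - P * Δ * P + P * Δ * P * Δ * P - P' * (Δ * P) * (Δ * P) * (Δ * P) := by
      have h2 : P' * Δ * P = P * Δ * P - P' * Δ * P * Δ * P := by
        conv_lhs => rw [hinv]
        noncomm_ring
      have h3 : P' * Δ * P * Δ * P = P * Δ * P * Δ * P - P' * (Δ * P) * (Δ * P) * (Δ * P) := by
        conv_lhs => rw [h2]
        noncomm_ring
      conv_lhs => rw [hinv, h2, h3]
      abel
    have h4 : P * Δ * P = P * D * P + P * F * P + P * R * P := by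
      rw [hΔ]; noncomm_ring
    have h5 : P * Δ * P * Δ * P = P * D * P * D * P + P * D * (P * (F + R)) * P +
        P * (F + R) * (P * Δ) * P := by
      rw [hΔ]; noncomm_ring
    conv_lhs => rw [h1, h5, h4]
    rw [hE₃]
    abel
  have hE₃b : absSum E₃ ≤ 63 * (K ^ 7 * t ^ 3) := by
    have hΔP : absSum (Δ * P) ≤ 3 * K ^ 2 * t :=
      (absSum_mul_le_of_le hΔb hP).trans_eq (by ring)
    have b1 : absSum (P * R * P) ≤ K ^ 7 * t ^ 3 := by
      refine (absSum_mul_le_of_le (absSum_mul_le_of_le hP hR) hP).trans ?_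
      calc _ = K ^ 3 * t ^ 3 := by ring
        _ ≤ _ := by gcongr ?_ * ?_; exact hKp7 3 (by norm_num)
    have b2 : absSum (P * (F + R) * (P * Δ) * P) ≤ 6 * (K ^ 7 * t ^ 3) := by
      refine (absSum_mul_le_of_le (absSum_mul_le_of_le (absSum_mul_le_of_le hP hG) hPΔ) hP).trans ?_
      calc _ = 6 * (K ^ 5 * t ^ 3) := by ring
        _ ≤ _ := by gcongr ?_ * (?_ * ?_); exact hKp7 5 (by norm_num)
    have b3 : absSum (P * D * (P * (F + R)) * P) ≤ 2 * (K ^ 7 * t ^ 3) := by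
      refine (absSum_mul_le_of_le (absSum_mul_le_of_le (absSum_mul_le_of_le hP hD)
        (absSum_mul_le_of_le hP hG)) hP).trans ?_
      calc _ = 2 * (K ^ 5 * t ^ 3) := by ring
        _ ≤ _ := by gcongr ?_ * (?_ * ?_); exact hKp7 5 (by norm_num)
    have b4 : absSum (P' * (Δ * P) * (Δ * P) * (Δ * P)) ≤ 54 * (K ^ 7 * t ^ 3) :=
      (absSum_mul_le_of_le (absSum_mul_le_of_le (absSum_mul_le_of_le hP' hΔP) hΔP) hΔP).trans_eq
        (by ring)
    have c1 := absSum_sub_le (-(P * R * P) + P * (F + R) * (P * Δ) * P +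
      P * D * (P * (F + R)) * P) (P' * (Δ * P) * (Δ * P) * (Δ * P))
    have c2 := absSum_add_le (-(P * R * P) + P * (F + R) * (P * Δ) * P)
      (P * D * (P * (F + R)) * P)
    have c3 := absSum_add_le (-(P * R * P)) (P * (F + R) * (P * Δ) * P)
    rw [absSum_neg] at c3
    rw [hE₃]
    linarith
  have hne := norm_nonneg e
  have q1 : |⇑e ⬝ᵥ (E₃ *ᵥ ⇑e)| ≤ 63 * (K ^ 8 * t ^ 3) * ‖e‖ ^ 2 := by
    refine (abs_bilin_le _ e e).trans ?_
    rw [← sq]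
    gcongr
    refine hE₃b.trans ?_
    gcongr ?_ * (?_ * ?_)
    exact hKp 7 (by norm_num)
  -- As `w` is already of order `t`, the matrix is only needed up to an error of order `t ^ 2`.
  have q2 : |⇑e ⬝ᵥ ((-(P * F * P) + P * D * P * D * P + E₃) *ᵥ ⇑w)| ≤
      65 * (K ^ 8 * t ^ 3) * ‖e‖ := by
    have b1 : absSum (-(P * F * P) + P * D * P * D * P + E₃) ≤ 65 * (K ^ 7 * t ^ 2) := by
      refine (absSum_add_le _ _).trans ?_
      have c1 : absSum (-(P * F * P) + P * D * P * D * P) ≤ 2 * (K ^ 7 * t ^ 2) := by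
        refine (absSum_add_le _ _).trans ?_
        rw [absSum_neg]
        have d1 : absSum (P * F * P) ≤ K ^ 7 * t ^ 2 := by
          refine (absSum_mul_le_of_le (absSum_mul_le_of_le hP hF) hP).trans ?_
          calc _ = K ^ 3 * t ^ 2 := by ring
            _ ≤ _ := by gcongr ?_ * ?_; exact hKp7 3 (by norm_num)
        have d2 : absSum (P * D * P * D * P) ≤ K ^ 7 * t ^ 2 := by
          refine (absSum_mul_le_of_le (absSum_mul_le_of_le (absSum_mul_le_of_le
            (absSum_mul_le_of_le hP hD) hP) hD) hP).trans ?_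
          calc _ = K ^ 5 * t ^ 2 := by ring
            _ ≤ _ := by gcongr ?_ * ?_; exact hKp7 5 (by norm_num)
        linarith
      have c2 : K ^ 7 * t ^ 3 ≤ K ^ 7 * t ^ 2 := by
        gcongr K ^ 7 * ?_
        exact pow_le_pow_of_le_one ht ht1 (by norm_num)
      linarith
    refine (abs_bilin_le _ e w).trans ?_
    calc _ ≤ 65 * (K ^ 7 * t ^ 2) * (‖e‖ * (K * t)) := by gcongr
      _ = _ := by ring
  have q3 : |⇑w ⬝ᵥ ((P' * Δ * P) *ᵥ ⇑w)| ≤ 6 * (K ^ 8 * t ^ 3) := by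
    refine (abs_bilin_le _ w w).trans ?_
    calc _ ≤ (2 * K * (3 * K * t) * K) * ((K * t) * (K * t)) := by
          gcongr
          exact absSum_mul_le_of_le (absSum_mul_le_of_le hP' hΔb) hP
      _ = 6 * (K ^ 5 * t ^ 3) := by ring
      _ ≤ _ := by gcongr ?_ * (?_ * ?_); exact hKp 5 (by norm_num)
  have s1 : (⇑e - ⇑w) ⬝ᵥ (P' *ᵥ (⇑e - ⇑w)) =
      ⇑e ⬝ᵥ (P' *ᵥ ⇑e) - 2 * (⇑e ⬝ᵥ (P' *ᵥ ⇑w)) + ⇑w ⬝ᵥ (P' *ᵥ ⇑w) := by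
    have : ⇑w ⬝ᵥ (P' *ᵥ ⇑e) = ⇑e ⬝ᵥ (P' *ᵥ ⇑w) := by
      rw [dotProduct_mulVec, ← mulVec_transpose, hP's, dotProduct_comm]
    rw [mulVec_sub, dotProduct_sub, sub_dotProduct, sub_dotProduct, this]
    ring
  have s2 : ⇑e ⬝ᵥ (P' *ᵥ ⇑e) = ⇑e ⬝ᵥ (P *ᵥ ⇑e) - ⇑e ⬝ᵥ ((P * D * P) *ᵥ ⇑e) -
      ⇑e ⬝ᵥ ((P * F * P) *ᵥ ⇑e) + ⇑e ⬝ᵥ ((P * D * P * D * P) *ᵥ ⇑e) + ⇑e ⬝ᵥ (E₃ *ᵥ ⇑e) := by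
    conv_lhs => rw [hexp]
    simp only [add_mulVec, sub_mulVec, dotProduct_add, dotProduct_sub]
  have s3 : ⇑e ⬝ᵥ (P' *ᵥ ⇑w) = ⇑e ⬝ᵥ (P *ᵥ ⇑w) - ⇑e ⬝ᵥ ((P * D * P) *ᵥ ⇑w) +
      ⇑e ⬝ᵥ ((-(P * F * P) + P * D * P * D * P + E₃) *ᵥ ⇑w) := by
    conv_lhs => rw [hexp]
    simp only [add_mulVec, sub_mulVec, neg_mulVec, dotProduct_add, dotProduct_sub, dotProduct_neg]
    ring
  have s4 : ⇑w ⬝ᵥ (P' *ᵥ ⇑w) = ⇑w ⬝ᵥ (P *ᵥ ⇑w) - ⇑w ⬝ᵥ ((P' * Δ * P) *ᵥ ⇑w) := by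
    conv_lhs => rw [hinv]
    simp only [sub_mulVec, dotProduct_sub]
  rw [s1, s2, s3, s4]
  rw [l3', l2'] at l1
  set T : ℝ := K ^ 8 * t ^ 3 with hT
  have hT0 : 0 ≤ T := by positivity
  -- The errors linear in `‖e‖` are absorbed into `1 + ‖e‖ ^ 2`.
  have hTe : T * ‖e‖ ≤ T / 2 + T * ‖e‖ ^ 2 / 2 := by nlinarith [sq_nonneg (‖e‖ - 1)]
  have hgoal : 200 * K ^ 8 * (1 + ‖e‖ ^ 2) * t ^ 3 = 200 * T + 200 * (T * ‖e‖ ^ 2) := by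
    rw [hT]; ring
  have hT2 : 0 ≤ T * ‖e‖ ^ 2 := by positivity
  rw [hgoal]
  obtain ⟨a1, b1⟩ := abs_le.1 l1
  obtain ⟨a2, b2⟩ := abs_le.1 l2
  obtain ⟨a3, b3⟩ := abs_le.1 l3
  obtain ⟨a4, b4⟩ := abs_le.1 q1
  obtain ⟨a5, b5⟩ := abs_le.1 q2
  obtain ⟨a6, b6⟩ := abs_le.1 q3
  rw [abs_le]
  constructor <;> linarith

end Expansion

end IOU

end

/-! ### Taylor's formula with uniform constants. -/

noncomputable section

namespace IOU

section UniformTaylor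

variable {E V : Type*} [NormedAddCommGroup E] [NormedSpace ℝ E] [NormedAddCommGroup V]
  [NormedSpace ℝ V]

theorem abs_sub_le_of_hasDerivAt {g g' : ℝ → ℝ} {C : ℝ} {s : ℝ} (hs : s ∈ Set.Icc (0 : ℝ) 1)
    (hg : ∀ x ∈ Set.Icc (0 : ℝ) 1, HasDerivAt g (g' x) x)
    (hC : ∀ x ∈ Set.Icc (0 : ℝ) 1, |g' x| ≤ C) : |g s - g 0| ≤ C := by
  have h := (convex_Icc (0 : ℝ) 1).norm_image_sub_le_of_norm_hasDerivWithin_le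
    (fun x hx => (hg x hx).hasDerivWithinAt) (C := C) (fun x hx => hC x hx)
    (Set.left_mem_Icc.2 zero_le_one) hs
  have hC0 : 0 ≤ C := (abs_nonneg _).trans (hC s hs)
  refine h.trans ?_
  rw [sub_zero, Real.norm_of_nonneg hs.1]
  exact mul_le_of_le_one_right hC0 hs.2

/-- Three applications of the mean value inequality on `[0, 1]`. The constant is not the optimal `C
/ 6`, but only the order of the remainder matters later. -/
theorem abs_taylor_two_le {g g₁ g₂ g₃ : ℝ → ℝ} {C : ℝ}
    (h0 : ∀ x ∈ Set.Icc (0 : ℝ) 1, HasDerivAt g (g₁ x) x)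
    (h1 : ∀ x ∈ Set.Icc (0 : ℝ) 1, HasDerivAt g₁ (g₂ x) x)
    (h2 : ∀ x ∈ Set.Icc (0 : ℝ) 1, HasDerivAt g₂ (g₃ x) x)
    (h3 : ∀ x ∈ Set.Icc (0 : ℝ) 1, |g₃ x| ≤ C) :
    |g 1 - g 0 - g₁ 0 - 1 / 2 * g₂ 0| ≤ C := by
  have k2 : ∀ x ∈ Set.Icc (0 : ℝ) 1, |g₂ x - g₂ 0| ≤ C := fun x hx =>
    abs_sub_le_of_hasDerivAt hx h2 h3
  have k1 : ∀ x ∈ Set.Icc (0 : ℝ) 1, |g₁ x - g₁ 0 - x * g₂ 0| ≤ C := fun x hx => by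
    have := abs_sub_le_of_hasDerivAt (g := fun x => g₁ x - x * g₂ 0) hx
      (fun y hy => by
        have := (h1 y hy).fun_sub ((hasDerivAt_id y).mul_const (g₂ 0))
        simpa using this) k2
    simpa [sub_right_comm] using this
  have := abs_sub_le_of_hasDerivAt (g := fun x => g x - x * g₁ 0 - x ^ 2 / 2 * g₂ 0)
    (Set.right_mem_Icc.2 zero_le_one) (fun y hy => by
      have := ((h0 y hy).fun_sub ((hasDerivAt_id y).mul_const (g₁ 0))).fun_sub
        (((hasDerivAt_pow 2 y).div_const 2).mul_const (g₂ 0))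
      simpa using this) k1
  convert this using 2
  norm_num
  ring

theorem hasDerivAt_comp_line {G : Type*} [NormedAddCommGroup G] [NormedSpace ℝ G] {f : E → G}
    {f' : E →L[ℝ] G} {x u : E} {s : ℝ} (h : HasFDerivAt f f' (x + s • u)) :
    HasDerivAt (fun s : ℝ => f (x + s • u)) (f' u) s := by
  have hline : HasDerivAt (fun s : ℝ => x + s • u) u s := by
    simpa using ((hasDerivAt_id s).smul_const u).const_add x
  exact h.comp_hasDerivAt s hline

theorem hasDerivAt_comp_line_apply {G : Type*} [NormedAddCommGroup G] [NormedSpace ℝ G]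
    {f : E → E →L[ℝ] G} {f' : E →L[ℝ] E →L[ℝ] G} {x u : E} {s : ℝ}
    (h : HasFDerivAt f f' (x + s • u)) :
    HasDerivAt (fun s : ℝ => f (x + s • u) u) (f' u u) s :=
  hasDerivAt_comp_line (h.clm_apply (hasFDerivAt_const u _)) |>.congr_deriv (by simp)

set_option maxSynthPendingDepth 3 in
theorem hasDerivAt_comp_line_apply_apply {G : Type*} [NormedAddCommGroup G] [NormedSpace ℝ G]
    {f : E → E →L[ℝ] E →L[ℝ] G} {f' : E →L[ℝ] E →L[ℝ] E →L[ℝ] G} {x u : E} {s : ℝ}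
    (h : HasFDerivAt f f' (x + s • u)) :
    HasDerivAt (fun s : ℝ => f (x + s • u) u u) (f' u u u) s := by
  have h1 : HasFDerivAt (fun y => f y u) ((ContinuousLinearMap.apply ℝ (E →L[ℝ] G) u).comp f')
      (x + s • u) := (ContinuousLinearMap.apply ℝ (E →L[ℝ] G) u).hasFDerivAt.comp _ h
  exact (hasDerivAt_comp_line_apply h1).congr_deriv (by simp)

set_option maxSynthPendingDepth 3 in
/-- Taylor's formula of order two, uniform on a compact set. -/
theorem exists_taylor_on_compact {F : E → ℝ} {W S : Set E} (hW : IsOpen W)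
    (hF : ContDiffOn ℝ 3 F W) (hS : IsCompact S) (hSW : S ⊆ W) :
    ∃ (C : ℝ) (F₁ : E → E →L[ℝ] ℝ) (F₂ : E → E →L[ℝ] E →L[ℝ] ℝ), 0 ≤ C ∧ ∀ x ∈ S,
      HasFDerivAt F (F₁ x) x ∧ |F x| ≤ C ∧ ‖F₁ x‖ ≤ C ∧ ‖F₂ x‖ ≤ C ∧
      ∀ u, (∀ s ∈ Set.Icc (0 : ℝ) 1, x + s • u ∈ S) →
        |F (x + u) - F x - F₁ x u - 1 / 2 * F₂ x u u| ≤ C * ‖u‖ ^ 3 := by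
  set F₁ := fderiv ℝ F with hF₁
  set F₂ := fderiv ℝ F₁ with hF₂
  set F₃ := fderiv ℝ F₂ with hF₃
  have c1 : ContDiffOn ℝ 2 F₁ W := hF.fderiv_of_isOpen hW (by norm_num)
  have c2 : ContDiffOn ℝ 1 F₂ W := c1.fderiv_of_isOpen hW (by norm_num)
  have c3 : ContinuousOn F₃ W := c2.continuousOn_fderiv_of_isOpen hW le_rfl
  have d0 : ∀ x ∈ W, HasFDerivAt F (F₁ x) x := fun x hx =>
    ((hF.differentiableOn (by norm_num)).differentiableAt (hW.mem_nhds hx)).hasFDerivAt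
  have d1 : ∀ x ∈ W, HasFDerivAt F₁ (F₂ x) x := fun x hx =>
    ((c1.differentiableOn (by norm_num)).differentiableAt (hW.mem_nhds hx)).hasFDerivAt
  have d2 : ∀ x ∈ W, HasFDerivAt F₂ (F₃ x) x := fun x hx =>
    ((c2.differentiableOn (by norm_num)).differentiableAt (hW.mem_nhds hx)).hasFDerivAt
  obtain ⟨C0, hC0⟩ := hS.exists_bound_of_continuousOn (hF.continuousOn.mono hSW)
  obtain ⟨C1, hC1⟩ := hS.exists_bound_of_continuousOn (c1.continuousOn.mono hSW)
  obtain ⟨C2, hC2⟩ := hS.exists_bound_of_continuousOn (E := E →L[ℝ] E →L[ℝ] ℝ) (f := F₂) (c2.continuousOn.mono hSW)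
  obtain ⟨C3, hC3⟩ := hS.exists_bound_of_continuousOn (E := E →L[ℝ] E →L[ℝ] E →L[ℝ] ℝ) (f := F₃) (c3.mono hSW)
  have hsum : ∀ i : Fin 4, |(![C0, C1, C2, C3] i)| ≤ |C0| + |C1| + |C2| + |C3| := by
    have := abs_nonneg C0
    have := abs_nonneg C1
    have := abs_nonneg C2
    have := abs_nonneg C3
    intro i
    fin_cases i <;> simp <;> linarith
  refine ⟨|C0| + |C1| + |C2| + |C3|, F₁, F₂, by positivity, fun x hx => ⟨d0 x (hSW hx),
    (hC0 x hx).trans ((le_abs_self _).trans (hsum 0)),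
    (hC1 x hx).trans ((le_abs_self _).trans (hsum 1)),
    (hC2 x hx).trans ((le_abs_self _).trans (hsum 2)), fun u hu => ?_⟩⟩
  have key := abs_taylor_two_le (g := fun s => F (x + s • u))
    (g₁ := fun s => F₁ (x + s • u) u) (g₂ := fun s => F₂ (x + s • u) u u)
    (g₃ := fun s => F₃ (x + s • u) u u u) (C := |C3| * ‖u‖ ^ 3)
    (fun s hs => hasDerivAt_comp_line (d0 _ (hSW (hu s hs))))
    (fun s hs => hasDerivAt_comp_line_apply (d1 _ (hSW (hu s hs))))
    (fun s hs => hasDerivAt_comp_line_apply_apply (d2 _ (hSW (hu s hs))))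
    (fun s hs => by
      have h1 := (hC3 _ (hu s hs)).trans (le_abs_self _)
      have h2 := (F₃ (x + s • u) u).le_opNorm₂ u u
      have h3 := (F₃ (x + s • u)).le_opNorm u
      calc _ ≤ _ := h2
        _ ≤ (|C3| * ‖u‖) * ‖u‖ * ‖u‖ := by
          gcongr
          exact h3.trans (by gcongr)
        _ = _ := by ring)
  simp only [one_smul, zero_smul, add_zero] at key
  refine key.trans ?_
  gcongr
  exact hsum 3

/-- Taylor's formula of order two, uniform in a parameter that ranges over a bounded set. -/
theorem exists_uniform_taylor [ProperSpace E] [ProperSpace V] {F : E × V → ℝ} {O : Set V}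
    (hO : IsOpen O) (hF : ContDiffOn ℝ 3 F (Set.univ ×ˢ O)) {v : V} (hv : v ∈ O) (R : ℝ) :
    ∃ r > 0, ∃ C : ℝ, 0 ≤ C ∧ Metric.closedBall v r ⊆ O ∧ ∀ d : E, ‖d‖ ≤ R →
      ∃ b : V → V → ℝ, (∃ B : V →L[ℝ] V →L[ℝ] ℝ, ∀ h k, b h k = B h k) ∧ 
      |F (d, v)| ≤ C ∧ (∀ h, |fderiv ℝ (fun w => F (d, w)) v h| ≤ C * ‖h‖) ∧
      (∀ h k, |b h k| ≤ C * ‖h‖ * ‖k‖) ∧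
      ∀ h : V, ‖h‖ ≤ r →
        |F (d, v + h) - F (d, v) - fderiv ℝ (fun w => F (d, w)) v h - 1 / 2 * b h h| ≤
          C * ‖h‖ ^ 3 := by
  obtain ⟨r, hr, hrO⟩ := Metric.nhds_basis_closedBall.mem_iff.1 (hO.mem_nhds hv)
  -- Uniformity in `d` is compactness: parameter and variable together range over a product of
  -- closed balls, and afterwards only increments `(0, h)` are used.
  obtain ⟨C, F₁, F₂, hC0, hC⟩ := exists_taylor_on_compact (isOpen_univ.prod hO) hF
    ((isCompact_closedBall (0 : E) R).prod (isCompact_closedBall v r))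
    (Set.prod_mono (Set.subset_univ _) hrO)
  refine ⟨r, hr, C, hC0, hrO, fun d hd => ?_⟩
  have hdv : (d, v) ∈ Metric.closedBall (0 : E) R ×ˢ Metric.closedBall v r :=
    ⟨by simpa using hd, Metric.mem_closedBall_self hr.le⟩
  obtain ⟨d0, hF0, hF1, hF2, ht⟩ := hC _ hdv
  have hfd : ∀ h, fderiv ℝ (fun w => F (d, w)) v h = F₁ (d, v) (0, h) := fun h => by
    have : HasFDerivAt (fun w => F (d, w)) _ v := d0.comp v (hasFDerivAt_prodMk_right d v)
    rw [this.fderiv]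
    simp
  have hn : ∀ h : V, ‖((0, h) : E × V)‖ = ‖h‖ := fun h => by simp [Prod.norm_def]
  refine ⟨fun h k => F₂ (d, v) (0, h) (0, k), ⟨((F₂ (d, v)).comp
    (ContinuousLinearMap.inr ℝ E V)).flip.comp (ContinuousLinearMap.inr ℝ E V) |>.flip,
    fun h k => by simp⟩, hF0, fun h => ?_, fun h k => ?_, fun h hh => ?_⟩
  · rw [hfd, ← hn h]
    exact ((F₁ (d, v)).le_opNorm _).trans (by gcongr)
  · rw [← hn h, ← hn k]
    exact ((F₂ (d, v)).le_opNorm₂ _ _).trans (by gcongr)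
  · have := ht (0, h) fun s hs => by
      refine ⟨by simpa using hd, ?_⟩
      simp only [Prod.smul_mk, Prod.mk_add_mk, Metric.mem_closedBall, dist_self_add_left, norm_smul,
        Real.norm_of_nonneg hs.1]
      exact (mul_le_of_le_one_left (norm_nonneg _) hs.2).trans hh
    rw [hn, Prod.mk_add_mk, add_zero] at this
    rwa [hfd]

end UniformTaylor

end IOU

end

/-! ### Uniform expansion of the covariance matrices. -/

noncomputable section

namespace IOU

section CovarianceExpansion

variable {pβ pb pγ : ℕ}

theorem contDiff_gammaOf {n : WithTop ℕ∞} : ContDiff ℝ n (gammaOf (pγ := pγ)) := by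
  rw [contDiff_euclidean]
  intro k
  exact (EuclideanSpace.proj (𝕜 := ℝ) (Sum.inl k : CovIdx pγ)).contDiff

theorem contDiff_scaleOf {n : WithTop ℕ∞} : ContDiff ℝ n (scaleOf (pγ := pγ)) := by
  rw [contDiff_euclidean]
  intro k
  exact (EuclideanSpace.proj (𝕜 := ℝ) (Sum.inr k : CovIdx pγ)).contDiff

theorem contDiff_coord {ι : Type*} [Fintype ι] {n : WithTop ℕ∞} (k : ι) :
    ContDiff ℝ n fun v : EuclideanSpace ℝ ι => v k :=
  (EuclideanSpace.proj (𝕜 := ℝ) k).contDiff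

theorem contDiff_betaOf {n : WithTop ℕ∞} : ContDiff ℝ n (betaOf (pβ := pβ) (pγ := pγ)) := by
  rw [contDiff_euclidean]
  intro k
  exact contDiff_coord (Sum.inl k : ParIdx pβ pγ)

theorem contDiff_covOf {n : WithTop ℕ∞} : ContDiff ℝ n (covOf (pβ := pβ) (pγ := pγ)) := by
  rw [contDiff_euclidean]
  intro k
  exact contDiff_coord (Sum.inr k : ParIdx pβ pγ)

theorem isOpen_covSet {Θγ : Set (EuclideanSpace ℝ (Fin pγ))} {Θs : Set (EuclideanSpace ℝ (Fin 3))}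
    (hΘγ : IsOpen Θγ) (hΘs : IsOpen Θs) : IsOpen (covSet Θγ Θs) :=
  (hΘγ.preimage (contDiff_gammaOf (n := 0)).continuous).inter
    (hΘs.preimage (contDiff_scaleOf (n := 0)).continuous)

theorem isOpen_parSet {Θβ : Set (EuclideanSpace ℝ (Fin pβ))}
    {Θγ : Set (EuclideanSpace ℝ (Fin pγ))} {Θs : Set (EuclideanSpace ℝ (Fin 3))}
    (hΘβ : IsOpen Θβ) (hΘγ : IsOpen Θγ) (hΘs : IsOpen Θs) : IsOpen (parSet Θβ Θγ Θs) :=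
  (hΘβ.preimage (contDiff_betaOf (n := 0)).continuous).inter
    ((isOpen_covSet hΘγ hΘs).preimage (contDiff_covOf (n := 0)).continuous)

/-- The data on which an entry of `Q_i(v)` depends: two rows of `Z_i`, and the numbers
`s`, `t`, `min s t`, `|s - t|` and `δ`. -/
abbrev EntryData (pb : ℕ) : Type :=
  EuclideanSpace ℝ (Fin pb) × EuclideanSpace ℝ (Fin pb) × (Fin 5 → ℝ)

/-- An entry of `Q_i(v)` as a function of its data and of `v`. -/
def entryFun (G : EuclideanSpace ℝ (Fin pγ) → Matrix (Fin pb) (Fin pb) ℝ)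
    (x : EntryData pb × CovPar pγ) : ℝ :=
  (∑ k, (∑ j, x.1.1 j * G (gammaOf x.2) j k) * x.1.2.1 k) +
    (alphaOf x.2 ^ 3)⁻¹ * (tauOf x.2 ^ 2 / 2 *
      (2 * alphaOf x.2 * x.1.2.2 2 + Real.exp (-alphaOf x.2 * x.1.2.2 0)
        + Real.exp (-alphaOf x.2 * x.1.2.2 1) - 1 - Real.exp (-alphaOf x.2 * x.1.2.2 3))) +
    sigmaSqOf x.2 * x.1.2.2 4

/-- The data of the entry `(a, b)` of `Q_i(v)`. -/
def entryData (D : Design pβ pb) (i : ℕ) (a b : Fin (D.n i)) : EntryData pb :=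
  (D.Z i (D.t i a), D.Z i (D.t i b),
    ![D.t i a, D.t i b, min (D.t i a) (D.t i b), |D.t i a - D.t i b|, if a = b then 1 else 0])

/-- The source of uniformity in `i`: all entries, for all individuals, are values of the same
function. -/
theorem QMat_apply (D : Design pβ pb)
    (G : EuclideanSpace ℝ (Fin pγ) → Matrix (Fin pb) (Fin pb) ℝ) (i : ℕ) (v : CovPar pγ)
    (a b : Fin (D.n i)) : QMat D G i v a b = entryFun G (entryData D i a b, v) := by
  simp only [QMat, entryFun, entryData, Matrix.add_apply, Matrix.mul_apply, Matrix.transpose_apply,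
    ZMat, HMat, iouCov, Matrix.of_apply, Matrix.smul_apply, Matrix.one_apply, smul_eq_mul]
  simp
  ring

/-- Smoothness is joint in data and parameter. The minimum and the absolute difference of the times
are coordinates of the data in their own right, so their kinks play no role; `α > 0` takes care of
the inverse cube. -/
theorem contDiffOn_entryFun {G : EuclideanSpace ℝ (Fin pγ) → Matrix (Fin pb) (Fin pb) ℝ}
    {Θγ : Set (EuclideanSpace ℝ (Fin pγ))} {Θs : Set (EuclideanSpace ℝ (Fin 3))}
    (hpos : ∀ s ∈ Θs, ∀ k, 0 < s k) (hG3 : ∀ j k, ContDiffOn ℝ 3 (fun γ => G γ j k) Θγ) :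
    ContDiffOn ℝ 3 (entryFun G) (Set.univ ×ˢ covSet Θγ Θs) := by
  have hα : ContDiff ℝ 3 fun x : EntryData pb × CovPar pγ => alphaOf x.2 :=
    (contDiff_coord _).comp contDiff_snd
  have hτ : ContDiff ℝ 3 fun x : EntryData pb × CovPar pγ => tauOf x.2 :=
    (contDiff_coord _).comp contDiff_snd
  have hσ : ContDiff ℝ 3 fun x : EntryData pb × CovPar pγ => sigmaSqOf x.2 :=
    (contDiff_coord _).comp contDiff_snd
  have hc : ∀ k : Fin 5, ContDiff ℝ 3 fun x : EntryData pb × CovPar pγ => x.1.2.2 k := fun k =>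
    (contDiff_apply ℝ ℝ k).comp (contDiff_snd.comp (contDiff_snd.comp contDiff_fst))
  have hz : ∀ k, ContDiff ℝ 3 fun x : EntryData pb × CovPar pγ => x.1.1 k := fun k =>
    (contDiff_coord k).comp (contDiff_fst.comp contDiff_fst)
  have hz' : ∀ k, ContDiff ℝ 3 fun x : EntryData pb × CovPar pγ => x.1.2.1 k := fun k =>
    (contDiff_coord k).comp (contDiff_fst.comp (contDiff_snd.comp contDiff_fst))
  have hGx : ∀ j k, ContDiffOn ℝ 3 (fun x : EntryData pb × CovPar pγ => G (gammaOf x.2) j k)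
      (Set.univ ×ˢ covSet Θγ Θs) := fun j k =>
    (hG3 j k).comp (contDiff_gammaOf.comp contDiff_snd).contDiffOn fun x hx => hx.2.1
  have hαi : ContDiffOn ℝ 3 (fun x : EntryData pb × CovPar pγ => (alphaOf x.2 ^ 3)⁻¹)
      (Set.univ ×ˢ covSet Θγ Θs) := by
    exact (hα.pow 3).contDiffOn.inv fun x hx => (pow_pos (hpos _ hx.2.2 0) 3).ne'
  refine ContDiffOn.add (ContDiffOn.add (ContDiffOn.sum fun k _ => ContDiffOn.mul
    (ContDiffOn.sum fun j _ => (hz j).contDiffOn.mul (hGx j k)) (hz' k).contDiffOn) ?_) ?_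
  · refine hαi.mul (ContDiff.contDiffOn ?_)
    exact ((hτ.pow 2).div_const 2).mul
      ((((((contDiff_const.mul hα).mul (hc 2)).add ((hα.neg.mul (hc 0)).exp)).add
        ((hα.neg.mul (hc 1)).exp)).sub contDiff_const).sub ((hα.neg.mul (hc 3)).exp))
  · exact (hσ.mul (hc 4)).contDiffOn

theorem exists_norm_entryData_le (D : Design pβ pb) :
    ∃ R : ℝ, ∀ i a b, ‖entryData D i a b‖ ≤ R := by
  obtain ⟨C, hC⟩ := D.covariates_bdd
  have hmem : ∀ i a, D.t i a ∈ Set.Icc 0 D.T := fun i a => ⟨(D.t_pos i a).le, D.t_le i a⟩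
  refine ⟨max C (max D.T 1), fun i a b => ?_⟩
  have h1 := hmem i a
  have h2 := hmem i b
  refine max_le ((hC i _ h1).2.trans (le_max_left _ _)) (max_le
    ((hC i _ h2).2.trans (le_max_left _ _)) ?_)
  refine (pi_norm_le_iff_of_nonneg ?_).2 fun k => ?_
  · exact (zero_le_one.trans (le_max_right _ _)).trans (le_max_right _ _)
  · have hT : ∀ x : ℝ, |x| ≤ D.T → |x| ≤ max C (max D.T 1) := fun x hx =>
      hx.trans ((le_max_left _ _).trans (le_max_right _ _))
    fin_cases k
    · exact hT (D.t i a) (abs_le.2 ⟨by linarith [h1.1, h1.2], h1.2⟩)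
    · exact hT (D.t i b) (abs_le.2 ⟨by linarith [h2.1, h2.2], h2.2⟩)
    · exact hT (min (D.t i a) (D.t i b)) (abs_le.2 ⟨by linarith [h1.1, h1.2, le_min h1.1 h2.1],
        (min_le_left _ _).trans h1.2⟩)
    · refine hT _ ?_
      change |(|D.t i a - D.t i b|)| ≤ _
      rw [abs_abs, abs_le]
      constructor <;> linarith [h1.1, h1.2, h2.1, h2.2]
    · change |(if a = b then (1 : ℝ) else 0)| ≤ _
      split_ifs
      · simp
      · simp

theorem sum_single (h : CovPar pγ) : h = ∑ k, h k • EuclideanSpace.single k (1 : ℝ) := by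
  ext j
  simp only [WithLp.ofLp_sum, Finset.sum_apply, PiLp.smul_apply, PiLp.single_apply, smul_eq_mul,
    mul_ite, mul_one, mul_zero, Finset.sum_ite_eq, Finset.mem_univ, if_true]

/-- The second order expansion of `Q_i(v)`, uniformly in `i`. -/
theorem exists_QMat_expansion (D : Design pβ pb)
    {G : EuclideanSpace ℝ (Fin pγ) → Matrix (Fin pb) (Fin pb) ℝ}
    {Θγ : Set (EuclideanSpace ℝ (Fin pγ))} {Θs : Set (EuclideanSpace ℝ (Fin 3))}
    (hΘγ : IsOpen Θγ) (hΘs : IsOpen Θs)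
    (hpos : ∀ s ∈ Θs, ∀ k, 0 < s k) (hG3 : ∀ j k, ContDiffOn ℝ 3 (fun γ => G γ j k) Θγ)
    {v : CovPar pγ} (hv : v ∈ covSet Θγ Θs) :
    ∃ r > 0, ∃ C : ℝ, 0 ≤ C ∧ Metric.closedBall v r ⊆ covSet Θγ Θs ∧
      ∃ F : ∀ i, CovIdx pγ → CovIdx pγ → Matrix (Fin (D.n i)) (Fin (D.n i)) ℝ, ∀ i a b,
        |QMat D G i v a b| ≤ C ∧ (∀ k, |dQMat D G i k v a b| ≤ C) ∧ (∀ k l, |F i k l a b| ≤ C) ∧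
        ∀ h : CovPar pγ, ‖h‖ ≤ r →
          |(QMat D G i (v + h) - QMat D G i v - ∑ k, h k • dQMat D G i k v
            - ∑ k, ∑ l, (h k * h l) • F i k l) a b| ≤ C * ‖h‖ ^ 3 := by
  obtain ⟨R, hR⟩ := exists_norm_entryData_le D
  obtain ⟨r, hr, C, hC0, hrO, hC⟩ := exists_uniform_taylor (isOpen_covSet hΘγ hΘs)
    (contDiffOn_entryFun (pb := pb) hpos hG3) hv R
  choose! B hBl hB0 hB1 hB2 hB3 using hC
  -- `F` consists of half the second derivatives, which removes the factor `1 / 2` from the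
  -- expansion.
  refine ⟨r, hr, C, hC0, hrO, fun i k l => Matrix.of fun a b => 1 / 2 *
    B (entryData D i a b) (EuclideanSpace.single k 1) (EuclideanSpace.single l 1), fun i a b => ?_⟩
  have hd : ∀ k, dQMat D G i k v a b =
      fderiv ℝ (fun w => entryFun G (entryData D i a b, w)) v (EuclideanSpace.single k 1) :=
    fun k => by simp only [dQMat, Matrix.of_apply, QMat_apply]
  obtain ⟨L, hL⟩ := hBl _ (hR i a b)
  refine ⟨?_, fun k => ?_, fun k l => ?_, fun h hh => ?_⟩
  · rw [QMat_apply]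
    exact hB0 _ (hR i a b)
  · rw [hd]
    simpa using hB1 _ (hR i a b) (EuclideanSpace.single k 1)
  · have := hB2 _ (hR i a b) (EuclideanSpace.single k 1) (EuclideanSpace.single l 1)
    simp only [PiLp.norm_single, norm_one, mul_one] at this
    change |1 / 2 * B _ _ _| ≤ _
    rw [abs_mul, abs_of_pos (by norm_num : (0 : ℝ) < 1 / 2)]
    linarith [abs_nonneg (B (entryData D i a b) (EuclideanSpace.single k 1)
      (EuclideanSpace.single l 1))]
  · convert hB3 _ (hR i a b) h hh using 2
    simp only [Matrix.sub_apply, Matrix.sum_apply, Matrix.smul_apply, smul_eq_mul, Matrix.of_apply,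
      QMat_apply, hd, hL]
    congr 1
    · congr 1
      conv_rhs => rw [sum_single h, map_sum]
      simp
    · conv_rhs => rw [sum_single h]
      simp only [map_sum, map_smul, _root_.sum_apply, _root_.smul_apply,
        smul_eq_mul, Finset.mul_sum]
      rw [Finset.sum_comm]
      refine Finset.sum_congr rfl fun k _ => Finset.sum_congr rfl fun l _ => ?_
      ring

end CovarianceExpansion

end IOU

end

/-! ### Score, second-order matrix and information of a Gaussian family. -/

noncomputable section

namespace IOU

section ScoreHessian

variable {n β κ : Type*} [Fintype n]

/-- The score of `N(X b, Q)` at the residual `e`, in the directions `b` and of the derivatives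
`Dm k` of `Q`; here `P` stands for `Q⁻¹`. -/
def gaussScore (X : Matrix n β ℝ) (P : Matrix n n ℝ) (Dm : κ → Matrix n n ℝ) (e : n → ℝ) :
    EuclideanSpace ℝ (β ⊕ κ) :=
  WithLp.toLp 2 (Sum.elim (fun a => (e ᵥ* (P * X)) a)
    fun k => 1 / 2 * (e ⬝ᵥ ((P * Dm k * P) *ᵥ e) - (P * Dm k).trace))

/-- The matrix of second derivatives of the logarithm of the density of `N(X b, Q)`; here `F k l`
stands for half the second derivatives of `Q`. -/
def gaussHess (X : Matrix n β ℝ) (P : Matrix n n ℝ) (Dm : κ → Matrix n n ℝ)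
    (F : κ → κ → Matrix n n ℝ) (e : n → ℝ) : Matrix (β ⊕ κ) (β ⊕ κ) ℝ :=
  Matrix.fromBlocks (-(Xᵀ * P * X))
    (Matrix.of fun a l => -((e ᵥ* (P * Dm l * P * X)) a))
    (Matrix.of fun k a => -((e ᵥ* (P * Dm k * P * X)) a))
    (Matrix.of fun k l => (e ⬝ᵥ ((P * F k l * P) *ᵥ e) - (P * F k l).trace)
      + 1 / 2 * (P * Dm k * P * Dm l).trace - e ⬝ᵥ ((P * Dm k * P * Dm l * P) *ᵥ e))

/-- The information matrix of the family `N(X b, Q)`. -/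
def gaussInfo (X : Matrix n β ℝ) (P : Matrix n n ℝ) (Dm : κ → Matrix n n ℝ) :
    Matrix (β ⊕ κ) (β ⊕ κ) ℝ :=
  Matrix.fromBlocks (Xᵀ * P * X) 0 0 (Matrix.of fun j k => 1 / 2 * (P * Dm k * P * Dm j).trace)

theorem continuous_gaussScore (X : Matrix n β ℝ) (P : Matrix n n ℝ) (Dm : κ → Matrix n n ℝ) :
    Continuous fun e : EuclideanSpace ℝ n => gaussScore X P Dm ⇑e := by
  refine (PiLp.continuous_toLp 2 _).comp (continuous_pi fun a => ?_)
  rcases a with a | k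
  · simp only [Sum.elim_inl, Matrix.vecMul, dotProduct]
    fun_prop
  · simp only [Sum.elim_inr, Matrix.mulVec, dotProduct]
    fun_prop

theorem continuous_gaussHess (X : Matrix n β ℝ) (P : Matrix n n ℝ) (Dm : κ → Matrix n n ℝ)
    (F : κ → κ → Matrix n n ℝ) (a b : β ⊕ κ) :
    Continuous fun e : EuclideanSpace ℝ n => gaussHess X P Dm F ⇑e a b := by
  rcases a with a | k <;> rcases b with b | l <;>
    simp only [gaussHess, Matrix.fromBlocks_apply₁₁, Matrix.fromBlocks_apply₁₂,
      Matrix.fromBlocks_apply₂₁, Matrix.fromBlocks_apply₂₂, Matrix.of_apply, Matrix.vecMul,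
      Matrix.mulVec, dotProduct] <;> fun_prop

variable [Fintype β]

section Bounds

variable {X : Matrix n β ℝ} {P : Matrix n n ℝ} {Dm : κ → Matrix n n ℝ} {F : κ → κ → Matrix n n ℝ}
  {K : ℝ}

theorem abs_vecMul_apply_le (M : Matrix n β ℝ) (e : EuclideanSpace ℝ n) (a : β) :
    |(⇑e ᵥ* M) a| ≤ absSum M * ‖e‖ := by
  classical
  have h := abs_bilin_le M e (EuclideanSpace.single a 1)
  rw [Matrix.dotProduct_mulVec] at h
  simpa using h

theorem abs_gaussScore_le (hK : 1 ≤ K) (hX : absSum X ≤ K) (hP : absSum P ≤ K)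
    (hD : ∀ k, absSum (Dm k) ≤ K) (e : EuclideanSpace ℝ n) (a : β ⊕ κ) :
    |gaussScore X P Dm ⇑e a| ≤ K ^ 3 * (1 + ‖e‖ ^ 2) := by
  have h32 : K ^ 2 ≤ K ^ 3 := pow_le_pow_right₀ hK (by norm_num)
  have hne := norm_nonneg e
  have hK2 : 0 ≤ K ^ 2 := by positivity
  rcases a with a | k
  · have h1 := abs_vecMul_apply_le (P * X) e a
    have h2 := absSum_mul_le_of_le hP hX
    calc _ ≤ _ := h1
      _ ≤ (K * K) * (1 + ‖e‖ ^ 2) := by gcongr; nlinarith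
      _ ≤ _ := by rw [← sq]; gcongr
  · have h1 := abs_bilin_le (P * Dm k * P) e e
    have h2 := absSum_mul_le_of_le (absSum_mul_le_of_le hP (hD k)) hP
    have h3 := (abs_trace_le (P * Dm k)).trans (absSum_mul_le_of_le hP (hD k))
    have h4 : |⇑e ⬝ᵥ ((P * Dm k * P) *ᵥ ⇑e)| ≤ K * K * K * (‖e‖ * ‖e‖) :=
      h1.trans (by gcongr)
    change |1 / 2 * (⇑e ⬝ᵥ ((P * Dm k * P) *ᵥ ⇑e) - (P * Dm k).trace)| ≤ _
    rw [abs_le] at h3 h4 ⊢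
    have : 0 ≤ K ^ 3 * ‖e‖ ^ 2 := by positivity
    constructor <;> nlinarith

theorem abs_gaussHess_le (hK : 1 ≤ K) (hX : absSum X ≤ K) (hP : absSum P ≤ K)
    (hD : ∀ k, absSum (Dm k) ≤ K) (hF : ∀ k l, absSum (F k l) ≤ K) (e : EuclideanSpace ℝ n)
    (a b : β ⊕ κ) : |gaussHess X P Dm F ⇑e a b| ≤ 3 * K ^ 5 * (1 + ‖e‖ ^ 2) := by
  have h35 : K ^ 3 ≤ K ^ 5 := pow_le_pow_right₀ hK (by norm_num)
  have h45 : K ^ 4 ≤ K ^ 5 := pow_le_pow_right₀ hK (by norm_num)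
  have h25 : K ^ 2 ≤ K ^ 5 := pow_le_pow_right₀ hK (by norm_num)
  have hne := norm_nonneg e
  have hK0 : 0 ≤ K := by linarith
  have hK5 : 0 ≤ K ^ 5 := by positivity
  have hK5e : 0 ≤ K ^ 5 * ‖e‖ ^ 2 := by positivity
  have hlin : ∀ k a, |-((⇑e ᵥ* (P * Dm k * P * X)) a)| ≤ 3 * K ^ 5 * (1 + ‖e‖ ^ 2) := fun k a => by
    have h1 := abs_vecMul_apply_le (P * Dm k * P * X) e a
    have h2 := absSum_mul_le_of_le (absSum_mul_le_of_le (absSum_mul_le_of_le hP (hD k)) hP) hX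
    rw [abs_neg]
    calc _ ≤ _ := h1
      _ ≤ (K * K * K * K) * (1 + ‖e‖ ^ 2) := by gcongr; nlinarith
      _ = K ^ 4 * (1 + ‖e‖ ^ 2) := by ring
      _ ≤ _ := by gcongr; linarith
  rcases a with a | k <;> rcases b with b | l
  · have h1 := (abs_apply_le_absSum (-(Xᵀ * P * X)) a b)
    rw [absSum_neg] at h1
    have h2 := absSum_mul_le_of_le (absSum_mul_le_of_le ((absSum_transpose X).trans_le hX) hP) hX
    calc _ ≤ _ := h1
      _ ≤ K * K * K := h2
      _ ≤ _ := by nlinarith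
  · exact hlin l a
  · exact hlin k b
  · have h1 := (abs_bilin_le (P * F k l * P) e e).trans (mul_le_mul_of_nonneg_right
      (absSum_mul_le_of_le (absSum_mul_le_of_le hP (hF k l)) hP) (by positivity))
    have h2 := (abs_trace_le (P * F k l)).trans (absSum_mul_le_of_le hP (hF k l))
    have h3 := (abs_trace_le (P * Dm k * P * Dm l)).trans
      (absSum_mul_le_of_le (absSum_mul_le_of_le (absSum_mul_le_of_le hP (hD k)) hP) (hD l))
    have h4 := (abs_bilin_le (P * Dm k * P * Dm l * P) e e).trans (mul_le_mul_of_nonneg_right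
      (absSum_mul_le_of_le (absSum_mul_le_of_le (absSum_mul_le_of_le (absSum_mul_le_of_le hP (hD k))
        hP) (hD l)) hP) (by positivity))
    have h5 : K ^ 3 * ‖e‖ ^ 2 ≤ K ^ 5 * ‖e‖ ^ 2 := by gcongr
    change |(⇑e ⬝ᵥ ((P * F k l * P) *ᵥ ⇑e) - (P * F k l).trace)
      + 1 / 2 * (P * Dm k * P * Dm l).trace - ⇑e ⬝ᵥ ((P * Dm k * P * Dm l * P) *ᵥ ⇑e)| ≤ _
    rw [abs_le] at h1 h2 h3 h4 ⊢
    constructor <;> linarith [h1.1, h1.2, h2.1, h2.2, h3.1, h3.2, h4.1, h4.2]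

end Bounds

variable [Fintype κ]

theorem gaussScore_dotProduct (X : Matrix n β ℝ) (P : Matrix n n ℝ) (Dm : κ → Matrix n n ℝ)
    (e : n → ℝ) (η : β → ℝ) (ν : κ → ℝ) :
    ⇑(gaussScore X P Dm e) ⬝ᵥ Sum.elim η ν = e ⬝ᵥ (P *ᵥ (X *ᵥ η)) +
      1 / 2 * (e ⬝ᵥ ((P * (∑ k, ν k • Dm k) * P) *ᵥ e) - (P * ∑ k, ν k • Dm k).trace) := by
  simp only [gaussScore, sumElim_dotProduct_sumElim]
  congr 1
  · rw [Matrix.mulVec_mulVec, Matrix.dotProduct_mulVec]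
  · simp only [Matrix.sum_mul, Matrix.sum_mulVec, dotProduct_sum, Matrix.trace_sum,
      Matrix.mul_smul, Matrix.smul_mul, Matrix.smul_mulVec, dotProduct_smul, Matrix.trace_smul,
      smul_eq_mul, ← Finset.sum_sub_distrib, Finset.mul_sum]
    exact Finset.sum_congr rfl fun k _ => by ring

theorem quadraticForm_fromBlocks (A : Matrix β β ℝ) (B : Matrix β κ ℝ) (C : Matrix κ β ℝ)
    (M : Matrix κ κ ℝ) (η : β → ℝ) (ν : κ → ℝ) :
    Sum.elim η ν ⬝ᵥ (Matrix.fromBlocks A B C M *ᵥ Sum.elim η ν) =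
      η ⬝ᵥ (A *ᵥ η) + η ⬝ᵥ (B *ᵥ ν) + ν ⬝ᵥ (C *ᵥ η) + ν ⬝ᵥ (M *ᵥ ν) := by
  rw [Matrix.fromBlocks_mulVec, sumElim_dotProduct_sumElim]
  simp [dotProduct_add]
  ring

/-- The right-hand side is the second-order term of `abs_gaussian_expansion_le`. Only the quadratic
form enters, so the matrix is not required to be symmetric. -/
theorem gaussHess_quadraticForm (X : Matrix n β ℝ) (P : Matrix n n ℝ) (Dm : κ → Matrix n n ℝ)
    (F : κ → κ → Matrix n n ℝ) (e : n → ℝ) (η : β → ℝ) (ν : κ → ℝ) {w : n → ℝ}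
    (hw : w = X *ᵥ η) {D F' : Matrix n n ℝ} (hD : D = ∑ k, ν k • Dm k)
    (hF : F' = ∑ k, ∑ l, (ν k * ν l) • F k l) :
    1 / 2 * (Sum.elim η ν ⬝ᵥ (gaussHess X P Dm F e *ᵥ Sum.elim η ν)) =
      -(1 / 2) * (w ⬝ᵥ (P *ᵥ w)) - e ⬝ᵥ ((P * D * P) *ᵥ w)
        + 1 / 2 * (e ⬝ᵥ ((P * F' * P) *ᵥ e) - (P * F').trace)
        + 1 / 4 * (P * D * (P * D)).trace - 1 / 2 * (e ⬝ᵥ ((P * D * P * D * P) *ᵥ e)) := by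
  have hcross : ∀ l, (e ᵥ* (P * Dm l * P * X)) ⬝ᵥ η = e ⬝ᵥ ((P * Dm l * P) *ᵥ w) := fun l => by
    rw [hw, ← Matrix.dotProduct_mulVec, Matrix.mulVec_mulVec]
  have h1 : η ⬝ᵥ ((-(Xᵀ * P * X)) *ᵥ η) = -(w ⬝ᵥ (P *ᵥ w)) := by
    rw [hw, Matrix.neg_mulVec, dotProduct_neg, ← Matrix.mulVec_mulVec, ← Matrix.mulVec_mulVec,
      Matrix.dotProduct_mulVec, Matrix.vecMul_transpose]
  have h3 : ν ⬝ᵥ ((Matrix.of fun k a => -((e ᵥ* (P * Dm k * P * X)) a)) *ᵥ η) =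
      -(e ⬝ᵥ ((P * D * P) *ᵥ w)) := by
    have : ((Matrix.of fun k a => -((e ᵥ* (P * Dm k * P * X)) a)) *ᵥ η) =
        fun k => -(e ⬝ᵥ ((P * Dm k * P) *ᵥ w)) := by
      ext k
      rw [← hcross]
      simp [Matrix.mulVec, dotProduct]
    rw [this, hD]
    simp only [Matrix.mul_sum, Matrix.sum_mul, Matrix.sum_mulVec, dotProduct_sum,
      Matrix.mul_smul, Matrix.smul_mul, Matrix.smul_mulVec, dotProduct_smul, smul_eq_mul]
    rw [dotProduct, ← Finset.sum_neg_distrib]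
    exact Finset.sum_congr rfl fun k _ => by ring
  have h2 : η ⬝ᵥ ((Matrix.of fun a l => -((e ᵥ* (P * Dm l * P * X)) a)) *ᵥ ν) =
      -(e ⬝ᵥ ((P * D * P) *ᵥ w)) := by
    rw [← h3, Matrix.dotProduct_mulVec, dotProduct_comm, ← Matrix.mulVec_transpose]
    rfl
  have h4 : ν ⬝ᵥ ((Matrix.of fun k l => (e ⬝ᵥ ((P * F k l * P) *ᵥ e) - (P * F k l).trace)
      + 1 / 2 * (P * Dm k * P * Dm l).trace - e ⬝ᵥ ((P * Dm k * P * Dm l * P) *ᵥ e)) *ᵥ ν) =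
      (e ⬝ᵥ ((P * F' * P) *ᵥ e) - (P * F').trace)
        + 1 / 2 * (P * D * (P * D)).trace - e ⬝ᵥ ((P * D * P * D * P) *ᵥ e) := by
    have t1 : e ⬝ᵥ ((P * F' * P) *ᵥ e) =
        ∑ k, ∑ l, ν k * (ν l * (e ⬝ᵥ ((P * F k l * P) *ᵥ e))) := by
      simp only [hF, Matrix.mul_sum, Matrix.sum_mul, Matrix.sum_mulVec, dotProduct_sum,
        Matrix.mul_smul, Matrix.smul_mul, Matrix.smul_mulVec, dotProduct_smul, smul_eq_mul,
        mul_assoc]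
    have t2 : (P * F').trace = ∑ k, ∑ l, ν k * (ν l * (P * F k l).trace) := by
      simp only [hF, Matrix.mul_sum, Matrix.trace_sum, Matrix.mul_smul, Matrix.trace_smul,
        smul_eq_mul, mul_assoc]
    have t3 : (P * D * (P * D)).trace =
        ∑ k, ∑ l, ν k * (ν l * (P * Dm k * P * Dm l).trace) := by
      rw [← Matrix.mul_assoc, hD]
      simp only [Matrix.sum_mul, Matrix.trace_sum, Matrix.mul_smul,
        Matrix.smul_mul, Matrix.trace_smul, smul_eq_mul, Finset.mul_sum]
      rw [Finset.sum_comm]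
      exact Finset.sum_congr rfl fun k _ => Finset.sum_congr rfl fun l _ => by ring
    have t4 : e ⬝ᵥ ((P * D * P * D * P) *ᵥ e) =
        ∑ k, ∑ l, ν k * (ν l * (e ⬝ᵥ ((P * Dm k * P * Dm l * P) *ᵥ e))) := by
      rw [hD]
      simp only [Matrix.sum_mul, Matrix.sum_mulVec, dotProduct_sum,
        Matrix.mul_smul, Matrix.smul_mul, Matrix.smul_mulVec, dotProduct_smul, smul_eq_mul,
        Finset.mul_sum]
      rw [Finset.sum_comm]
      exact Finset.sum_congr rfl fun k _ => Finset.sum_congr rfl fun l _ => by ring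
    have hb : ∀ f : κ → κ → ℝ, ν ⬝ᵥ (Matrix.of f *ᵥ ν) = ∑ k, ∑ l, ν k * (ν l * f k l) := by
      intro f
      simp only [Matrix.mulVec, dotProduct, Matrix.of_apply, Finset.mul_sum]
      exact Finset.sum_congr rfl fun k _ => Finset.sum_congr rfl fun l _ => by ring
    rw [t1, t2, t3, t4, hb]
    simp only [Finset.mul_sum, ← Finset.sum_sub_distrib, ← Finset.sum_add_distrib]
    exact Finset.sum_congr rfl fun k _ => Finset.sum_congr rfl fun l _ => by ring
  rw [gaussHess, quadraticForm_fromBlocks, h1, h2, h3, h4]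
  ring

theorem gaussInfo_quadraticForm (X : Matrix n β ℝ) (P : Matrix n n ℝ) (Dm : κ → Matrix n n ℝ)
    (η : β → ℝ) (ν : κ → ℝ) {w : n → ℝ}
    (hw : w = X *ᵥ η) {D : Matrix n n ℝ} (hD : D = ∑ k, ν k • Dm k) :
    Sum.elim η ν ⬝ᵥ (gaussInfo X P Dm *ᵥ Sum.elim η ν) =
      w ⬝ᵥ (P *ᵥ w) + 1 / 2 * (P * D * P * D).trace := by
  have h1 : η ⬝ᵥ ((Xᵀ * P * X) *ᵥ η) = w ⬝ᵥ (P *ᵥ w) := by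
    rw [hw, ← Matrix.mulVec_mulVec, ← Matrix.mulVec_mulVec, Matrix.dotProduct_mulVec,
      Matrix.vecMul_transpose]
  have h2 : ν ⬝ᵥ ((Matrix.of fun j k => 1 / 2 * (P * Dm k * P * Dm j).trace) *ᵥ ν) =
      1 / 2 * (P * D * P * D).trace := by
    rw [hD]
    simp only [Matrix.mul_sum, Matrix.sum_mul, Matrix.trace_sum, Matrix.mul_smul,
      Matrix.smul_mul, Matrix.trace_smul, smul_eq_mul]
    simp only [Matrix.mulVec, dotProduct, Matrix.of_apply, Finset.mul_sum]
    exact Finset.sum_congr rfl fun k _ => Finset.sum_congr rfl fun l _ => by ring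
  rw [gaussInfo, quadraticForm_fromBlocks, h1, h2]
  simp

section Moments

variable [DecidableEq n]
variable {X : Matrix n β ℝ} {Q : Matrix n n ℝ} {Dm : κ → Matrix n n ℝ}

theorem PosDef.inv_mul_self (hQ : Q.PosDef) : Q⁻¹ * Q = 1 :=
  Matrix.nonsing_inv_mul _ hQ.det_pos.ne'.isUnit

theorem PosDef.isSymm_inv (hQ : Q.PosDef) : (Q⁻¹).IsSymm := by
  have := hQ.inv.isHermitian
  simpa [Matrix.IsHermitian, Matrix.IsSymm] using this

theorem trace_mul_mul_mul_self {A B : Matrix n n ℝ} (hA : A * B = 1) (M : Matrix n n ℝ) :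
    (A * M * A * B).trace = (A * M).trace := by
  rw [Matrix.mul_assoc _ A, hA, Matrix.mul_one]

/-- Brings the score into the form `l·e + (e·Me - tr (M Q))` with `M = ½ Q⁻¹ D Q⁻¹`, for which the
first two moments are known. -/
theorem gaussScore_dotProduct_eq (hQ : Q.PosDef) (e : n → ℝ) (η : β → ℝ) (ν : κ → ℝ) :
    ⇑(gaussScore X Q⁻¹ Dm e) ⬝ᵥ Sum.elim η ν = (Q⁻¹ *ᵥ (X *ᵥ η)) ⬝ᵥ e +
      (e ⬝ᵥ (((1 / 2 : ℝ) • (Q⁻¹ * (∑ k, ν k • Dm k) * Q⁻¹)) *ᵥ e) -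
        (((1 / 2 : ℝ) • (Q⁻¹ * (∑ k, ν k • Dm k) * Q⁻¹)) * Q).trace) := by
  rw [gaussScore_dotProduct, dotProduct_comm, Matrix.smul_mul, Matrix.trace_smul,
    trace_mul_mul_mul_self (PosDef.inv_mul_self hQ), Matrix.smul_mulVec, dotProduct_smul,
    smul_eq_mul, smul_eq_mul]
  ring

theorem integral_gaussScore_dotProduct (hQ : Q.PosDef) (u : β ⊕ κ → ℝ) :
    ∫ e : EuclideanSpace ℝ n, ⇑(gaussScore X Q⁻¹ Dm ⇑e) ⬝ᵥ u ∂(multivariateGaussian 0 Q) = 0 := by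
  rw [← Sum.elim_comp_inl_inr u]
  simp_rw [gaussScore_dotProduct_eq hQ]
  rw [integral_add, integral_sub, integral_dotProduct hQ.posSemidef,
    integral_quadraticForm hQ.posSemidef]
  · simp
  · exact integrable_quadraticForm _
  · exact integrable_const _
  · simpa using integrable_dotProduct_pow (S := Q) (Q⁻¹ *ᵥ (X *ᵥ (u ∘ Sum.inl))) 1
  · exact (integrable_quadraticForm _).sub (integrable_const _)

/-- Inserting `l = Q⁻¹ X η` and `M = ½ Q⁻¹ D Q⁻¹` into `l·Ql + 2 tr (M Q M Q)` cancels every `Q`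
against an inverse; `2 · ¼` gives the factor `½` of the information. -/
theorem integral_gaussScore_dotProduct_sq (hQ : Q.PosDef) (hD : ∀ k, (Dm k).IsSymm)
    (u : β ⊕ κ → ℝ) :
    ∫ e : EuclideanSpace ℝ n, (⇑(gaussScore X Q⁻¹ Dm ⇑e) ⬝ᵥ u) ^ 2 ∂(multivariateGaussian 0 Q) =
      u ⬝ᵥ (gaussInfo X Q⁻¹ Dm *ᵥ u) := by
  rw [← Sum.elim_comp_inl_inr u]
  set η := u ∘ Sum.inl
  set ν := u ∘ Sum.inr
  simp_rw [gaussScore_dotProduct_eq hQ]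
  set D := ∑ k, ν k • Dm k with hDdef
  have hDs : D.IsSymm := by
    simp only [Matrix.IsSymm, hDdef, Matrix.transpose_sum, Matrix.transpose_smul, (hD _).eq]
  have hPs := PosDef.isSymm_inv hQ
  have hM : ((1 / 2 : ℝ) • (Q⁻¹ * D * Q⁻¹)).IsSymm := by
    simp only [Matrix.IsSymm, Matrix.transpose_smul, Matrix.transpose_mul, hPs.eq, hDs.eq,
      Matrix.mul_assoc]
  rw [integral_sq_linear_add_quadratic hQ.posSemidef _ hM, gaussInfo_quadraticForm X Q⁻¹ Dm η ν
    rfl hDdef]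
  have hPQ := PosDef.inv_mul_self hQ
  have hQP : Q * Q⁻¹ = 1 := Matrix.mul_nonsing_inv _ hQ.det_pos.ne'.isUnit
  congr 1
  · have : Q *ᵥ (Q⁻¹ *ᵥ (X *ᵥ η)) = X *ᵥ η := by
      rw [Matrix.mulVec_mulVec, hQP, Matrix.one_mulVec]
    rw [this, dotProduct_comm]
  · have : ((1 / 2 : ℝ) • (Q⁻¹ * D * Q⁻¹)) * Q * ((1 / 2 : ℝ) • (Q⁻¹ * D * Q⁻¹)) * Q =
        (1 / 4 : ℝ) • (Q⁻¹ * D * Q⁻¹ * D) := by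
      simp only [Matrix.smul_mul, Matrix.mul_smul, smul_smul, Matrix.mul_assoc, hPQ, Matrix.mul_one]
      norm_num
    rw [this, Matrix.trace_smul, smul_eq_mul]
    ring

end Moments

end ScoreHessian

/-- The mixed blocks are linear in `e` and average to zero. The terms with `F` are centered, and the
rest of the last block averages to `½ tr - tr = -½ tr`. -/
theorem integral_gaussHess {n β κ : Type*} [Fintype n] [DecidableEq n] {X : Matrix n β ℝ}
    {Q : Matrix n n ℝ} {Dm : κ → Matrix n n ℝ} (hQ : Q.PosDef) (F : κ → κ → Matrix n n ℝ) (a b : β ⊕ κ) :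
    ∫ e : EuclideanSpace ℝ n, gaussHess X Q⁻¹ Dm F ⇑e a b ∂(multivariateGaussian 0 Q) =
      -gaussInfo X Q⁻¹ Dm a b := by
  have hPQ := PosDef.inv_mul_self hQ
  have hlin : ∀ (M : Matrix n β ℝ) (a : β),
      ∫ e : EuclideanSpace ℝ n, -((⇑e ᵥ* M) a) ∂(multivariateGaussian 0 Q) = 0 := fun M a => by
    rw [integral_neg, neg_eq_zero]
    rw [← integral_dotProduct hQ.posSemidef (fun b => M b a)]
    exact integral_congr_ae (Eventually.of_forall fun e => dotProduct_comm _ _)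
  rcases a with a | k <;> rcases b with b | l
  · simp [gaussHess, gaussInfo]
  · simpa [gaussHess, gaussInfo] using hlin _ a
  · simpa [gaussHess, gaussInfo] using hlin _ b
  · simp only [gaussHess, gaussInfo, Matrix.fromBlocks_apply₂₂, Matrix.of_apply]
    rw [integral_sub, integral_add, integral_sub, integral_quadraticForm hQ.posSemidef,
      integral_quadraticForm hQ.posSemidef, trace_mul_mul_mul_self hPQ]
    · simp only [integral_const, probReal_univ, one_smul]
      have hc : (Q⁻¹ * Dm k * Q⁻¹ * Dm l).trace = (Q⁻¹ * Dm l * Q⁻¹ * Dm k).trace := by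
        rw [Matrix.mul_assoc (Q⁻¹ * Dm k), Matrix.trace_mul_comm, ← Matrix.mul_assoc]
      rw [Matrix.mul_assoc _ Q⁻¹ Q, hPQ, Matrix.mul_one, hc]
      ring
    all_goals
      first
      | exact integrable_quadraticForm _
      | exact integrable_const _
      | exact (integrable_quadraticForm _).sub (integrable_const _)
      | exact ((integrable_quadraticForm _).sub (integrable_const _)).add (integrable_const _)

end IOU

end

/-! ### Uniform expansion of the contribution of one individual. -/

noncomputable section

namespace IOU

/-- Apply the lower bound to a column `x` of the inverse: as `Q x` is a unit vector, `c |x|² ≤ x_b ≤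
|x|`. -/
theorem abs_inv_apply_le {n : Type*} [Fintype n] [DecidableEq n] {Q : Matrix n n ℝ}
    (hQ : Q.PosDef) {c : ℝ} (hc : 0 < c) (h : ∀ x : n → ℝ, c * (x ⬝ᵥ x) ≤ x ⬝ᵥ (Q *ᵥ x)) (a b : n) :
    |Q⁻¹ a b| ≤ c⁻¹ := by
  have hQP : Q * Q⁻¹ = 1 := Matrix.mul_nonsing_inv _ hQ.det_pos.ne'.isUnit
  set x : n → ℝ := Q⁻¹ *ᵥ Pi.single b 1 with hx
  have hxa : ∀ a, x a = Q⁻¹ a b := fun a => by simp [hx]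
  have h1 : Q *ᵥ x = Pi.single b 1 := by rw [hx, Matrix.mulVec_mulVec, hQP, Matrix.one_mulVec]
  have h2 : ∀ a, x a ^ 2 ≤ x ⬝ᵥ x := fun a => by
    rw [sq]
    exact Finset.single_le_sum (f := fun a => x a * x a) (fun a _ => mul_self_nonneg _)
      (Finset.mem_univ a)
  have h3 := h x
  rw [h1] at h3
  simp only [dotProduct_single, mul_one] at h3
  have h4 : c * |x b| ≤ 1 := by
    rcases (abs_nonneg (x b)).eq_or_lt with h0 | h0
    · rw [← h0]; simp
    · have h5 := h2 b
      rw [← sq_abs] at h5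
      have : c * |x b| ^ 2 ≤ |x b| := ((mul_le_mul_of_nonneg_left h5 hc.le).trans h3).trans
        (le_abs_self _)
      nlinarith
  rw [← hxa]
  have h5 : (c * |x a|) ^ 2 ≤ 1 := by
    have h6 := h2 a
    rw [← sq_abs] at h6
    calc (c * |x a|) ^ 2 = c * (c * |x a| ^ 2) := by ring
      _ ≤ c * (c * (x ⬝ᵥ x)) := by gcongr
      _ ≤ c * |x b| := by gcongr; exact h3.trans (le_abs_self _)
      _ ≤ 1 := h4
  have h6 : c * |x a| ≤ 1 := by
    have := abs_le_of_sq_le_sq (h5.trans_eq (one_pow 2).symm) zero_le_one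
    exact (le_abs_self _).trans this
  rw [← mul_le_mul_iff_right₀ hc, mul_inv_cancel₀ hc.ne']
  exact h6

section Individual

variable {pβ pb pγ : ℕ} {D : Design pβ pb}
  {G : EuclideanSpace ℝ (Fin pγ) → Matrix (Fin pb) (Fin pb) ℝ}
  {Θβ : Set (EuclideanSpace ℝ (Fin pβ))}
  {Θγ : Set (EuclideanSpace ℝ (Fin pγ))} {Θs : Set (EuclideanSpace ℝ (Fin 3))}

theorem iouCov_comm (α τ s t : ℝ) : iouCov α τ s t = iouCov α τ t s := by
  simp only [iouCov, min_comm s t, abs_sub_comm s t]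
  ring

theorem HMat_isSymm (i : ℕ) (α τ : ℝ) : (HMat D i α τ).IsSymm :=
  Matrix.IsSymm.ext fun _ _ => iouCov_comm _ _ _ _

theorem QMat_isSymm (hG : ∀ γ ∈ Θγ, (G γ).PosSemidef) {v : CovPar pγ} (hv : v ∈ covSet Θγ Θs)
    (i : ℕ) : (QMat D G i v).IsSymm := by
  have hGs : (G (gammaOf v))ᵀ = G (gammaOf v) := by
    have := (hG _ hv.1).isHermitian.eq
    rwa [conjTranspose_eq_transpose_of_trivial] at this
  simp only [QMat, Matrix.IsSymm, Matrix.transpose_add, Matrix.transpose_mul,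
    Matrix.transpose_transpose, hGs, (HMat_isSymm i _ _).eq, Matrix.transpose_smul,
    Matrix.transpose_one, Matrix.mul_assoc]

theorem QMat_posDef (hG : ∀ γ ∈ Θγ, (G γ).PosSemidef)
    (hQ : UniformlyNondegenerate D G (covSet Θγ Θs)) {v : CovPar pγ} (hv : v ∈ covSet Θγ Θs)
    (i : ℕ) : (QMat D G i v).PosDef := by
  obtain ⟨c, hc, h⟩ := hQ v hv
  rw [Matrix.posDef_iff_dotProduct_mulVec]
  refine ⟨?_, fun x hx => ?_⟩
  · rw [Matrix.IsHermitian, conjTranspose_eq_transpose_of_trivial]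
    exact QMat_isSymm hG hv i
  · refine lt_of_lt_of_le (mul_pos hc ?_) (h i x)
    refine lt_of_le_of_ne (Finset.sum_nonneg fun a _ => mul_self_nonneg _) fun h0 => hx ?_
    exact dotProduct_self_eq_zero.1 h0.symm

theorem dQMat_isSymm (hΘγ : IsOpen Θγ) (hΘs : IsOpen Θs) (hG : ∀ γ ∈ Θγ, (G γ).PosSemidef)
    {v : CovPar pγ} (hv : v ∈ covSet Θγ Θs) (i : ℕ) (k : CovIdx pγ) :
    (dQMat D G i k v).IsSymm := by
  refine Matrix.IsSymm.ext fun a b => ?_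
  simp only [dQMat, Matrix.of_apply]
  have : (fun w => QMat D G i w b a) =ᶠ[𝓝 v] fun w => QMat D G i w a b := by
    filter_upwards [(isOpen_covSet hΘγ hΘs).mem_nhds hv] with w hw
    exact (QMat_isSymm hG hw i).apply a b
  rw [this.fderiv_eq]

theorem norm_betaOf_le (h : Par pβ pγ) : ‖betaOf h‖ ≤ ‖h‖ := by
  rw [EuclideanSpace.norm_eq, EuclideanSpace.norm_eq]
  refine Real.sqrt_le_sqrt ?_
  rw [Fintype.sum_sum_type]
  exact le_add_of_nonneg_right (Finset.sum_nonneg fun _ _ => sq_nonneg _)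

theorem norm_covOf_le (h : Par pβ pγ) : ‖covOf h‖ ≤ ‖h‖ := by
  rw [EuclideanSpace.norm_eq, EuclideanSpace.norm_eq h]
  refine Real.sqrt_le_sqrt ?_
  rw [Fintype.sum_sum_type (f := fun k : ParIdx pβ pγ => ‖h k‖ ^ 2)]
  exact le_add_of_nonneg_left (Finset.sum_nonneg fun _ _ => sq_nonneg _)

theorem sumElim_betaOf_covOf (h : Par pβ pγ) : Sum.elim ⇑(betaOf h) ⇑(covOf h) = ⇑h :=
  Sum.elim_comp_inl_inr _

/-- The contribution of the `i`th individual, with residual `e`, to the score at `θ`. -/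
def indScore (D : Design pβ pb) (G : EuclideanSpace ℝ (Fin pγ) → Matrix (Fin pb) (Fin pb) ℝ)
    (θ : Par pβ pγ) (i : ℕ) (e : D.Obs i) : Par pβ pγ :=
  gaussScore (XMat D i) (QMat D G i (covOf θ))⁻¹ (fun k => dQMat D G i k (covOf θ)) ⇑e

/-- The contribution of the `i`th individual, with residual `e`, to the second derivative of the
log-likelihood at `θ`; here `F i k l` stands for half the second derivatives of `Q_i`. -/
def indHess (D : Design pβ pb) (G : EuclideanSpace ℝ (Fin pγ) → Matrix (Fin pb) (Fin pb) ℝ)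
    (F : ∀ i, CovIdx pγ → CovIdx pγ → Matrix (Fin (D.n i)) (Fin (D.n i)) ℝ)
    (θ : Par pβ pγ) (i : ℕ) (e : D.Obs i) : Matrix (ParIdx pβ pγ) (ParIdx pβ pγ) ℝ :=
  gaussHess (XMat D i) (QMat D G i (covOf θ))⁻¹ (fun k => dQMat D G i k (covOf θ)) (F i) ⇑e

/-- The information of the `i`th individual. -/
def indInfo (D : Design pβ pb) (G : EuclideanSpace ℝ (Fin pγ) → Matrix (Fin pb) (Fin pb) ℝ)
    (θ : Par pβ pγ) (i : ℕ) : Matrix (ParIdx pβ pγ) (ParIdx pβ pγ) ℝ :=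
  gaussInfo (XMat D i) (QMat D G i (covOf θ))⁻¹ fun k => dQMat D G i k (covOf θ)

/-- The bounds under which the contribution of the `i`th individual to the log-likelihood has
an expansion with controlled remainder. -/
structure IndBounds (D : Design pβ pb) (G : EuclideanSpace ℝ (Fin pγ) → Matrix (Fin pb) (Fin pb) ℝ)
    (F : ∀ i, CovIdx pγ → CovIdx pγ → Matrix (Fin (D.n i)) (Fin (D.n i)) ℝ) (θ : Par pβ pγ)
    (K : ℝ) (i : ℕ) : Prop where
  n_le : (D.n i : ℝ) ≤ K
  X_le : absSum (XMat D i) ≤ K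
  inv_le : absSum (QMat D G i (covOf θ))⁻¹ ≤ K
  dQ_le : ∀ k, absSum (dQMat D G i k (covOf θ)) ≤ K
  F_le : ∀ k l, absSum (F i k l) ≤ K
  Q_le : ∀ a, QMat D G i (covOf θ) a a ≤ K

theorem exists_expansion_bounds (hΘβ : IsOpen Θβ) (hΘγ : IsOpen Θγ) (hΘs : IsOpen Θs)
    (hpos : ∀ s ∈ Θs, ∀ k, 0 < s k) (hG : ∀ γ ∈ Θγ, (G γ).PosSemidef)
    (hG3 : ∀ j k, ContDiffOn ℝ 3 (fun γ => G γ j k) Θγ)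
    (hQ : UniformlyNondegenerate D G (covSet Θγ Θs)) {θ : Par pβ pγ}
    (hθ : θ ∈ parSet Θβ Θγ Θs) :
    ∃ r > 0, ∃ K : ℝ, 1 ≤ K ∧ Metric.closedBall θ r ⊆ parSet Θβ Θγ Θs ∧
      ∃ F : ∀ i, CovIdx pγ → CovIdx pγ → Matrix (Fin (D.n i)) (Fin (D.n i)) ℝ, ∀ i,
        IndBounds D G F θ K i ∧ ∀ h : Par pβ pγ, ‖h‖ ≤ r →
          absSum (∑ k, covOf h k • dQMat D G i k (covOf θ)) ≤ K * ‖h‖ ∧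
          absSum (∑ k, ∑ l, (covOf h k * covOf h l) • F i k l) ≤ K * ‖h‖ ^ 2 ∧
          absSum (QMat D G i (covOf (θ + h)) - QMat D G i (covOf θ)
            - ∑ k, covOf h k • dQMat D G i k (covOf θ)
            - ∑ k, ∑ l, (covOf h k * covOf h l) • F i k l) ≤ K * ‖h‖ ^ 3 ∧
          ‖WithLp.toLp 2 (XMat D i *ᵥ ⇑(betaOf h))‖ ≤ K * ‖h‖ := by
  obtain ⟨r, hr, C, hC0, -, F, hF⟩ := exists_QMat_expansion D hΘγ hΘs hpos hG3 hθ.2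
  obtain ⟨c, hc, hcQ⟩ := hQ _ hθ.2
  obtain ⟨m, hm⟩ := D.n_bdd
  obtain ⟨Cx, hCx⟩ := D.covariates_bdd
  obtain ⟨r', hr', hball⟩ := Metric.nhds_basis_closedBall.mem_iff.1
    ((isOpen_parSet hΘβ hΘγ hΘs).mem_nhds hθ)
  set q : ℝ := ((Fintype.card (CovIdx pγ) : ℕ) : ℝ) with hq
  have hq0 : 0 ≤ q := Nat.cast_nonneg _
  have hmr : ∀ i, (D.n i : ℝ) ≤ m := fun i => Nat.cast_le.2 (hm i)
  have hmat : ∀ {i : ℕ} {A : Matrix (Fin (D.n i)) (Fin (D.n i)) ℝ} {B : ℝ}, 0 ≤ B →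
      (∀ a b, |A a b| ≤ B) → absSum A ≤ m ^ 2 * B := fun {i A B} hB h => by
    refine (absSum_le_of_le h).trans ?_
    rw [Fintype.card_fin, sq, mul_assoc]
    have := hmr i
    gcongr
  have hsum1 : ∀ (s : CovIdx pγ → ℝ) (i : ℕ)
      (A : CovIdx pγ → Matrix (Fin (D.n i)) (Fin (D.n i)) ℝ) {B t : ℝ}, (∀ k, |s k| ≤ t) → 0 ≤ t →
      (∀ k, absSum (A k) ≤ B) → absSum (∑ k, s k • A k) ≤ q * (t * B) := by
    intro s i A B t hs ht hA
    have h1 : ∀ S : Finset (CovIdx pγ), absSum (∑ k ∈ S, s k • A k) ≤ ∑ k ∈ S, t * B := fun S => by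
      induction S using Finset.induction_on with
      | empty => simp [absSum]
      | insert k S hk ih =>
        rw [Finset.sum_insert hk, Finset.sum_insert hk]
        refine (absSum_add_le _ _).trans (add_le_add ?_ ih)
        have : absSum (s k • A k) = |s k| * absSum (A k) := by
          simp [absSum, abs_mul, Finset.mul_sum]
        rw [this]
        exact mul_le_mul (hs k) (hA k) (absSum_nonneg _) ht
    refine (h1 _).trans_eq ?_
    simp [hq]
  have hX : ∀ i, absSum (XMat D i) ≤ m * (pβ * |Cx|) := fun i => by
    refine (absSum_le_of_le (C := |Cx|) fun a b => ?_).trans ?_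
    · have := (hCx i _ ⟨(D.t_pos i a).le, D.t_le i a⟩).1
      exact (PiLp.norm_apply_le (D.X i (D.t i a)) b).trans (this.trans (le_abs_self _))
    · rw [Fintype.card_fin, Fintype.card_fin]
      have := hmr i
      gcongr
  have hm2 : (0 : ℝ) ≤ m ^ 2 := by positivity
  have hm2C : 0 ≤ m ^ 2 * C := by positivity
  have hmc : 0 ≤ m ^ 2 * c⁻¹ := by positivity
  have hmX : 0 ≤ m * (pβ * |Cx|) := by positivity
  have hqm : 0 ≤ q * (m ^ 2 * C) := by positivity
  have hqqm : 0 ≤ q * (q * (m ^ 2 * C)) := by positivity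
  have hm0 : (0 : ℝ) ≤ m := by positivity
  -- The sum of all constants that occur below. Each is nonnegative, so every bound follows by
  -- dropping the other summands.
  obtain ⟨K, hK⟩ : ∃ K, K = 1 + m + m ^ 2 * c⁻¹ + m * (pβ * |Cx|) + C + m ^ 2 * C +
    q * (m ^ 2 * C) + q * (q * (m ^ 2 * C)) := ⟨_, rfl⟩
  refine ⟨min r r', lt_min hr hr', K, by linarith,
    (Metric.closedBall_subset_closedBall (min_le_right _ _)).trans hball, F, fun i =>
    ⟨⟨(hmr i).trans (by linarith), (hX i).trans (by linarith), ?_, fun k => ?_, fun k l => ?_,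
      fun a => ?_⟩, fun h hh => ?_⟩⟩
  · exact (hmat (inv_nonneg.2 hc.le) (abs_inv_apply_le (QMat_posDef hG hQ hθ.2 i) hc
      (hcQ i))).trans (by linarith)
  · exact (hmat hC0 fun a b => (hF i a b).2.1 k).trans (by linarith)
  · exact (hmat hC0 fun a b => (hF i a b).2.2.1 k l).trans (by linarith)
  · exact ((le_abs_self _).trans (hF i a a).1).trans (by linarith)
  · have hcov : ∀ k, |covOf h k| ≤ ‖h‖ := fun k => by
      have := PiLp.norm_apply_le (covOf h) k
      exact this.trans (norm_covOf_le h)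
    have hn := norm_nonneg h
    refine ⟨?_, ?_, ?_, ?_⟩
    · refine (hsum1 _ i _ hcov hn fun k => hmat hC0 fun a b => (hF i a b).2.1 k).trans ?_
      calc _ = q * (m ^ 2 * C) * ‖h‖ := by ring
        _ ≤ _ := by gcongr; linarith
    · have h1 : ∀ k, absSum (∑ l, covOf h l • F i k l) ≤ q * (‖h‖ * (m ^ 2 * C)) := fun k =>
        hsum1 _ i _ hcov hn fun l => hmat hC0 fun a b => (hF i a b).2.2.1 k l
      have h2 := hsum1 _ i _ hcov hn h1
      simp only [Finset.smul_sum, smul_smul] at h2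
      refine h2.trans ?_
      calc _ = q * (q * (m ^ 2 * C)) * ‖h‖ ^ 2 := by ring
        _ ≤ _ := by gcongr; linarith
    · refine (hmat (B := C * ‖h‖ ^ 3) (by positivity) fun a b => ?_).trans ?_
      · have h1 := (hF i a b).2.2.2 (covOf h) ((norm_covOf_le h).trans (hh.trans (min_le_left _ _)))
        refine h1.trans ?_
        have := norm_covOf_le h
        gcongr
      · rw [← mul_assoc]
        gcongr
        linarith
    · refine (norm_mulVec_le _ _).trans ?_
      have h1 := norm_betaOf_le h
      have h2 := hX i
      have h3 : absSum (XMat D i) ≤ K := h2.trans (by rw [hK]; linarith)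
      exact mul_le_mul h3 h1 (norm_nonneg _) (by linarith [absSum_nonneg (XMat D i)])

/-- The contribution of the `i`th individual, with residual `e` at `θ`, to the log-likelihood has a
second order expansion, uniformly in `i`. -/
theorem exists_gaussianLogDensity_expansion (hΘβ : IsOpen Θβ) (hΘγ : IsOpen Θγ) (hΘs : IsOpen Θs)
    (hpos : ∀ s ∈ Θs, ∀ k, 0 < s k) (hG : ∀ γ ∈ Θγ, (G γ).PosSemidef)
    (hG3 : ∀ j k, ContDiffOn ℝ 3 (fun γ => G γ j k) Θγ)
    (hQ : UniformlyNondegenerate D G (covSet Θγ Θs)) {θ : Par pβ pγ}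
    (hθ : θ ∈ parSet Θβ Θγ Θs) :
    ∃ r > 0, ∃ K : ℝ, 1 ≤ K ∧ Metric.closedBall θ r ⊆ parSet Θβ Θγ Θs ∧
      ∃ F : ∀ i, CovIdx pγ → CovIdx pγ → Matrix (Fin (D.n i)) (Fin (D.n i)) ℝ, ∀ i,
        IndBounds D G F θ K i ∧ ∀ (e : D.Obs i) (h : Par pβ pγ), ‖h‖ ≤ r →
          |(gaussianLogDensity (XMat D i *ᵥ ⇑(betaOf (θ + h))) (QMat D G i (covOf (θ + h)))
              (XMat D i *ᵥ ⇑(betaOf θ) + ⇑e) -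
            gaussianLogDensity (XMat D i *ᵥ ⇑(betaOf θ)) (QMat D G i (covOf θ))
              (XMat D i *ᵥ ⇑(betaOf θ) + ⇑e)) -
            (⇑(indScore D G θ i e) ⬝ᵥ ⇑h + 1 / 2 * (⇑h ⬝ᵥ (indHess D G F θ i e *ᵥ ⇑h)))| ≤
          200 * K ^ 8 * (1 + ‖e‖ ^ 2) * ‖h‖ ^ 3 := by
  obtain ⟨r, hr, K, hK, hball, F, hF⟩ :=
    exists_expansion_bounds hΘβ hΘγ hΘs hpos hG hG3 hQ hθ
  have hK0 : 0 < K := by linarith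
  -- The radius is reduced to guarantee `6 K² ‖h‖ ≤ 1`, the smallness condition of
  -- `abs_gaussian_expansion_le` with `t = ‖h‖`.
  refine ⟨min r (1 / (6 * K ^ 2)), lt_min hr (by positivity), K, hK,
    (Metric.closedBall_subset_closedBall (min_le_left _ _)).trans hball, F, fun i =>
    ⟨(hF i).1, fun e h hh => ?_⟩⟩
  obtain ⟨hD, hF2, hR, hw⟩ := (hF i).2 h (hh.trans (min_le_left _ _))
  have hmem : θ + h ∈ parSet Θβ Θγ Θs := hball (by
    simpa using hh.trans (min_le_left _ _))
  have htK : 6 * K ^ 2 * ‖h‖ ≤ 1 := by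
    have := hh.trans (min_le_right _ _)
    rw [le_div_iff₀ (by positivity)] at this
    linarith
  have key := abs_gaussian_expansion_le (QMat_posDef hG hQ hθ.2 i) (QMat_posDef hG hQ hmem.2 i)
    hK (norm_nonneg h) htK (hF i).1.inv_le hD hF2 hR e _ hw
  convert key using 2
  rw [← sumElim_betaOf_covOf h, indScore, indHess, gaussScore_dotProduct,
    gaussHess_quadraticForm _ _ _ _ _ _ _ rfl rfl rfl]
  congr 1
  have hb : betaOf (θ + h) = betaOf θ + betaOf h := rfl
  have h1 : XMat D i *ᵥ ⇑(betaOf θ) + ⇑e - XMat D i *ᵥ ⇑(betaOf (θ + h)) =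
      ⇑e - XMat D i *ᵥ ⇑(betaOf h) := by
    rw [hb, WithLp.ofLp_add, Matrix.mulVec_add]
    abel
  simp only [gaussianLogDensity, h1, add_sub_cancel_left]
  ring

end Individual

end IOU

end

/-! ### Riemann sums and the covariance of the integrated process. -/

noncomputable section

namespace IOU

section RiemannSums

/-- The Riemann sum of `f` over `[0, t]` with `n` equal steps and left end points. -/
def riemannSum (f : ℝ → ℝ) (t : ℝ) (n : ℕ) : ℝ := ∑ k ∈ Finset.range n, t / n * f (t * k / n)

theorem abs_riemannSum_sub_integral_le {f : ℝ → ℝ} (hf : Continuous f) {t : ℝ} (ht : 0 ≤ t) {n : ℕ}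
    (hn : 0 < n) {ε : ℝ} (hε : ∀ x ∈ Set.Icc 0 t, ∀ y ∈ Set.Icc 0 t, |x - y| ≤ t / n →
      |f x - f y| ≤ ε) :
    |riemannSum f t n - ∫ s in (0 : ℝ)..t, f s| ≤ t * ε := by
  have hn' : (0 : ℝ) < n := Nat.cast_pos.2 hn
  have hsum : ∫ s in (0 : ℝ)..t, f s =
      ∑ k ∈ Finset.range n, ∫ s in (t * k / n)..(t * (k + 1 : ℕ) / n), f s := by
    rw [intervalIntegral.sum_integral_adjacent_intervals (a := fun k : ℕ => t * k / n)
      fun k _ => hf.intervalIntegrable _ _]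
    simp [hn'.ne']
  have hlen : ∀ k : ℕ, t * (k + 1 : ℕ) / n - t * k / n = t / n := fun k => by
    push_cast
    field_simp
    ring
  have htn : 0 ≤ t / n := by positivity
  rw [hsum, riemannSum, ← Finset.sum_sub_distrib]
  refine (Finset.abs_sum_le_sum_abs _ _).trans ?_
  have hterm : ∀ k ∈ Finset.range n, |t / n * f (t * k / n) -
      ∫ s in (t * k / n)..(t * (k + 1 : ℕ) / n), f s| ≤ t / n * ε := fun k hk => by
    have hk' : (k : ℝ) + 1 ≤ n := by exact_mod_cast Finset.mem_range.1 hk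
    have hle : t * k / n ≤ t * (k + 1 : ℕ) / n := by linarith [hlen k]
    have h0 : 0 ≤ t * k / n := by positivity
    have h1 : t * (k + 1 : ℕ) / n ≤ t := by
      rw [div_le_iff₀ hn']
      push_cast
      gcongr
    have h2 : t / n * f (t * k / n) = ∫ s in (t * k / n)..(t * (k + 1 : ℕ) / n), f (t * k / n) := by
      rw [intervalIntegral.integral_const, hlen, smul_eq_mul]
    rw [h2, ← intervalIntegral.integral_sub intervalIntegrable_const (hf.intervalIntegrable _ _)]
    have h3 := intervalIntegral.norm_integral_le_of_norm_le_const
      (f := fun s => f (t * k / n) - f s) (a := t * k / n) (b := t * (k + 1 : ℕ) / n) (C := ε)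
      fun s hs => by
        rw [Set.uIoc_of_le hle] at hs
        refine hε _ ⟨h0, by linarith⟩ _ ⟨by linarith [hs.1], by linarith [hs.2]⟩ ?_
        rw [abs_sub_comm, abs_of_nonneg (by linarith [hs.1])]
        linarith [hs.2, hlen k]
    rw [hlen, abs_of_nonneg htn] at h3
    exact h3.trans_eq (mul_comm _ _)
  refine (Finset.sum_le_sum hterm).trans_eq ?_
  rw [Finset.sum_const, Finset.card_range, nsmul_eq_mul]
  field_simp

theorem tendsto_riemannSum {f : ℝ → ℝ} (hf : Continuous f) {t : ℝ} (ht : 0 ≤ t) :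
    Tendsto (riemannSum f t) atTop (𝓝 (∫ s in (0 : ℝ)..t, f s)) := by
  rw [Metric.tendsto_atTop]
  intro ε hε
  have hu := isCompact_Icc.uniformContinuousOn_of_continuous (hf.continuousOn (s := Set.Icc 0 t))
  rw [Metric.uniformContinuousOn_iff] at hu
  obtain ⟨δ, hδ, h⟩ := hu (ε / (2 * (t + 1))) (by positivity)
  obtain ⟨N, hN⟩ := exists_nat_gt (t / δ)
  have hN0 : (0 : ℝ) < N := lt_of_le_of_lt (by positivity) hN
  refine ⟨N, fun n hn => ?_⟩
  have hn0 : (0 : ℝ) < n := hN0.trans_le (Nat.cast_le.2 hn)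
  rw [Real.dist_eq]
  refine (abs_riemannSum_sub_integral_le hf ht (Nat.cast_pos.1 hn0)
    (ε := ε / (2 * (t + 1))) fun x hx y hy hxy => ?_).trans_lt ?_
  · refine (h x hx y hy (lt_of_le_of_lt hxy ?_)).le
    rw [div_lt_iff₀ hδ] at hN
    rw [div_lt_iff₀ hn0]
    have : (N : ℝ) ≤ n := Nat.cast_le.2 hn
    nlinarith
  · have h1 : 0 < ε / (2 * (t + 1)) := by positivity
    calc t * (ε / (2 * (t + 1))) ≤ (t + 1) * (ε / (2 * (t + 1))) := by gcongr; linarith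
      _ = ε / 2 := by field_simp
      _ < ε := half_lt_self hε

/-- Double Riemann sums of a continuous function that is Lipschitz in the second variable. -/
theorem tendsto_riemannSum_riemannSum {c : ℝ → ℝ → ℝ} (hc : Continuous fun p : ℝ × ℝ => c p.1 p.2)
    {L : ℝ} (hL : ∀ x y z, |c x y - c x z| ≤ L * |y - z|) {s t : ℝ} (hs : 0 ≤ s) (ht : 0 ≤ t) :
    Tendsto (fun n => riemannSum (fun x => riemannSum (c x) t n) s n) atTop
      (𝓝 (∫ x in (0 : ℝ)..s, ∫ y in (0 : ℝ)..t, c x y)) := by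
  have hL0 : 0 ≤ L := by
    have := (abs_nonneg _).trans (hL 0 1 0)
    simpa using this
  have hg : Continuous fun x => ∫ y in (0 : ℝ)..t, c x y :=
    intervalIntegral.continuous_parametric_intervalIntegral_of_continuous' hc 0 t
  have h1 := tendsto_riemannSum hg hs
  have h2 : Tendsto (fun n : ℕ => s * (t * (L * (t / n)))) atTop (𝓝 0) := by
    have h3 := tendsto_const_div_atTop_nhds_zero_nat t
    simpa using ((h3.const_mul L).const_mul t).const_mul s
  -- The Lipschitz bound makes the error of the inner sum at most `t L t / n`, uniformly in the
  -- outer variable.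
  have h4 : Tendsto (fun n => riemannSum (fun x => riemannSum (c x) t n) s n -
      riemannSum (fun x => ∫ y in (0 : ℝ)..t, c x y) s n) atTop (𝓝 0) := by
    refine squeeze_zero_norm' ?_ h2
    filter_upwards [eventually_gt_atTop 0] with n hn
    have hn' : (0 : ℝ) < n := Nat.cast_pos.2 hn
    rw [riemannSum, riemannSum, ← Finset.sum_sub_distrib]
    refine (Finset.abs_sum_le_sum_abs _ _).trans ?_
    have hterm : ∀ k ∈ Finset.range n, |s / n * riemannSum (c (s * k / n)) t n -
        s / n * ∫ y in (0 : ℝ)..t, c (s * k / n) y| ≤ s / n * (t * (L * (t / n))) := fun k _ => by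
      rw [← mul_sub, abs_mul, abs_of_nonneg (by positivity)]
      gcongr
      refine abs_riemannSum_sub_integral_le (by fun_prop) ht hn fun x _ y _ hxy => ?_
      exact (hL _ _ _).trans (by gcongr)
    refine (Finset.sum_le_sum hterm).trans_eq ?_
    rw [Finset.sum_const, Finset.card_range, nsmul_eq_mul]
    field_simp
  simpa using h4.add h1

theorem riemannSum_riemannSum_comm {c : ℝ → ℝ → ℝ} (hc : ∀ x y, c x y = c y x) (s t : ℝ) (n : ℕ) :
    riemannSum (fun x => riemannSum (c x) t n) s n =
      riemannSum (fun x => riemannSum (c x) s n) t n := by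
  simp only [riemannSum, Finset.mul_sum]
  rw [Finset.sum_comm]
  refine Finset.sum_congr rfl fun k _ => Finset.sum_congr rfl fun l _ => ?_
  rw [hc]
  ring

end RiemannSums

section OUCovariance

/-- The covariance function of the stationary Ornstein-Uhlenbeck process. -/
def ouCov (α τ s t : ℝ) : ℝ := τ ^ 2 / (2 * α) * Real.exp (-α * |s - t|)

theorem ouCov_comm (α τ s t : ℝ) : ouCov α τ s t = ouCov α τ t s := by
  rw [ouCov, ouCov, abs_sub_comm]

theorem abs_exp_neg_sub_le {a b : ℝ} (ha : 0 ≤ a) (hb : 0 ≤ b) :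
    |Real.exp (-a) - Real.exp (-b)| ≤ |a - b| := by
  wlog h : a ≤ b generalizing a b
  · rw [abs_sub_comm, abs_sub_comm a]
    exact this hb ha (le_of_not_ge h)
  have h1 : Real.exp (-b) ≤ Real.exp (-a) := Real.exp_le_exp.2 (by linarith)
  have h2 : Real.exp (-a) ≤ 1 := Real.exp_le_one_iff.2 (by linarith)
  have h3 : 1 - (b - a) ≤ Real.exp (-(b - a)) := by
    have := Real.add_one_le_exp (-(b - a))
    linarith
  have h4 : Real.exp (-b) = Real.exp (-a) * Real.exp (-(b - a)) := by
    rw [← Real.exp_add]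
    congr 1
    ring
  rw [abs_of_nonneg (by linarith), abs_sub_comm, abs_of_nonneg (by linarith), h4]
  nlinarith [Real.exp_pos (-a)]

theorem abs_ouCov_sub_le {α : ℝ} (hα : 0 < α) (τ x y z : ℝ) :
    |ouCov α τ x y - ouCov α τ x z| ≤ τ ^ 2 / (2 * α) * α * |y - z| := by
  have h1 := abs_exp_neg_sub_le (mul_nonneg hα.le (abs_nonneg (x - y)))
    (mul_nonneg hα.le (abs_nonneg (x - z)))
  have h2 : |α * |x - y| - α * (|x - z|)| ≤ α * |y - z| := by
    rw [← mul_sub, abs_mul, abs_of_pos hα]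
    refine mul_le_mul_of_nonneg_left ?_ hα.le
    refine (abs_abs_sub_abs_le (x - y) (x - z)).trans_eq ?_
    rw [abs_sub_comm y z]
    congr 1
    ring
  rw [ouCov, ouCov, ← mul_sub, abs_mul, abs_of_nonneg (by positivity), mul_assoc]
  gcongr
  simpa only [neg_mul] using h1.trans h2

theorem continuous_ouCov (α τ : ℝ) : Continuous fun p : ℝ × ℝ => ouCov α τ p.1 p.2 := by
  unfold ouCov
  fun_prop

theorem integral_exp_mul_add {a : ℝ} (ha : a ≠ 0) (c x y : ℝ) :
    ∫ v in x..y, Real.exp (a * v + c) = (Real.exp (a * y + c) - Real.exp (a * x + c)) / a := by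
  have h : ∀ v, HasDerivAt (fun v => Real.exp (a * v + c) / a) (Real.exp (a * v + c)) v := fun v => by
    have := ((((hasDerivAt_id v).const_mul a).add_const c).exp).div_const a
    simpa [ha] using this
  rw [intervalIntegral.integral_eq_sub_of_hasDerivAt (fun v _ => h v)
    (Continuous.intervalIntegrable (by fun_prop) _ _)]
  ring

theorem integral_integral_ouCov {α : ℝ} (hα : 0 < α) (τ : ℝ) {s t : ℝ} (hs : 0 ≤ s) (hst : s ≤ t) :
    ∫ x in (0 : ℝ)..s, ∫ y in (0 : ℝ)..t, ouCov α τ x y = iouCov α τ s t := by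
  have hinner : ∀ x ∈ Set.uIcc 0 s, ∫ y in (0 : ℝ)..t, ouCov α τ x y =
      τ ^ 2 / (2 * α ^ 2) * (2 - Real.exp (-α * x + 0) - Real.exp (α * x + -α * t)) := fun x hx => by
    rw [Set.uIcc_of_le hs] at hx
    have hint : ∀ a b, IntervalIntegrable (fun y => ouCov α τ x y) volume a b := fun a b =>
      Continuous.intervalIntegrable (by unfold ouCov; fun_prop) _ _
    -- Since `x ≤ s ≤ t`, the inner interval splits at `y = x`, and `|x - y|` has a constant sign on
    -- each piece.
    rw [← intervalIntegral.integral_add_adjacent_intervals (hint 0 x) (hint x t)]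
    have h1 : ∫ y in (0 : ℝ)..x, ouCov α τ x y =
        τ ^ 2 / (2 * α) * ∫ y in (0 : ℝ)..x, Real.exp (α * y + -α * x) := by
      rw [← intervalIntegral.integral_const_mul]
      refine intervalIntegral.integral_congr fun y hy => ?_
      rw [Set.uIcc_of_le hx.1] at hy
      simp only [ouCov]
      rw [abs_of_nonneg (by linarith [hy.2])]
      ring_nf
    have h2 : ∫ y in x..t, ouCov α τ x y =
        τ ^ 2 / (2 * α) * ∫ y in x..t, Real.exp (-α * y + α * x) := by
      rw [← intervalIntegral.integral_const_mul]
      refine intervalIntegral.integral_congr fun y hy => ?_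
      rw [Set.uIcc_of_le (hx.2.trans hst)] at hy
      simp only [ouCov]
      rw [abs_of_nonpos (by linarith [hy.1])]
      ring_nf
    rw [h1, h2, integral_exp_mul_add hα.ne', integral_exp_mul_add (neg_ne_zero.2 hα.ne')]
    have e1 : α * x + -α * x = 0 := by ring
    have e2 : α * 0 + -α * x = -α * x + 0 := by ring
    have e3 : -α * t + α * x = α * x + -α * t := by ring
    have e4 : -α * x + α * x = 0 := by ring
    rw [e1, e2, e3, e4, Real.exp_zero]
    field_simp
    ring
  rw [intervalIntegral.integral_congr hinner, intervalIntegral.integral_const_mul,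
    intervalIntegral.integral_sub, intervalIntegral.integral_sub, intervalIntegral.integral_const,
    integral_exp_mul_add (neg_ne_zero.2 hα.ne'), integral_exp_mul_add hα.ne', iouCov,
    min_eq_left hst, abs_of_nonpos (by linarith)]
  · have e1 : -α * 0 + 0 = 0 := by ring
    have e2 : α * 0 + -α * t = -α * t := by ring
    have e3 : α * s + -α * t = -α * -(s - t) := by ring
    rw [e1, e2, e3, Real.exp_zero, add_zero, smul_eq_mul]
    field_simp
    ring
  all_goals exact Continuous.intervalIntegrable (by fun_prop) _ _

theorem tendsto_riemannSum_ouCov {α : ℝ} (hα : 0 < α) (τ : ℝ) {s t : ℝ} (hs : 0 ≤ s)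
    (ht : 0 ≤ t) :
    Tendsto (fun n => riemannSum (fun x => riemannSum (ouCov α τ x) t n) s n) atTop
      (𝓝 (iouCov α τ s t)) := by
  wlog h : s ≤ t generalizing s t
  · simp_rw [riemannSum_riemannSum_comm (ouCov_comm α τ) s t]
    rw [iouCov_comm]
    exact this ht hs (le_of_not_ge h)
  rw [← integral_integral_ouCov hα τ hs h]
  exact tendsto_riemannSum_riemannSum (continuous_ouCov α τ) (abs_ouCov_sub_le hα τ) hs ht

end OUCovariance

end IOU

end

/-! ### The law of the integrated Ornstein-Uhlenbeck process. -/

noncomputable section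

namespace IOU

section IntegratedOU

/-- The integral of a path over `[0, t]`, as a measurable function of the path. -/
def pathIntegral (t : ℝ) (x : ℝ≥0 → ℝ) : ℝ :=
  limsup (fun n => riemannSum (fun s => x s.toNNReal) t n) atTop

/-- The upper limit of Riemann sums is measurable for the product σ-algebra on all paths, because
each sum involves finitely many evaluations; for continuous paths it is the integral. -/
theorem measurable_pathIntegral (t : ℝ) : Measurable (pathIntegral t) := by
  refine Measurable.limsup fun n => ?_
  unfold riemannSum
  exact Finset.measurable_fun_sum _ fun k _ => (measurable_pi_apply _).const_mul _

theorem tendsto_riemannSum_path {x : ℝ≥0 → ℝ} (hx : Continuous x) {t : ℝ} (ht : 0 ≤ t) :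
    Tendsto (riemannSum (fun s => x s.toNNReal) t) atTop (𝓝 (pathIntegral t x)) := by
  have h := tendsto_riemannSum (f := fun s => x s.toNNReal) (by fun_prop) ht
  rwa [pathIntegral, h.limsup_eq]

theorem pathIntegral_eq {x : ℝ≥0 → ℝ} (hx : Continuous x) {t : ℝ} (ht : 0 ≤ t) :
    pathIntegral t x = ∫ s in (0 : ℝ)..t, x s.toNNReal :=
  (tendsto_riemannSum (f := fun s => x s.toNNReal) (by fun_prop) ht).limsup_eq

variable {Ω : Type*} [MeasurableSpace Ω] {P : Measure Ω} [IsProbabilityMeasure P] {α τ : ℝ}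
  {ζ : ℝ≥0 → Ω → ℝ}

/-- A finite linear combination of values of a centered Gaussian process is Gaussian with the
displayed double sum as variance. The index type is arbitrary so that it may consist of pairs
(observation time, node of the Riemann sum). -/
theorem IsStationaryOU.integral_exp_sum (h : IsStationaryOU α τ ζ P) {S : Type*} (I : Finset S)
    (a : S → ℝ) (f : S → ℝ≥0) :
    0 ≤ ∑ p ∈ I, ∑ q ∈ I, a p * a q * ouCov α τ (f p) (f q) ∧
    ∫ ω, Complex.exp ((∑ p ∈ I, a p * ζ (f p) ω : ℝ) * Complex.I) ∂P =
      Complex.exp (-(∑ p ∈ I, ∑ q ∈ I, a p * a q * ouCov α τ (f p) (f q) : ℝ) / 2) := by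
  have hG : HasGaussianLaw (fun ω => ∑ p ∈ I, a p * ζ (f p) ω) P :=
    ((h.gaussian.comp_right f).smul a).hasGaussianLaw_fun_sum (I := I)
  have h2 : ∀ t, MemLp (ζ t) 2 P := fun t => (h.gaussian.hasGaussianLaw_eval t).memLp_two
  have hmean : ∫ ω, ∑ p ∈ I, a p * ζ (f p) ω ∂P = 0 := by
    rw [integral_finsetSum _ fun p _ => ((h2 _).integrable one_le_two).const_mul _]
    simp [integral_const_mul, h.mean]
  have hvar : Var[fun ω => ∑ p ∈ I, a p * ζ (f p) ω; P] =
      ∑ p ∈ I, ∑ q ∈ I, a p * a q * ouCov α τ (f p) (f q) := by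
    rw [← covariance_self hG.aemeasurable, covariance_fun_sum_fun_sum'
      (fun p _ => (h2 _).const_mul _) (fun p _ => (h2 _).const_mul _)]
    refine Finset.sum_congr rfl fun p _ => Finset.sum_congr rfl fun q _ => ?_
    rw [covariance_const_mul_left, covariance_const_mul_right, h.cov, ouCov]
    ring
  have hpos : 0 ≤ ∑ p ∈ I, ∑ q ∈ I, a p * a q * ouCov α τ (f p) (f q) :=
    hvar ▸ variance_nonneg _ _
  refine ⟨hpos, ?_⟩
  have hm := hG.map_eq_gaussianReal
  rw [hmean, hvar] at hm
  have hc := congrArg (fun μ => charFun μ 1) hm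
  simp only [charFun_gaussianReal] at hc
  rw [charFun_apply_real, integral_map hG.aemeasurable (by fun_prop)] at hc
  simp only [Complex.ofReal_one, one_mul, one_pow, mul_one, Complex.ofReal_zero, zero_mul, zero_sub,
    Real.coe_toNNReal _ hpos, mul_zero] at hc
  rw [hc]
  congr 1
  ring

/-- The integrated process at the times `t j`, as a function of the path. -/
def integratedVec {n : ℕ} (t : Fin n → ℝ) (x : ℝ≥0 → ℝ) : EuclideanSpace ℝ (Fin n) :=
  WithLp.toLp 2 fun j => pathIntegral (t j) x

theorem measurable_integratedVec {n : ℕ} (t : Fin n → ℝ) : Measurable (integratedVec t) :=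
  (PiLp.continuous_toLp 2 _).measurable.comp
    (measurable_pi_lambda _ fun j => measurable_pathIntegral (t j))

/-- The Riemann sums have explicit Gaussian characteristic functions. Dominated convergence gives
the limit on one side, convergence of the double Riemann sums of the covariance on the other. The
limit matrix is positive semidefinite as a limit of variances. -/
theorem IsStationaryOU.map_integratedVec (hα : 0 < α) (h : IsStationaryOU α τ ζ P) {n : ℕ}
    {t : Fin n → ℝ} (ht : ∀ j, 0 ≤ t j) :
    (Matrix.of fun j k => iouCov α τ (t j) (t k)).PosSemidef ∧
    P.map (fun ω => integratedVec t fun s => ζ s ω) =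
      multivariateGaussian 0 (Matrix.of fun j k => iouCov α τ (t j) (t k)) := by
  have hlaw : ∀ (x : Fin n → ℝ) (N : ℕ),
      0 ≤ ∑ j, ∑ k, x j * x k * riemannSum (fun u => riemannSum (ouCov α τ u) (t k) N) (t j) N ∧
      ∫ ω, Complex.exp ((∑ j, x j * riemannSum (fun s => ζ s.toNNReal ω) (t j) N : ℝ) * Complex.I)
        ∂P = Complex.exp (-(∑ j, ∑ k, x j * x k *
          riemannSum (fun u => riemannSum (ouCov α τ u) (t k) N) (t j) N : ℝ) / 2) := by
    intro x N
    have := h.integral_exp_sum (Finset.univ ×ˢ Finset.range N)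
      (fun p : Fin n × ℕ => x p.1 * (t p.1 / N)) (fun p => (t p.1 * p.2 / N).toNNReal)
    have hco : ∀ (j : Fin n) (k : ℕ), ((t j * k / N).toNNReal : ℝ) = t j * k / N := fun j k =>
      Real.coe_toNNReal _ (by have := ht j; positivity)
    simp only [hco, Finset.sum_product] at this
    have hA : ∑ j, ∑ a ∈ Finset.range N, ∑ k, ∑ b ∈ Finset.range N,
        x j * (t j / N) * (x k * (t k / N)) * ouCov α τ (t j * a / N) (t k * b / N) =
        ∑ j, ∑ k, x j * x k * riemannSum (fun u => riemannSum (ouCov α τ u) (t k) N) (t j) N := by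
      refine Finset.sum_congr rfl fun j _ => ?_
      rw [Finset.sum_comm]
      refine Finset.sum_congr rfl fun k _ => ?_
      simp only [riemannSum, Finset.mul_sum]
      exact Finset.sum_congr rfl fun _ _ => Finset.sum_congr rfl fun _ _ => by ring
    have hB : ∀ ω, ∑ j, ∑ k ∈ Finset.range N, x j * (t j / N) * ζ (t j * k / N).toNNReal ω =
        ∑ j, x j * riemannSum (fun s => ζ s.toNNReal ω) (t j) N := fun ω => by
      refine Finset.sum_congr rfl fun j _ => ?_
      simp only [riemannSum, Finset.mul_sum]
      exact Finset.sum_congr rfl fun k _ => by ring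
    rw [hA] at this
    simpa only [hB] using this
  have hvar : ∀ x : Fin n → ℝ, Tendsto (fun N => ∑ j, ∑ k, x j * x k *
      riemannSum (fun u => riemannSum (ouCov α τ u) (t k) N) (t j) N) atTop
      (𝓝 (x ⬝ᵥ ((Matrix.of fun j k => iouCov α τ (t j) (t k)) *ᵥ x))) := fun x => by
    have : x ⬝ᵥ ((Matrix.of fun j k => iouCov α τ (t j) (t k)) *ᵥ x) =
        ∑ j, ∑ k, x j * x k * iouCov α τ (t j) (t k) := by
      simp only [dotProduct, Matrix.mulVec, Matrix.of_apply, Finset.mul_sum]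
      exact Finset.sum_congr rfl fun j _ => Finset.sum_congr rfl fun k _ => by ring
    rw [this]
    exact tendsto_finsetSum _ fun j _ => tendsto_finsetSum _ fun k _ =>
      (tendsto_riemannSum_ouCov hα τ (ht j) (ht k)).const_mul _
  have hpsd : (Matrix.of fun j k => iouCov α τ (t j) (t k)).PosSemidef := by
    rw [Matrix.posSemidef_iff_dotProduct_mulVec]
    refine ⟨?_, fun x => ge_of_tendsto' (hvar x) fun N => (hlaw x N).1⟩
    ext j k
    simpa using iouCov_comm α τ _ _
  refine ⟨hpsd, ?_⟩
  have hpath : Measurable fun ω s => ζ s ω := measurable_pi_lambda _ h.measurable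
  have hm : Measurable fun ω => integratedVec t fun s => ζ s ω :=
    (measurable_integratedVec t).comp hpath
  have : IsProbabilityMeasure (P.map fun ω => integratedVec t fun s => ζ s ω) :=
    Measure.isProbabilityMeasure_map hm.aemeasurable
  refine Measure.ext_of_charFun (funext fun x => ?_)
  rw [charFun_multivariateGaussian hpsd, charFun_apply, integral_map hm.aemeasurable (by fun_prop)]
  have hin : ∀ ω, inner ℝ (integratedVec t fun s => ζ s ω) x =
      ∑ j, x j * pathIntegral (t j) fun s => ζ s ω := fun ω => by
    simp [PiLp.inner_apply, integratedVec]
  simp only [hin]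
  have hl1 : Tendsto (fun N => ∫ ω, Complex.exp ((∑ j, x j *
      riemannSum (fun s => ζ s.toNNReal ω) (t j) N : ℝ) * Complex.I) ∂P) atTop
      (𝓝 (∫ ω, Complex.exp ((∑ j, x j * pathIntegral (t j) fun s => ζ s ω : ℝ) * Complex.I) ∂P)) := by
    refine tendsto_integral_of_dominated_convergence (fun _ => 1) (fun N => ?_)
      (integrable_const _) (fun N => Eventually.of_forall fun ω => ?_) ?_
    · have hr : ∀ j, Measurable fun ω => riemannSum (fun s => ζ s.toNNReal ω) (t j) N := fun j => by
        unfold riemannSum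
        exact Finset.measurable_fun_sum _ fun k _ => (h.measurable _).const_mul _
      have : Measurable fun ω => ∑ j, x j * riemannSum (fun s => ζ s.toNNReal ω) (t j) N :=
        Finset.measurable_fun_sum _ fun j _ => (hr j).const_mul _
      exact (by fun_prop : Measurable _).aestronglyMeasurable
    · rw [Complex.norm_exp_ofReal_mul_I]
    · filter_upwards [h.continuous_paths] with ω hω
      refine (Complex.continuous_exp.tendsto _).comp (((Complex.continuous_ofReal.tendsto _).comp
        ?_).mul_const _)
      exact tendsto_finsetSum _ fun j _ => (tendsto_riemannSum_path hω (ht j)).const_mul _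
  have hl2 := ((Complex.continuous_ofReal.tendsto _).comp (hvar ⇑x)).neg.div_const 2
  have hl3 := (Complex.continuous_exp.tendsto _).comp hl2
  refine tendsto_nhds_unique hl1 ?_
  simp only [(hlaw ⇑x _).2]
  rw [inner_zero_right, Complex.ofReal_zero, zero_mul, zero_sub, ← neg_div]
  exact hl3

end IntegratedOU

end IOU

end

/-! ### Independent Gaussian residuals from the model. -/

noncomputable section

namespace IOU

section Regrouping

variable {Ω : Type*} [MeasurableSpace Ω] {P : Measure Ω}

/-- Independence of the whole array means that its law is an infinite product, and currying carries
an infinite product to a product of products. -/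
theorem iIndepFun_curry {ι : Type*} {κ : ι → Type*} {𝓧 : (i : ι) → κ i → Type*}
    {m𝓧 : ∀ i j, MeasurableSpace (𝓧 i j)} {X : (i : ι) → (j : κ i) → Ω → 𝓧 i j}
    (mX : ∀ i j, Measurable (X i j))
    (h : iIndepFun (fun (p : (i : ι) × (κ i)) ω => X p.1 p.2 ω) P) :
    iIndepFun (fun i ω => (X i · ω)) P := by
  have := h.isProbabilityMeasure
  have : ∀ i j, IsProbabilityMeasure (P.map (X i j)) :=
    fun i j => Measure.isProbabilityMeasure_map (mX i j).aemeasurable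
  have h2 : ∀ i, iIndepFun (X i) P := fun i =>
    h.precomp (g := fun j => (⟨i, j⟩ : (i : ι) × κ i)) fun a b hab => by simpa using hab
  have he : (MeasurableEquiv.piCurry 𝓧) ∘ (fun ω p => X p.1 p.2 ω) = fun ω i j => X i j ω := by
    ext
    simp [Sigma.curry]
  rw [iIndepFun_iff_map_fun_eq_infinitePi_map (by fun_prop), ← he,
    ← Measure.map_map (by fun_prop) (by fun_prop),
    (iIndepFun_iff_map_fun_eq_infinitePi_map (by fun_prop)).1 h,
    Measure.infinitePi_map_piCurry (fun i j => P.map (X i j))]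
  congr 1
  ext1 i
  rw [← (iIndepFun_iff_map_fun_eq_infinitePi_map (by fun_prop)).1 (h2 i)]

/-- Independence between and within rows makes the whole array independent, so it can be regrouped
by columns. Here the rows are the three random sources and the columns are the individuals. -/
theorem iIndepFun_transpose {ι κ : Type*} {𝓧 : κ → Type*}
    {m𝓧 : ∀ j, MeasurableSpace (𝓧 j)} {X : ι → (j : κ) → Ω → 𝓧 j}
    (mX : ∀ i j, Measurable (X i j)) (h1 : iIndepFun (fun i ω => (X i · ω)) P)
    (h2 : ∀ i, iIndepFun (X i) P) :
    iIndepFun (fun j ω i => X i j ω) P ∧ ∀ j, iIndepFun (fun i => X i j) P := by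
  have h := iIndepFun_uncurry' mX h1 h2
  refine ⟨iIndepFun_curry (X := fun j i => X i j) (fun j i => mX i j) ?_, fun j => ?_⟩
  · exact h.precomp (g := fun p : (_ : κ) × ι => (p.2, p.1)) fun a b hab => by
      obtain ⟨a1, a2⟩ := a
      obtain ⟨b1, b2⟩ := b
      simp only [Prod.mk.injEq] at hab
      obtain ⟨rfl, rfl⟩ := hab
      rfl
  · exact h.precomp (g := fun i => (i, j)) fun a b hab => by simpa using hab

end Regrouping

section Residuals

variable {Ω : Type*} [MeasurableSpace Ω] {P : Measure Ω}

theorem charFun_map_mulVec {m n : Type*} [Fintype m] [Fintype n]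
    {b : Ω → EuclideanSpace ℝ m} (hb : Measurable b)
    (Z : Matrix n m ℝ) (x : EuclideanSpace ℝ n) :
    charFun (P.map fun ω => (WithLp.toLp 2 (Z *ᵥ ⇑(b ω)) : EuclideanSpace ℝ n)) x =
      charFun (P.map b) (WithLp.toLp 2 (Zᵀ *ᵥ ⇑x)) := by
  have hm : Measurable fun ω => (WithLp.toLp 2 (Z *ᵥ ⇑(b ω)) : EuclideanSpace ℝ n) := by
    have : Continuous fun y : EuclideanSpace ℝ m =>
        (WithLp.toLp 2 (Z *ᵥ ⇑y) : EuclideanSpace ℝ n) := by fun_prop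
    exact this.measurable.comp hb
  rw [charFun_apply, charFun_apply, integral_map hm.aemeasurable (by fun_prop),
    integral_map hb.aemeasurable (by fun_prop)]
  congr 1
  ext ω
  congr 3
  simp only [EuclideanSpace.inner_eq_star_dotProduct, star_trivial]
  rw [Matrix.mulVec_transpose, ← Matrix.dotProduct_mulVec]

variable {pβ pb pγ : ℕ} {D : Design pβ pb}
  {G : EuclideanSpace ℝ (Fin pγ) → Matrix (Fin pb) (Fin pb) ℝ} {θ : Par pβ pγ}
  {b : ℕ → Ω → EuclideanSpace ℝ (Fin pb)} {ζ : ℕ → ℝ≥0 → Ω → ℝ} {ε : ∀ i, Ω → D.Obs i}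

/-- The three components of the residual `Z_i b_i + W_i + ε_i`. -/
def residualPart (D : Design pβ pb) (b : ℕ → Ω → EuclideanSpace ℝ (Fin pb))
    (ζ : ℕ → ℝ≥0 → Ω → ℝ) (ε : ∀ i, Ω → D.Obs i) (r : Fin 3) (i : ℕ) (ω : Ω) : D.Obs i :=
  ![WithLp.toLp 2 (ZMat D i *ᵥ ⇑(b i ω)), integratedVec (D.t i) fun s => ζ i s ω, ε i ω] r

theorem measurable_residualPart (h : IsModel D G θ P b ζ ε) (r : Fin 3) (i : ℕ) :
    Measurable (residualPart D b ζ ε r i) := by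
  fin_cases r
  · have : Continuous fun y : EuclideanSpace ℝ (Fin pb) =>
        (WithLp.toLp 2 (ZMat D i *ᵥ ⇑y) : D.Obs i) := by fun_prop
    exact this.measurable.comp (h.b_measurable i)
  · exact (measurable_integratedVec (D.t i)).comp
      (measurable_pi_lambda _ (h.ζ_law i).measurable)
  · exact h.ε_measurable i

theorem iIndepFun_residualPart (h : IsModel D G θ P b ζ ε) (r : Fin 3) :
    iIndepFun (residualPart D b ζ ε r) P := by
  fin_cases r
  · have : ∀ i, Continuous fun y : EuclideanSpace ℝ (Fin pb) =>
        (WithLp.toLp 2 (ZMat D i *ᵥ ⇑y) : D.Obs i) := fun i => by fun_prop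
    exact h.b_indep.comp _ fun i => (this i).measurable
  · exact h.ζ_indep.comp (fun i x => integratedVec (D.t i) x) fun i =>
      measurable_integratedVec (D.t i)
  · exact h.ε_indep

theorem iIndepFun_residualPart_families (h : IsModel D G θ P b ζ ε) :
    iIndepFun (fun r ω => (residualPart D b ζ ε r · ω)) P := by
  rw [iIndepFun_iff_iIndep]
  refine iIndep_of_iIndep_of_le h.families_indep fun r => ?_
  fin_cases r
  · have hc : ∀ i, Continuous fun y : EuclideanSpace ℝ (Fin pb) =>
        (WithLp.toLp 2 (ZMat D i *ᵥ ⇑y) : D.Obs i) := fun i => by fun_prop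
    have hm : Measurable fun (x : ℕ → EuclideanSpace ℝ (Fin pb)) i =>
        (WithLp.toLp 2 (ZMat D i *ᵥ ⇑(x i)) : D.Obs i) :=
      measurable_pi_lambda _ fun i => (hc i).measurable.comp (measurable_pi_apply i)
    exact (hm.comp (comap_measurable fun ω i => b i ω)).comap_le
  · have hm : Measurable fun (x : ℕ → ℝ≥0 → ℝ) i => integratedVec (D.t i) (x i) :=
      measurable_pi_lambda _ fun i =>
        (measurable_integratedVec (D.t i)).comp (measurable_pi_apply i)
    exact (hm.comp (comap_measurable fun ω i t => ζ i t ω)).comap_le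
  · exact le_rfl

/-- Under the model, the residuals are independent, centered and Gaussian with covariance matrices
`Q_i(v)`. -/
theorem IsModel.exists_residuals [IsProbabilityMeasure P] (h : IsModel D G θ P b ζ ε) (hα : 0 < alphaOf (covOf θ))
    (hσ : 0 < sigmaSqOf (covOf θ)) (hG : (G (gammaOf (covOf θ))).PosSemidef)
    (hQ : ∀ i, (QMat D G i (covOf θ)).PosSemidef) :
    ∃ e : ∀ i, Ω → D.Obs i, (∀ i, Measurable (e i)) ∧ iIndepFun e P ∧
      (∀ i, P.map (e i) = multivariateGaussian 0 (QMat D G i (covOf θ))) ∧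
      ∀ᵐ ω ∂P, ∀ i, obs D (betaOf θ) b ζ ε i ω =
        WithLp.toLp 2 (XMat D i *ᵥ ⇑(betaOf θ)) + e i ω := by
  have hm := measurable_residualPart h
  obtain ⟨hind, hind'⟩ := iIndepFun_transpose hm (iIndepFun_residualPart_families h)
    (iIndepFun_residualPart h)
  refine ⟨fun i ω => ∑ r, residualPart D b ζ ε r i ω, fun i =>
    Finset.measurable_fun_sum _ fun r _ => hm r i, ?_, fun i => ?_, ?_⟩
  · exact hind.comp (fun i (x : Fin 3 → D.Obs i) => ∑ r, x r) fun i =>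
      Finset.measurable_fun_sum _ fun r _ => measurable_pi_apply r
  · have hmi : Measurable fun ω => ∑ r, residualPart D b ζ ε r i ω :=
      Finset.measurable_fun_sum _ fun r _ => hm r i
    have : IsProbabilityMeasure (P.map fun ω => ∑ r, residualPart D b ζ ε r i ω) :=
      Measure.isProbabilityMeasure_map hmi.aemeasurable
    refine Measure.ext_of_charFun (funext fun x => ?_)
    obtain ⟨hpsd, hW⟩ := (h.ζ_law i).map_integratedVec hα fun j => (D.t_pos i j).le
    have hH : (HMat D i (alphaOf (covOf θ)) (tauOf (covOf θ))).PosSemidef := hpsd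
    have hσ1 : (sigmaSqOf (covOf θ) • (1 : Matrix (Fin (D.n i)) (Fin (D.n i)) ℝ)).PosSemidef :=
      Matrix.PosSemidef.one.smul hσ.le
    have h0 : charFun (P.map (residualPart D b ζ ε 0 i)) x =
        charFun (P.map (b i)) (WithLp.toLp 2 ((ZMat D i)ᵀ *ᵥ ⇑x)) :=
      charFun_map_mulVec (h.b_measurable i) _ x
    have h1 : P.map (residualPart D b ζ ε 1 i) = multivariateGaussian 0
        (HMat D i (alphaOf (covOf θ)) (tauOf (covOf θ))) := hW
    have h2 : P.map (residualPart D b ζ ε 2 i) = multivariateGaussian 0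
        (sigmaSqOf (covOf θ) • (1 : Matrix (Fin (D.n i)) (Fin (D.n i)) ℝ)) := h.ε_law i
    rw [(hind' i).charFun_map_fun_sum_eq_prod fun r => (hm r i).aemeasurable,
      Finset.prod_apply, Fin.prod_univ_three, h0, h1, h2, h.b_law,
      charFun_multivariateGaussian hG, charFun_multivariateGaussian hH,
      charFun_multivariateGaussian hσ1, charFun_multivariateGaussian (hQ i), ← Complex.exp_add,
      ← Complex.exp_add]
    congr 1
    -- The three independent parts multiply characteristic functions, hence add quadratic forms;
    -- their sum is the form of `Q_i`.
    have hquad : ⇑x ⬝ᵥ (QMat D G i (covOf θ) *ᵥ ⇑x) =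
        ((ZMat D i)ᵀ *ᵥ ⇑x) ⬝ᵥ (G (gammaOf (covOf θ)) *ᵥ ((ZMat D i)ᵀ *ᵥ ⇑x)) +
        ⇑x ⬝ᵥ (HMat D i (alphaOf (covOf θ)) (tauOf (covOf θ)) *ᵥ ⇑x) +
        ⇑x ⬝ᵥ ((sigmaSqOf (covOf θ) • (1 : Matrix (Fin (D.n i)) (Fin (D.n i)) ℝ)) *ᵥ ⇑x) := by
      rw [QMat, Matrix.add_mulVec, Matrix.add_mulVec, dotProduct_add, dotProduct_add,
        ← Matrix.mulVec_mulVec, ← Matrix.mulVec_mulVec, Matrix.dotProduct_mulVec,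
        ← Matrix.mulVec_transpose]
    rw [hquad]
    simp only [inner_zero_right, Complex.ofReal_zero, zero_mul, zero_sub, Complex.ofReal_add]
    ring
  -- Path continuity, an almost sure property, is what identifies `pathIntegral` with the interval
  -- integral; this is why the identity is only asserted almost everywhere.
  · have hc : ∀ᵐ ω ∂P, ∀ i, Continuous fun t => ζ i t ω :=
      ae_all_iff.2 fun i => (h.ζ_law i).continuous_paths
    filter_upwards [hc] with ω hω i
    ext j
    have hj : pathIntegral (D.t i j) (fun s => ζ i s ω) = integrated (ζ i) (D.t i j) ω :=
      pathIntegral_eq (hω i) (D.t_pos i j).le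
    simp only [obs, Fin.sum_univ_three, residualPart, PiLp.add_apply, Matrix.cons_val_zero,
      Matrix.cons_val_one, Matrix.cons_val, integratedVec, hj]
    ring

end Residuals

end IOU

end

/-! ### Limit theorems for averages over the residuals. -/

noncomputable section

namespace IOU

variable {pβ pb pγ : ℕ} {D : Design pβ pb}
  {G : EuclideanSpace ℝ (Fin pγ) → Matrix (Fin pb) (Fin pb) ℝ} {θ : Par pβ pγ}
  {Ω : Type*} [MeasurableSpace Ω] {P : Measure Ω}

/-- The residuals `e i` are independent, centered and Gaussian with covariance matrices
`Q_i(v)`. -/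
structure IsResidual (D : Design pβ pb)
    (G : EuclideanSpace ℝ (Fin pγ) → Matrix (Fin pb) (Fin pb) ℝ) (θ : Par pβ pγ) (P : Measure Ω)
    (e : ∀ i, Ω → D.Obs i) : Prop where
  measurable : ∀ i, Measurable (e i)
  indep : iIndepFun e P
  law : ∀ i, P.map (e i) = multivariateGaussian 0 (QMat D G i (covOf θ))

section Averages

variable {e : ∀ i, Ω → D.Obs i}

theorem IsResidual.integral_comp (he : IsResidual D G θ P e) (i : ℕ) {f : D.Obs i → ℝ}
    (hf : Continuous f) :
    ∫ ω, f (e i ω) ∂P = ∫ x, f x ∂(multivariateGaussian 0 (QMat D G i (covOf θ))) := by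
  rw [← he.law i, integral_map (he.measurable i).aemeasurable hf.aestronglyMeasurable]

theorem IsResidual.integrable_comp (he : IsResidual D G θ P e) (i : ℕ) {f : D.Obs i → ℝ}
    (hf : Continuous f) {C : ℝ} {k : ℕ} (h : ∀ x, |f x| ≤ C * (1 + ‖x‖ ^ 2) ^ k) :
    Integrable (fun ω => f (e i ω)) P := by
  have := integrable_of_abs_le (S := QMat D G i (covOf θ)) hf C k h
  rw [← he.law i] at this
  exact this.comp_measurable (he.measurable i)

/-- Dimension and diagonal of `Q_i` are both at most `K`, and `(1 + y)³ ≤ 4 (1 + y³)`. This single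
uniform moment bound feeds both limit theorems and the remainder. -/
theorem IsResidual.integral_moment_le (he : IsResidual D G θ P e)
    (hQ : ∀ i, (QMat D G i (covOf θ)).PosDef)
    {F : ∀ i, CovIdx pγ → CovIdx pγ → Matrix (Fin (D.n i)) (Fin (D.n i)) ℝ} {K : ℝ} (hK : 1 ≤ K)
    (hb : ∀ i, IndBounds D G F θ K i) (i : ℕ) :
    ∫ ω, (1 + ‖e i ω‖ ^ 2) ^ 3 ∂P ≤ 4 * (1 + 15 * K ^ 6) := by
  have hc : Continuous fun x : D.Obs i => (1 + ‖x‖ ^ 2) ^ 3 := by fun_prop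
  have h6 := integral_norm_pow_six_le (hQ i).posSemidef (hb i).Q_le
  have : IsProbabilityMeasure P := he.indep.isProbabilityMeasure
  rw [Fintype.card_fin] at h6
  have hn : (D.n i : ℝ) ^ 3 ≤ K ^ 3 := pow_le_pow_left₀ (Nat.cast_nonneg _) (hb i).n_le 3
  have hi6 : Integrable (fun x : D.Obs i => ‖x‖ ^ 6)
      (multivariateGaussian 0 (QMat D G i (covOf θ))) :=
    integrable_of_abs_le (by fun_prop) 1 3 fun x => by
      rw [abs_of_nonneg (by positivity)]
      calc ‖x‖ ^ 6 = (‖x‖ ^ 2) ^ 3 := by ring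
        _ ≤ 1 * (1 + ‖x‖ ^ 2) ^ 3 := by
          rw [one_mul]; gcongr; linarith
  rw [he.integral_comp i hc]
  calc _ ≤ ∫ x : D.Obs i, 4 * (1 + ‖x‖ ^ 6) ∂(multivariateGaussian 0 (QMat D G i (covOf θ))) := by
        refine integral_mono (integrable_of_abs_le hc 1 3 fun x => ?_)
          (((integrable_const _).add hi6).const_mul 4) fun x => ?_
        · rw [abs_of_nonneg (by positivity), one_mul]
        · have h : ∀ y : ℝ, 0 ≤ y → (1 + y) ^ 3 ≤ 4 * (1 + y ^ 3) := fun y hy => by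
            nlinarith [mul_nonneg (by linarith : 0 ≤ 1 + y) (sq_nonneg (1 - y))]
          calc (1 + ‖x‖ ^ 2) ^ 3 ≤ 4 * (1 + (‖x‖ ^ 2) ^ 3) := h _ (sq_nonneg _)
            _ = _ := by ring
    _ = 4 * (1 + ∫ x : D.Obs i, ‖x‖ ^ 6 ∂(multivariateGaussian 0 (QMat D G i (covOf θ)))) := by
        rw [integral_const_mul, integral_add (integrable_const _) hi6]
        simp
    _ ≤ 4 * (1 + 15 * K ^ 3 * K ^ 3) := by
        gcongr
        exact h6.trans (by gcongr)
    _ = _ := by ring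

/-- The law of large numbers for functions of the residuals of quadratic growth. -/
theorem IsResidual.tendstoInMeasure_average (he : IsResidual D G θ P e) {B : ℝ}
    (hB : ∀ i, ∫ ω, (1 + ‖e i ω‖ ^ 2) ^ 3 ∂P ≤ B) {f : ∀ i, D.Obs i → ℝ}
    (hf : ∀ i, Continuous (f i)) {C : ℝ} (hC : ∀ i x, |f i x| ≤ C * (1 + ‖x‖ ^ 2)) {a : ℝ}
    (ha : Tendsto (fun N : ℕ => (N : ℝ)⁻¹ * ∑ i : Fin N, ∫ ω, f i (e i ω) ∂P) atTop (𝓝 a)) :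
    TendstoInMeasure P (fun (N : ℕ) ω => (N : ℝ)⁻¹ * ∑ i : Fin N, f i (e i ω)) atTop
      fun _ => a := by
  have : IsProbabilityMeasure P := he.indep.isProbabilityMeasure
  have hsq : ∀ i x, |f i x ^ 2| ≤ C ^ 2 * (1 + ‖x‖ ^ 2) ^ 3 := fun i x => by
    have h1 : (1 : ℝ) ≤ 1 + ‖x‖ ^ 2 := le_add_of_nonneg_right (sq_nonneg _)
    rw [abs_of_nonneg (sq_nonneg _), ← sq_abs]
    calc |f i x| ^ 2 ≤ (C * (1 + ‖x‖ ^ 2)) ^ 2 := pow_le_pow_left₀ (abs_nonneg _) (hC i x) 2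
      _ = C ^ 2 * (1 + ‖x‖ ^ 2) ^ 2 := by ring
      _ ≤ _ := by
        gcongr
        norm_num
  have hint : ∀ i, Integrable (fun ω => f i (e i ω) ^ 2) P := fun i =>
    he.integrable_comp i ((hf i).pow 2) (hsq i)
  have hi3 : ∀ i, Integrable (fun ω => (1 + ‖e i ω‖ ^ 2) ^ 3) P := fun i =>
    he.integrable_comp i (f := fun x => (1 + ‖x‖ ^ 2) ^ 3) (by fun_prop) (C := 1) (k := 3)
      fun x => by rw [abs_of_nonneg (by positivity), one_mul]
  refine IOU.tendstoInMeasure_average (he.indep.comp f fun i => (hf i).measurable)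
    (fun i => ?_) (C := C ^ 2 * B) (fun i => ?_) ha
  · exact (memLp_two_iff_integrable_sq
      ((hf i).measurable.comp (he.measurable i)).aestronglyMeasurable).2 (hint i)
  · calc _ ≤ ∫ ω, C ^ 2 * (1 + ‖e i ω‖ ^ 2) ^ 3 ∂P :=
          integral_mono (hint i) ((hi3 i).const_mul _) fun ω => (le_abs_self _).trans (hsq i _)
      _ ≤ _ := by
        rw [integral_const_mul]
        gcongr
        exact hB i

/-- Averages of functions of the residuals of quadratic growth are bounded in probability. -/
theorem IsResidual.tendsto_measure_lt_average (he : IsResidual D G θ P e) {B : ℝ}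
    (hB : ∀ i, ∫ ω, (1 + ‖e i ω‖ ^ 2) ^ 3 ∂P ≤ B) {c : ℝ} (hc : 0 ≤ c) :
    Tendsto (fun N : ℕ => P {ω | c * B + 1 < (N : ℝ)⁻¹ * ∑ i : Fin N, c * (1 + ‖e i ω‖ ^ 2)})
      atTop (𝓝 0) := by
  have : IsProbabilityMeasure P := he.indep.isProbabilityMeasure
  have hi1 : ∀ i, Integrable (fun ω => c * (1 + ‖e i ω‖ ^ 2)) P := fun i =>
    (he.integrable_comp i (f := fun x => 1 + ‖x‖ ^ 2) (by fun_prop) (C := 1) (k := 1)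
      fun x => by rw [abs_of_nonneg (by positivity), one_mul, pow_one]).const_mul c
  have hi3 : ∀ i, Integrable (fun ω => (1 + ‖e i ω‖ ^ 2) ^ 3) P := fun i =>
    he.integrable_comp i (f := fun x => (1 + ‖x‖ ^ 2) ^ 3) (by fun_prop) (C := 1) (k := 3)
      fun x => by rw [abs_of_nonneg (by positivity), one_mul]
  set m : ℕ → ℝ := fun i => ∫ ω, c * (1 + ‖e i ω‖ ^ 2) ∂P with hm
  have hm0 : ∀ i, 0 ≤ m i := fun i => integral_nonneg fun ω => by positivity
  have hmB : ∀ i, m i ≤ c * B := fun i => by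
    calc m i ≤ ∫ ω, c * (1 + ‖e i ω‖ ^ 2) ^ 3 ∂P :=
          integral_mono (hi1 i) ((hi3 i).const_mul c) fun ω => by
            have h1 : (1 : ℝ) ≤ 1 + ‖e i ω‖ ^ 2 := le_add_of_nonneg_right (sq_nonneg _)
            dsimp only
            gcongr
            exact le_self_pow₀ h1 (by norm_num)
      _ ≤ _ := by
        rw [integral_const_mul]
        gcongr
        exact hB i
  have hcB : 0 ≤ c * B := (hm0 0).trans (hmB 0)
  -- The law of large numbers is applied to the centered variables. As the means are at most `c *
  -- B`, exceeding `c * B + 1` requires a deviation of at least `1`.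
  have h := he.tendstoInMeasure_average hB (f := fun i x => c * (1 + ‖x‖ ^ 2) - m i)
    (fun i => by fun_prop) (C := c + c * B) (fun i x => by
      have h1 : 0 ≤ ‖x‖ ^ 2 := sq_nonneg _
      have h2 : 0 ≤ c * ‖x‖ ^ 2 := by positivity
      have h3 : 0 ≤ c * B * ‖x‖ ^ 2 := by positivity
      rw [abs_le]
      constructor <;> nlinarith [hm0 i, hmB i]) (a := 0) (by
      have : ∀ i, ∫ ω, (c * (1 + ‖e i ω‖ ^ 2) - m i) ∂P = 0 := fun i => by
        rw [integral_sub (hi1 i) (integrable_const _)]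
        simp [hm]
      simp [this])
  rw [tendstoInMeasure_iff_norm] at h
  refine tendsto_of_tendsto_of_tendsto_of_le_of_le tendsto_const_nhds (h 1 one_pos)
    (fun _ => zero_le) fun N => measure_mono fun ω hω => ?_
  simp only [Set.mem_ofPred_eq, sub_zero, Finset.sum_sub_distrib, mul_sub] at hω ⊢
  have hN : 0 < N := by
    rcases Nat.eq_zero_or_pos N with rfl | h0
    · simp at hω
      linarith
    · exact h0
  have hmean : (N : ℝ)⁻¹ * ∑ i : Fin N, m i ≤ c * B := by
    rw [inv_mul_le_iff₀ (Nat.cast_pos.2 hN)]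
    calc _ ≤ ∑ i : Fin N, c * B := Finset.sum_le_sum fun i _ => hmB i
      _ = _ := by simp
  refine le_trans ?_ (Real.le_norm_self _)
  linarith

variable {F : ∀ i, CovIdx pγ → CovIdx pγ → Matrix (Fin (D.n i)) (Fin (D.n i)) ℝ} {K : ℝ}
  {I : Matrix (ParIdx pβ pγ) (ParIdx pβ pγ) ℝ}

theorem continuous_indHess (F : ∀ i, CovIdx pγ → CovIdx pγ → Matrix (Fin (D.n i)) (Fin (D.n i)) ℝ)
    (i : ℕ) (a b : ParIdx pβ pγ) : Continuous fun x => indHess D G F θ i x a b :=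
  continuous_gaussHess _ _ _ _ a b

theorem continuous_indScore (i : ℕ) : Continuous (indScore D G θ i) :=
  continuous_gaussScore _ _ _

theorem IsResidual.tendstoInMeasure_hess (he : IsResidual D G θ P e)
    (hQ : ∀ i, (QMat D G i (covOf θ)).PosDef) (hK : 1 ≤ K) (hb : ∀ i, IndBounds D G F θ K i)
    (hI : ∀ a b, Tendsto (fun N : ℕ => (N : ℝ)⁻¹ * ∑ i : Fin N, indInfo D G θ i a b) atTop
      (𝓝 (I a b))) (a b : ParIdx pβ pγ) :
    TendstoInMeasure P
      (fun (N : ℕ) ω => ((N : ℝ)⁻¹ • ∑ i : Fin N, indHess D G F θ i (e i ω)) a b) atTop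
      fun _ => -I a b := by
  simp only [Matrix.smul_apply, Matrix.sum_apply, smul_eq_mul]
  refine he.tendstoInMeasure_average (he.integral_moment_le hQ hK hb)
    (f := fun i x => indHess D G F θ i x a b) (fun i => continuous_indHess F i a b)
    (C := 3 * K ^ 5) (fun i x => ?_) ?_
  · exact abs_gaussHess_le hK (hb i).X_le (hb i).inv_le (hb i).dQ_le (hb i).F_le x a b
  · have : ∀ i, ∫ ω, indHess D G F θ i (e i ω) a b ∂P = -indInfo D G θ i a b := fun i => by
      rw [he.integral_comp i (continuous_indHess F i a b)]
      exact integral_gaussHess (hQ i) (F i) a b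
    simp only [this, Finset.sum_neg_distrib, mul_neg]
    exact (hI a b).neg

/-- The central limit theorem for the score. -/
theorem IsResidual.tendstoInDistribution_score [IsProbabilityMeasure P]
    (he : IsResidual D G θ P e)
    (hQ : ∀ i, (QMat D G i (covOf θ)).PosDef)
    (hD : ∀ i k, (dQMat D G i k (covOf θ)).IsSymm) (hK : 1 ≤ K)
    (hb : ∀ i, IndBounds D G F θ K i) (hIpsd : I.PosSemidef)
    (hI : ∀ a b, Tendsto (fun N : ℕ => (N : ℝ)⁻¹ * ∑ i : Fin N, indInfo D G θ i a b) atTop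
      (𝓝 (I a b))) :
    TendstoInDistribution (fun (N : ℕ) ω => (√N)⁻¹ • ∑ i : Fin N, indScore D G θ i (e i ω)) atTop id
      (fun _ => P) (multivariateGaussian 0 I) := by
  have hinner : ∀ (x u : Par pβ pγ), inner ℝ x u = ⇑x ⬝ᵥ ⇑u := fun x u => by
    rw [EuclideanSpace.inner_eq_star_dotProduct, star_trivial, dotProduct_comm]
  set q : ℝ := ((Fintype.card (ParIdx pβ pγ) : ℕ) : ℝ) with hq
  have hbound : ∀ i (x : D.Obs i), ‖indScore D G θ i x‖ ≤ q * K ^ 3 * (1 + ‖x‖ ^ 2) := fun i x => by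
    have h1 : ‖indScore D G θ i x‖ ≤ ∑ a, |indScore D G θ i x a| := by
      rw [EuclideanSpace.norm_eq]
      refine Real.sqrt_le_iff.2 ⟨by positivity, ?_⟩
      simp only [Real.norm_eq_abs]
      exact Finset.sum_sq_le_sq_sum_of_nonneg fun a _ => abs_nonneg _
    refine h1.trans ((Finset.sum_le_sum fun a _ =>
      abs_gaussScore_le hK (hb i).X_le (hb i).inv_le (hb i).dQ_le x a).trans_eq ?_)
    rw [Finset.sum_const, nsmul_eq_mul, Finset.card_univ, mul_assoc]
  have hq0 : 0 ≤ q := Nat.cast_nonneg _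
  have hK0 : 0 ≤ K := by linarith
  have hcube : ∀ i (x : D.Obs i), |‖indScore D G θ i x‖ ^ 3| ≤
      (q * K ^ 3) ^ 3 * (1 + ‖x‖ ^ 2) ^ 3 := fun i x => by
    rw [abs_of_nonneg (by positivity), ← mul_pow]
    exact pow_le_pow_left₀ (norm_nonneg _) (hbound i x) 3
  have hcs := fun i => continuous_indScore (D := D) (G := G) (θ := θ) i
  have hint : ∀ i, Integrable (fun ω => ‖indScore D G θ i (e i ω)‖ ^ 3) P := fun i =>
    he.integrable_comp i ((hcs i).norm.pow 3) (hcube i)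
  have hi3 : ∀ i, Integrable (fun ω => (1 + ‖e i ω‖ ^ 2) ^ 3) P := fun i =>
    he.integrable_comp i (f := fun x => (1 + ‖x‖ ^ 2) ^ 3) (by fun_prop) (C := 1) (k := 3)
      fun x => by rw [abs_of_nonneg (by positivity), one_mul]
  have hmeas : ∀ i, Measurable fun ω => indScore D G θ i (e i ω) := fun i =>
    (hcs i).measurable.comp (he.measurable i)
  have hcd : ∀ i (u : Par pβ pγ), Continuous fun x => ⇑(indScore D G θ i x) ⬝ᵥ ⇑u := fun i u => by
    have := (hcs i).inner (continuous_const (y := u)) (𝕜 := ℝ)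
    simpa only [hinner] using this
  refine tendstoInDistribution_inv_sqrt_smul_sum (he.indep.comp _ fun i => (hcs i).measurable)
    hmeas (fun i => ?_) (C := (q * K ^ 3) ^ 3 * (4 * (1 + 15 * K ^ 6))) (fun i => ?_)
    (fun i u => ?_) hIpsd fun u => ?_
  · refine (integrable_norm_rpow_iff (hmeas i).aestronglyMeasurable (by norm_num)
      (by norm_num)).1 ?_
    simpa using hint i
  · calc _ ≤ ∫ ω, (q * K ^ 3) ^ 3 * (1 + ‖e i ω‖ ^ 2) ^ 3 ∂P :=
          integral_mono (hint i) ((hi3 i).const_mul _) fun ω => (le_abs_self _).trans (hcube i _)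
      _ ≤ _ := by
        rw [integral_const_mul]
        gcongr
        exact he.integral_moment_le hQ hK hb i
  · simp only [hinner, Function.comp]
    rw [he.integral_comp i (hcd i u)]
    exact integral_gaussScore_dotProduct (hQ i) _
  · have hv : ∀ i, ∫ ω, inner ℝ (indScore D G θ i (e i ω)) u ^ 2 ∂P =
        ∑ a, ∑ b, u a * u b * indInfo D G θ i a b := fun i => by
      simp only [hinner]
      refine (he.integral_comp i (f := fun x => (⇑(indScore D G θ i x) ⬝ᵥ ⇑u) ^ 2)
        ((hcd i u).pow 2)).trans ((integral_gaussScore_dotProduct_sq (hQ i) (hD i) _).trans ?_)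
      simp only [dotProduct, Matrix.mulVec, Finset.mul_sum]
      exact Finset.sum_congr rfl fun a _ => Finset.sum_congr rfl fun b _ => by
        rw [indInfo]; ring
    have hu : ⇑u ⬝ᵥ (I *ᵥ ⇑u) = ∑ a, ∑ b, u a * u b * I a b := by
      simp only [dotProduct, Matrix.mulVec, Finset.mul_sum]
      exact Finset.sum_congr rfl fun a _ => Finset.sum_congr rfl fun b _ => by ring
    have hsum : ∀ N : ℕ, (N : ℝ)⁻¹ * ∑ i : Fin N, ∑ a, ∑ b, u a * u b * indInfo D G θ i a b =
        ∑ a, ∑ b, u a * u b * ((N : ℝ)⁻¹ * ∑ i : Fin N, indInfo D G θ i a b) := fun N => by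
      rw [Finset.sum_comm, Finset.mul_sum]
      refine Finset.sum_congr rfl fun a _ => ?_
      rw [Finset.sum_comm, Finset.mul_sum]
      refine Finset.sum_congr rfl fun b _ => ?_
      rw [← Finset.mul_sum]
      ring
    simp only [Function.comp, hv, hu, hsum]
    exact tendsto_finsetSum _ fun a _ => tendsto_finsetSum _ fun b _ => (hI a b).const_mul _

end Averages

end IOU

end

/-! ### The log-likelihood of the sample and the information matrix. -/

noncomputable section

namespace IOU

section LogLikelihood

variable {pβ pb pγ : ℕ} {D : Design pβ pb}
  {G : EuclideanSpace ℝ (Fin pγ) → Matrix (Fin pb) (Fin pb) ℝ}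
  {Θβ : Set (EuclideanSpace ℝ (Fin pβ))}
  {Θγ : Set (EuclideanSpace ℝ (Fin pγ))} {Θs : Set (EuclideanSpace ℝ (Fin 3))} {θ : Par pβ pγ}

/-- The observation with mean `X_i β` and residual `e`. -/
def obsOfResid (D : Design pβ pb) (θ : Par pβ pγ) (N : ℕ) (e : ∀ i, D.Obs i) : D.Sample N :=
  fun i => WithLp.toLp 2 (XMat D i *ᵥ ⇑(betaOf θ)) + e i

theorem abs_sum_expansion_le {ι : Type*} [Fintype ι] {N : ℕ} {l κ : Fin N → ℝ}
    {S : Fin N → EuclideanSpace ℝ ι} {H : Fin N → Matrix ι ι ℝ} {h : EuclideanSpace ℝ ι} {t : ℝ}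
    (hl : ∀ i, |l i - (⇑(S i) ⬝ᵥ ⇑h + 1 / 2 * (⇑h ⬝ᵥ (H i *ᵥ ⇑h)))| ≤ κ i * t) :
    |∑ i, l i - (⇑(∑ i, S i) ⬝ᵥ ⇑h + 1 / 2 * (⇑h ⬝ᵥ ((∑ i, H i) *ᵥ ⇑h)))| ≤ (∑ i, κ i) * t := by
  have : ∑ i, l i - (⇑(∑ i, S i) ⬝ᵥ ⇑h + 1 / 2 * (⇑h ⬝ᵥ ((∑ i, H i) *ᵥ ⇑h))) =
      ∑ i, (l i - (⇑(S i) ⬝ᵥ ⇑h + 1 / 2 * (⇑h ⬝ᵥ (H i *ᵥ ⇑h)))) := by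
    rw [WithLp.ofLp_sum, sum_dotProduct, Matrix.sum_mulVec, dotProduct_sum, Finset.mul_sum,
      ← Finset.sum_add_distrib, ← Finset.sum_sub_distrib]
  rw [this, Finset.sum_mul]
  exact (Finset.abs_sum_le_sum_abs _ _).trans (Finset.sum_le_sum fun i _ => hl i)

/-- After the linear term the expansion leaves `O(‖h‖²)`, which identifies the gradient without
differentiating determinants or inverse matrices. -/
theorem hasGradientAt_of_expansion {ι : Type*} [Fintype ι] {f : EuclideanSpace ℝ ι → ℝ}
    {x S : EuclideanSpace ℝ ι} {H : Matrix ι ι ℝ} {r C : ℝ} (hr : 0 < r)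
    (h : ∀ h, ‖h‖ ≤ r → |f (x + h) - f x - (⇑S ⬝ᵥ ⇑h + 1 / 2 * (⇑h ⬝ᵥ (H *ᵥ ⇑h)))| ≤
      C * ‖h‖ ^ 3) : HasGradientAt f S x := by
  rw [hasGradientAt_iff_hasFDerivAt, hasFDerivAt_iff_isLittleO_nhds_zero]
  have hO : (fun h => f (x + h) - f x - InnerProductSpace.toDual ℝ _ S h) =O[𝓝 0]
      fun h => ‖h‖ ^ 2 := by
    refine Asymptotics.IsBigO.of_bound (|C| * r + absSum H) ?_
    filter_upwards [Metric.closedBall_mem_nhds (0 : EuclideanSpace ℝ ι) hr] with u hu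
    rw [mem_closedBall_zero_iff] at hu
    have hin : InnerProductSpace.toDual ℝ _ S u = ⇑S ⬝ᵥ ⇑u := by
      rw [InnerProductSpace.toDual_apply_apply, EuclideanSpace.inner_eq_star_dotProduct,
        star_trivial, dotProduct_comm]
    rw [hin, norm_pow, norm_norm, Real.norm_eq_abs]
    have h1 := h u hu
    have h2 := abs_bilin_le H u u
    have h3 : C * ‖u‖ ^ 3 ≤ |C| * r * ‖u‖ ^ 2 := by
      calc C * ‖u‖ ^ 3 ≤ |C| * ‖u‖ ^ 3 := by gcongr; exact le_abs_self C
        _ = |C| * ‖u‖ * ‖u‖ ^ 2 := by ring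
        _ ≤ _ := by gcongr
    have h4 : 0 ≤ absSum H * ‖u‖ ^ 2 := mul_nonneg (absSum_nonneg H) (sq_nonneg _)
    rw [← sq] at h2
    rw [abs_le] at h1 h2 ⊢
    constructor <;> nlinarith [h1.1, h1.2, h2.1, h2.2]
  refine hO.trans_isLittleO ?_
  have : (fun h : EuclideanSpace ℝ ι => ‖h‖ ^ 2) =o[𝓝 0] fun h => h := by
    simpa using Asymptotics.isLittleO_norm_pow_id (E' := EuclideanSpace ℝ ι) one_lt_two
  exact this

theorem logLik_obsOfResid (N : ℕ) (e : ∀ i, D.Obs i) (θ' : Par pβ pγ) :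
    logLik D G N (obsOfResid D θ N e) θ' = ∑ i : Fin N,
      gaussianLogDensity (XMat D i *ᵥ ⇑(betaOf θ')) (QMat D G i (covOf θ'))
        (XMat D i *ᵥ ⇑(betaOf θ) + ⇑(e i)) := rfl

/-- The expansion of the contributions of all individuals to the log-likelihood. -/
def HasIndExpansion (D : Design pβ pb)
    (G : EuclideanSpace ℝ (Fin pγ) → Matrix (Fin pb) (Fin pb) ℝ)
    (F : ∀ i, CovIdx pγ → CovIdx pγ → Matrix (Fin (D.n i)) (Fin (D.n i)) ℝ) (θ : Par pβ pγ)
    (r κ : ℝ) : Prop :=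
  ∀ (i : ℕ) (e : D.Obs i) (h : Par pβ pγ), ‖h‖ ≤ r →
    |(gaussianLogDensity (XMat D i *ᵥ ⇑(betaOf (θ + h))) (QMat D G i (covOf (θ + h)))
        (XMat D i *ᵥ ⇑(betaOf θ) + ⇑e) -
      gaussianLogDensity (XMat D i *ᵥ ⇑(betaOf θ)) (QMat D G i (covOf θ))
        (XMat D i *ᵥ ⇑(betaOf θ) + ⇑e)) -
      (⇑(indScore D G θ i e) ⬝ᵥ ⇑h + 1 / 2 * (⇑h ⬝ᵥ (indHess D G F θ i e *ᵥ ⇑h)))| ≤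
    κ * (1 + ‖e‖ ^ 2) * ‖h‖ ^ 3

variable {F : ∀ i, CovIdx pγ → CovIdx pγ → Matrix (Fin (D.n i)) (Fin (D.n i)) ℝ} {r κ : ℝ}

theorem HasIndExpansion.logLik (hexp : HasIndExpansion D G F θ r κ) (N : ℕ) (e : ∀ i, D.Obs i)
    (h : Par pβ pγ) (hh : ‖h‖ ≤ r) :
    |logLik D G N (obsOfResid D θ N e) (θ + h) - logLik D G N (obsOfResid D θ N e) θ -
      (⇑(∑ i : Fin N, indScore D G θ i (e i)) ⬝ᵥ ⇑h +
        1 / 2 * (⇑h ⬝ᵥ ((∑ i : Fin N, indHess D G F θ i (e i)) *ᵥ ⇑h)))| ≤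
      (∑ i : Fin N, κ * (1 + ‖e i‖ ^ 2)) * ‖h‖ ^ 3 := by
  rw [logLik_obsOfResid, logLik_obsOfResid, ← Finset.sum_sub_distrib]
  exact abs_sum_expansion_le fun i => hexp i (e i) h hh

theorem HasIndExpansion.hasGradientAt (hexp : HasIndExpansion D G F θ r κ) (hr : 0 < r) (N : ℕ)
    (e : ∀ i, D.Obs i) :
    HasGradientAt (IOU.logLik D G N (obsOfResid D θ N e))
      (∑ i : Fin N, indScore D G θ i (e i)) θ :=
  hasGradientAt_of_expansion hr fun h hh => hexp.logLik N e h hh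

theorem HasIndExpansion.normScore_eq (hexp : HasIndExpansion D G F θ r κ) (hr : 0 < r) (N : ℕ)
    (e : ∀ i, D.Obs i) :
    normScore D G N (obsOfResid D θ N e) θ = (√N)⁻¹ • ∑ i : Fin N, indScore D G θ i (e i) := by
  rw [normScore, (hexp.hasGradientAt hr N e).gradient]

/-- The normalization expected by `lan_of_expansion` and `argmax_linear_of_expansion`. For `N = 0`
both sides vanish, the sums being empty. -/
theorem HasIndExpansion.rescaled (hexp : HasIndExpansion D G F θ r κ) (N : ℕ) (e : ∀ i, D.Obs i)
    (h : Par pβ pγ) (hh : ‖h‖ ≤ r) :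
    |(IOU.logLik D G N (obsOfResid D θ N e) (θ + h) - IOU.logLik D G N (obsOfResid D θ N e) θ) -
      (√N * (⇑((√N)⁻¹ • ∑ i : Fin N, indScore D G θ i (e i)) ⬝ᵥ ⇑h) + √N ^ 2 / 2 *
        (⇑h ⬝ᵥ (((N : ℝ)⁻¹ • ∑ i : Fin N, indHess D G F θ i (e i)) *ᵥ ⇑h)))| ≤
      √N ^ 2 * ((N : ℝ)⁻¹ * ∑ i : Fin N, κ * (1 + ‖e i‖ ^ 2)) * ‖h‖ ^ 3 := by
  have h1 := hexp.logLik N e h hh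
  rcases Nat.eq_zero_or_pos N with rfl | hN
  · simp [IOU.logLik]
  have hN' : (0 : ℝ) < N := Nat.cast_pos.2 hN
  have hs : √(N : ℝ) ≠ 0 := (Real.sqrt_pos.2 hN').ne'
  rw [Real.sq_sqrt hN'.le, WithLp.ofLp_smul, smul_dotProduct, smul_eq_mul,
    mul_inv_cancel_left₀ hs, Matrix.smul_mulVec, dotProduct_smul, smul_eq_mul,
    mul_inv_cancel_left₀ hN'.ne', ← mul_assoc, div_mul_eq_mul_div, mul_inv_cancel₀ hN'.ne']
  exact h1

theorem exists_hasIndExpansion (hΘβ : IsOpen Θβ) (hΘγ : IsOpen Θγ) (hΘs : IsOpen Θs)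
    (hpos : ∀ s ∈ Θs, ∀ k, 0 < s k) (hG : ∀ γ ∈ Θγ, (G γ).PosSemidef)
    (hG3 : ∀ j k, ContDiffOn ℝ 3 (fun γ => G γ j k) Θγ)
    (hQ : UniformlyNondegenerate D G (covSet Θγ Θs)) (hθ : θ ∈ parSet Θβ Θγ Θs) :
    ∃ r > 0, ∃ K : ℝ, 1 ≤ K ∧ Metric.closedBall θ r ⊆ parSet Θβ Θγ Θs ∧
      ∃ F, (∀ i, IndBounds D G F θ K i) ∧ HasIndExpansion D G F θ r (200 * K ^ 8) := by
  obtain ⟨r, hr, K, hK, hball, F, hF⟩ :=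
    exists_gaussianLogDensity_expansion hΘβ hΘγ hΘs hpos hG hG3 hQ hθ
  exact ⟨r, hr, K, hK, hball, F, fun i => (hF i).1, fun i => (hF i).2⟩

/-- Relative to any parameter `θ`, any sample is a mean plus residuals, so the expansion at `θ`
makes the log-likelihood differentiable there. -/
theorem continuousOn_logLik (hΘβ : IsOpen Θβ) (hΘγ : IsOpen Θγ) (hΘs : IsOpen Θs)
    (hpos : ∀ s ∈ Θs, ∀ k, 0 < s k) (hG : ∀ γ ∈ Θγ, (G γ).PosSemidef)
    (hG3 : ∀ j k, ContDiffOn ℝ 3 (fun γ => G γ j k) Θγ)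
    (hQ : UniformlyNondegenerate D G (covSet Θγ Θs)) (N : ℕ) (y : D.Sample N) :
    ContinuousOn (logLik D G N y) (parSet Θβ Θγ Θs) := by
  intro θ hθ
  obtain ⟨r, hr, K, -, -, F, -, hexp⟩ :=
    exists_hasIndExpansion hΘβ hΘγ hΘs hpos hG hG3 hQ hθ
  -- The log-likelihood sees only the first `N` residuals; the others are given the default value
  -- `0`.
  set e : ∀ i, D.Obs i := fun i => if h : i < N then
    y ⟨i, h⟩ - WithLp.toLp 2 (XMat D i *ᵥ ⇑(betaOf θ)) else 0 with he
  have hy : obsOfResid D θ N e = y := by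
    funext i
    simp [obsOfResid, he]
  have := (hexp.hasGradientAt hr N e).continuousAt
  rw [hy] at this
  exact this.continuousWithinAt

theorem measurable_logLik (N : ℕ) (θ : Par pβ pγ) : Measurable fun y => logLik D G N y θ := by
  refine Finset.measurable_fun_sum _ fun i _ => ?_
  have : Continuous fun x : D.Obs i => gaussianLogDensity (XMat D i *ᵥ ⇑(betaOf θ))
      (QMat D G i (covOf θ)) ⇑x := by
    unfold gaussianLogDensity
    simp only [Matrix.mulVec, dotProduct]
    fun_prop
  exact this.measurable.comp (measurable_pi_apply i)

end LogLikelihood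

section Information

variable {pβ pb pγ : ℕ}

theorem tendsto_average_indInfo {D : Design pβ pb}
    {G : EuclideanSpace ℝ (Fin pγ) → Matrix (Fin pb) (Fin pb) ℝ} {θ : Par pβ pγ}
    {A : Matrix (Fin pβ) (Fin pβ) ℝ} {U : Matrix (CovIdx pγ) (CovIdx pγ) ℝ}
    (hA : Tendsto (fun N => avgA D G N (covOf θ)) atTop (𝓝 A))
    (hU : ∀ j k, Tendsto (fun N => avgU D G N j k (covOf θ)) atTop (𝓝 (U j k)))
    (a b : ParIdx pβ pγ) :
    Tendsto (fun N : ℕ => (N : ℝ)⁻¹ * ∑ i : Fin N, indInfo D G θ i a b) atTop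
      (𝓝 (infoMat A U a b)) := by
  rcases a with a | j <;> rcases b with b | k
  · have := (tendsto_pi_nhds.1 (tendsto_pi_nhds.1 hA a)) b
    simpa [avgA, indInfo, gaussInfo, infoMat, Matrix.sum_apply] using this
  · simp [indInfo, gaussInfo, infoMat]
  · simp [indInfo, gaussInfo, infoMat]
  · simpa [avgU, indInfo, gaussInfo, infoMat] using hU j k

theorem infoMat_isSymm {A : Matrix (Fin pβ) (Fin pβ) ℝ} {U : Matrix (CovIdx pγ) (CovIdx pγ) ℝ}
    (hA : A.IsSymm) (hU : U.IsSymm) : (infoMat A U).IsSymm := by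
  rw [infoMat, Matrix.IsSymm, Matrix.fromBlocks_transpose, hA.eq, hU.eq]
  simp

theorem le_infoMat_quadraticForm {A : Matrix (Fin pβ) (Fin pβ) ℝ}
    {U : Matrix (CovIdx pγ) (CovIdx pγ) ℝ} {c₁ c₂ : ℝ}
    (hA : ∀ x, c₁ * (x ⬝ᵥ x) ≤ x ⬝ᵥ (A *ᵥ x)) (hU : ∀ x, c₂ * (x ⬝ᵥ x) ≤ x ⬝ᵥ (U *ᵥ x))
    (x : ParIdx pβ pγ → ℝ) : min c₁ c₂ * (x ⬝ᵥ x) ≤ x ⬝ᵥ (infoMat A U *ᵥ x) := by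
  rw [← Sum.elim_comp_inl_inr x, infoMat, quadraticForm_fromBlocks, sumElim_dotProduct_sumElim]
  have h1 := hA (x ∘ Sum.inl)
  have h2 := hU (x ∘ Sum.inr)
  have h3 : 0 ≤ (x ∘ Sum.inl) ⬝ᵥ (x ∘ Sum.inl) := Finset.sum_nonneg fun _ _ => mul_self_nonneg _
  have h4 : 0 ≤ (x ∘ Sum.inr) ⬝ᵥ (x ∘ Sum.inr) := Finset.sum_nonneg fun _ _ => mul_self_nonneg _
  have h5 := mul_le_mul_of_nonneg_right (min_le_left c₁ c₂) h3
  have h6 := mul_le_mul_of_nonneg_right (min_le_right c₁ c₂) h4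
  simp only [Matrix.zero_mulVec, dotProduct_zero, add_zero]
  linarith

/-- The image has covariance `I⁻¹ I I⁻¹ = I⁻¹`, by symmetry of the inverse. -/
theorem map_inv_multivariateGaussian {ι : Type*} [Fintype ι] [DecidableEq ι] {I : Matrix ι ι ℝ}
    (hI : I.PosDef) :
    (multivariateGaussian 0 I).map (fun x : EuclideanSpace ℝ ι => (WithLp.toLp 2 (I⁻¹ *ᵥ ⇑x) : EuclideanSpace ℝ ι)) =
      multivariateGaussian 0 I⁻¹ := by
  have hc : Continuous fun x : EuclideanSpace ℝ ι =>
      (WithLp.toLp 2 (I⁻¹ *ᵥ ⇑x) : EuclideanSpace ℝ ι) := by fun_prop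
  have : IsProbabilityMeasure ((multivariateGaussian 0 I).map fun x : EuclideanSpace ℝ ι =>
      (WithLp.toLp 2 (I⁻¹ *ᵥ ⇑x) : EuclideanSpace ℝ ι)) :=
    Measure.isProbabilityMeasure_map hc.measurable.aemeasurable
  refine Measure.ext_of_charFun (funext fun x => ?_)
  have h1 := charFun_map_mulVec (P := multivariateGaussian 0 I) measurable_id I⁻¹ x
  simp only [id] at h1
  have hII : I * I⁻¹ = 1 := Matrix.mul_nonsing_inv _ hI.det_pos.ne'.isUnit
  rw [h1, (PosDef.isSymm_inv hI).eq, Measure.map_id, charFun_multivariateGaussian hI.posSemidef,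
    charFun_multivariateGaussian hI.inv.posSemidef]
  simp only [Matrix.mulVec_mulVec, hII, Matrix.one_mulVec, inner_zero_right]
  rw [dotProduct_comm]

end Information

end IOU

end

/-! ### Asymptotics in terms of the residuals. -/

noncomputable section

namespace IOU

section Limits

variable {ι : Type*} [Fintype ι] {I : Matrix ι ι ℝ}

theorem posDef_of_le_quadraticForm (hI : I.IsSymm) {c : ℝ} (hc : 0 < c)
    (h : ∀ x : ι → ℝ, c * (x ⬝ᵥ x) ≤ x ⬝ᵥ (I *ᵥ x)) : I.PosDef := by
  refine Matrix.PosDef.of_dotProduct_mulVec_pos ?_ fun x hx => ?_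
  · rw [Matrix.IsHermitian, conjTranspose_eq_transpose_of_trivial, hI.eq]
  · rw [star_trivial]
    refine lt_of_lt_of_le (mul_pos hc ?_) (h x)
    exact lt_of_le_of_ne (Finset.sum_nonneg fun _ _ => mul_self_nonneg _)
      fun h0 => hx (dotProduct_self_eq_zero.1 h0.symm)

theorem tendstoInDistribution_inv_mulVec [DecidableEq ι] {Ω : Type*} [MeasurableSpace Ω] {P : Measure Ω}
    [IsProbabilityMeasure P] (hI : I.PosDef) {X : ℕ → Ω → EuclideanSpace ℝ ι}
    (h : TendstoInDistribution X atTop id (fun _ => P) (multivariateGaussian 0 I)) :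
    TendstoInDistribution
      (fun N ω => (WithLp.toLp 2 (I⁻¹ *ᵥ ⇑(X N ω)) : EuclideanSpace ℝ ι)) atTop id (fun _ => P)
      (multivariateGaussian 0 I⁻¹) := by
  have hc : Continuous fun x : EuclideanSpace ℝ ι =>
      (WithLp.toLp 2 (I⁻¹ *ᵥ ⇑x) : EuclideanSpace ℝ ι) := by fun_prop
  have h1 := h.continuous_comp hc
  refine ⟨h1.forall_aemeasurable, aemeasurable_id, ?_⟩
  have h2 := h1.tendsto
  have h3 : (⟨(multivariateGaussian 0 I⁻¹).map id,
      Measure.isProbabilityMeasure_map aemeasurable_id⟩ :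
      ProbabilityMeasure (EuclideanSpace ℝ ι)) =
      ⟨(multivariateGaussian 0 I).map ((fun x : EuclideanSpace ℝ ι =>
        (WithLp.toLp 2 (I⁻¹ *ᵥ ⇑x) : EuclideanSpace ℝ ι)) ∘ id),
        Measure.isProbabilityMeasure_map h1.aemeasurable_limit⟩ :=
    Subtype.ext (by
      simp only [Measure.map_id, Function.comp_id]
      exact (map_inv_multivariateGaussian hI).symm)
  rw [h3]
  exact h2

end Limits

section Estimation

variable {pβ pb pγ : ℕ} {D : Design pβ pb}
  {G : EuclideanSpace ℝ (Fin pγ) → Matrix (Fin pb) (Fin pb) ℝ} {θ₀ : Par pβ pγ}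
  {Θβ : Set (EuclideanSpace ℝ (Fin pβ))} {Θγ : Set (EuclideanSpace ℝ (Fin pγ))}
  {Θs : Set (EuclideanSpace ℝ (Fin 3))}

theorem exists_measurable_maximizer_logLik (hΘβ : IsOpen Θβ) (hΘγ : IsOpen Θγ) (hΘs : IsOpen Θs)
    (hpos : ∀ s ∈ Θs, ∀ k, 0 < s k) (hG : ∀ γ ∈ Θγ, (G γ).PosSemidef)
    (hG3 : ∀ j k, ContDiffOn ℝ 3 (fun γ => G γ j k) Θγ)
    (hQ : UniformlyNondegenerate D G (covSet Θγ Θs)) {ρ : ℝ} (hρ : 0 ≤ ρ)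
    (hball : Metric.closedBall θ₀ ρ ⊆ parSet Θβ Θγ Θs) (N : ℕ) :
    ∃ g : D.Sample N → Par pβ pγ, Measurable g ∧ ∀ y, ‖g y - θ₀‖ ≤ ρ ∧
      ∀ θ, ‖θ - θ₀‖ ≤ ρ → logLik D G N y θ ≤ logLik D G N y (g y) := by
  obtain ⟨g, hg, h⟩ := exists_measurable_argmax (isCompact_closedBall θ₀ ρ)
    ⟨θ₀, Metric.mem_closedBall_self hρ⟩ (fun y θ => logLik D G N y θ)
    (fun θ _ => measurable_logLik N θ)
    fun y => (continuousOn_logLik hΘβ hΘγ hΘs hpos hG hG3 hQ N y).mono hball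
  simp only [mem_closedBall_iff_norm] at h
  exact ⟨g, hg, h⟩

theorem isLocalMax_of_forall_norm_le {E : Type*} [SeminormedAddCommGroup E] {f : E → ℝ} {x y : E}
    {ρ : ℝ} (hy : ‖y - x‖ < ρ) (h : ∀ z, ‖z - x‖ ≤ ρ → f z ≤ f y) : IsLocalMax f y := by
  filter_upwards [Metric.isOpen_ball.mem_nhds (mem_ball_iff_norm.2 hy)] with z hz
  exact h z (mem_ball_iff_norm.1 hz).le

variable {Ω : Type*} [MeasurableSpace Ω] {P : Measure Ω} [IsProbabilityMeasure P]

/-- Local asymptotic normality, and an asymptotically efficient local maximizer, in terms of the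
residuals. -/
theorem IsResidual.asymptotics (hΘβ : IsOpen Θβ) (hΘγ : IsOpen Θγ) (hΘs : IsOpen Θs)
    (hpos : ∀ s ∈ Θs, ∀ k, 0 < s k) (hG : ∀ γ ∈ Θγ, (G γ).PosSemidef)
    (hG3 : ∀ j k, ContDiffOn ℝ 3 (fun γ => G γ j k) Θγ)
    (hQ : UniformlyNondegenerate D G (covSet Θγ Θs)) (hθ₀ : θ₀ ∈ parSet Θβ Θγ Θs)
    {e : ∀ i, Ω → D.Obs i} (he : IsResidual D G θ₀ P e)
    {I : Matrix (ParIdx pβ pγ) (ParIdx pβ pγ) ℝ} (hIsymm : I.IsSymm) {c : ℝ} (hc : 0 < c)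
    (hIc : ∀ x : ParIdx pβ pγ → ℝ, c * (x ⬝ᵥ x) ≤ x ⬝ᵥ (I *ᵥ x))
    (hI : ∀ a b, Tendsto (fun N : ℕ => (N : ℝ)⁻¹ * ∑ i : Fin N, indInfo D G θ₀ i a b) atTop
      (𝓝 (I a b)))
    {Y : ∀ N : ℕ, Ω → D.Sample N} (hY : ∀ N ω, Y N ω = obsOfResid D θ₀ N fun i => e i ω)
    {Δ : ℕ → Ω → Par pβ pγ} (hΔ : ∀ N ω, Δ N ω = normScore D G N (Y N ω) θ₀) :
    ((∀ u : ℕ → Par pβ pγ, (∃ C : ℝ, ∀ N, ‖u N‖ ≤ C) →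
        TendstoInMeasure P
          (fun N ω => (logLik D G N (Y N ω) (θ₀ + (√N)⁻¹ • u N) - logLik D G N (Y N ω) θ₀)
              - ((⇑(Δ N ω) ⬝ᵥ ⇑(u N)) - (1 / 2 : ℝ) * (⇑(u N) ⬝ᵥ (I *ᵥ ⇑(u N)))))
          atTop (fun _ => (0 : ℝ))) ∧
      TendstoInDistribution Δ atTop id (fun _ => P) (multivariateGaussian 0 I)) ∧
    ∃ θhat : ∀ N : ℕ, D.Sample N → Par pβ pγ,
      (∀ N, Measurable (θhat N)) ∧
      Tendsto (fun N => P {ω | ¬ (θhat N (Y N ω) ∈ parSet Θβ Θγ Θs ∧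
          IsLocalMax (logLik D G N (Y N ω)) (θhat N (Y N ω)))}) atTop (𝓝 0) ∧
      TendstoInMeasure P
        (fun (N : ℕ) ω => √N • (θhat N (Y N ω) - θ₀) - WithLp.toLp 2 (I⁻¹ *ᵥ ⇑(Δ N ω)))
        atTop (fun _ => (0 : Par pβ pγ)) ∧
      TendstoInDistribution (fun (N : ℕ) ω => √N • (θhat N (Y N ω) - θ₀)) atTop id
        (fun _ => P) (multivariateGaussian 0 I⁻¹) := by
  obtain ⟨r, hr, K, hK, hball, F, hb, hexp⟩ :=
    exists_hasIndExpansion hΘβ hΘγ hΘs hpos hG hG3 hQ hθ₀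
  have hQpd : ∀ i, (QMat D G i (covOf θ₀)).PosDef := QMat_posDef hG hQ hθ₀.2
  have hIpd : I.PosDef := posDef_of_le_quadraticForm hIsymm hc hIc
  obtain rfl : Δ = fun (N : ℕ) ω => (√N)⁻¹ • ∑ i : Fin N, indScore D G θ₀ i (e i ω) := by
    funext N ω
    rw [hΔ, hY, hexp.normScore_eq hr]
  have hclt := he.tendstoInDistribution_score hQpd (dQMat_isSymm hΘγ hΘs hG hθ₀.2) hK hb
    hIpd.posSemidef hI
  have hexpY : ∀ (N : ℕ) (ω : Ω) (h : Par pβ pγ), ‖h‖ ≤ r → _ := fun N ω h hh =>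
    hexp.rescaled N (fun i => e i ω) h hh
  simp only [← hY] at hexpY
  have hhess := he.tendstoInMeasure_hess hQpd hK hb hI
  have hrem := he.tendsto_measure_lt_average (he.integral_moment_le hQpd hK hb)
    (c := 200 * K ^ 8) (by positivity)
  -- This is the bound `c * B + 1` of `IsResidual.tendsto_measure_lt_average`, with `c` the constant
  -- of the individual remainders and `B` the moment bound.
  set κ : ℝ := 200 * K ^ 8 * (4 * (1 + 15 * K ^ 6)) + 1 with hκdef
  have hκ : 0 < κ := by positivity
  refine ⟨⟨fun u hu => lan_of_expansion hr hexpY hhess hrem u hu, hclt⟩, ?_⟩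
  -- A radius independent of `N`, small enough for the curvature `c` to dominate the cubic remainder
  -- on the whole ball.
  set ρ : ℝ := min r (c / (8 * κ)) with hρdef
  have hρ : 0 < ρ := lt_min hr (by positivity)
  have hκρ : κ * ρ ≤ c / 8 := by
    refine (mul_le_mul_of_nonneg_left (min_le_right _ _) hκ.le).trans (le_of_eq ?_)
    field_simp
  have hρball : Metric.closedBall θ₀ ρ ⊆ parSet Θβ Θγ Θs :=
    (Metric.closedBall_subset_closedBall (min_le_left _ _)).trans hball
  choose θhat hmeas hθhat using
    exists_measurable_maximizer_logLik hΘβ hΘγ hΘs hpos hG hG3 hQ hρ.le hρball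
  obtain ⟨hloc, hlin⟩ := argmax_linear_of_expansion hκ.le hρ hc hκρ hIsymm hIc
    (fun N ω h hh => hexpY N ω h (hh.trans (min_le_left _ _))) hhess hrem
    (exists_measure_norm_gt_le_of_tendstoInDistribution hclt)
    (fun N ω => θhat N (Y N ω) - θ₀) (fun N ω => (hθhat N _).1) fun N ω h hh => by
      rw [add_sub_cancel]
      exact sub_le_sub_right ((hθhat N _).2 _ (by rwa [add_sub_cancel_left])) _
  refine ⟨θhat, hmeas, ?_, hlin, ?_⟩
  -- Whenever the maximizer over the closed ball is not on the sphere, it is an unconstrained local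
  -- maximum and lies in the parameter set.
  · refine tendsto_of_tendsto_of_tendsto_of_le_of_le tendsto_const_nhds hloc
      (fun _ => zero_le) fun N => measure_mono fun ω hω => ?_
    rw [Set.mem_ofPred_eq] at hω ⊢
    contrapose! hω
    exact ⟨hρball (mem_closedBall_iff_norm.2 hω.le),
      isLocalMax_of_forall_norm_le hω (hθhat N _).2⟩
  · have hYm : ∀ N, Measurable (Y N) := fun N => by
      rw [show Y N = fun ω => obsOfResid D θ₀ N fun i => e i ω from funext (hY N)]
      exact measurable_pi_lambda _ fun i => (he.measurable i).const_add _
    exact tendstoInDistribution_of_tendstoInMeasure_sub _ _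
      (tendstoInDistribution_inv_mulVec hIpd hclt) hlin
      fun N => (((hmeas N).comp (hYm N)).sub_const θ₀ |>.const_smul (√N)).aemeasurable

end Estimation

end IOU

end

/-! ### The theorem for the model. -/

theorem theorem1 {pβ pb pγ : ℕ} (D : IOU.Design pβ pb)
    (G : EuclideanSpace ℝ (Fin pγ) → Matrix (Fin pb) (Fin pb) ℝ)
    -- the parameter space `Θ = Θβ × Θγ × Θs`
    (Θβ : Set (EuclideanSpace ℝ (Fin pβ))) (Θγ : Set (EuclideanSpace ℝ (Fin pγ)))
    (Θs : Set (EuclideanSpace ℝ (Fin 3)))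
    (hΘβ : IsOpen Θβ) (hΘγ : IsOpen Θγ) (hΘs : IsOpen Θs)
    (hpos : ∀ s ∈ Θs, ∀ k, 0 < s k)
    -- `G(γ)` is a covariance matrix, and `G` is of class `C^3`
    (hG : ∀ γ ∈ Θγ, (G γ).PosSemidef)
    (hG3 : ∀ j k, ContDiffOn ℝ 3 (fun γ => G γ j k) Θγ)
    (hQ : IOU.UniformlyNondegenerate D G (IOU.covSet Θγ Θs))
    -- the limits `A` and `U`
    (A : IOU.CovPar pγ → Matrix (Fin pβ) (Fin pβ) ℝ)
    (U : IOU.CovPar pγ → Matrix (IOU.CovIdx pγ) (IOU.CovIdx pγ) ℝ)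
    (hAsymm : ∀ v ∈ IOU.covSet Θγ Θs, (A v).IsSymm)
    (hUsymm : ∀ v ∈ IOU.covSet Θγ Θs, (U v).IsSymm)
    (hA1 : ∀ j k, ContDiffOn ℝ 1 (fun v => A v j k) (IOU.covSet Θγ Θs))
    (hU1 : ∀ j k, ContDiffOn ℝ 1 (fun v => U v j k) (IOU.covSet Θγ Θs))
    (hA : ∀ v ∈ IOU.covSet Θγ Θs,
      Tendsto (fun N => IOU.avgA D G N v) atTop (𝓝 (A v)))
    (hU : ∀ v ∈ IOU.covSet Θγ Θs, ∀ j k,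
      Tendsto (fun N => IOU.avgU D G N j k v) atTop (𝓝 (U v j k)))
    (hApd : IOU.PosDefOnCompacts (IOU.covSet Θγ Θs) A)
    (hUpd : IOU.PosDefOnCompacts (IOU.covSet Θγ Θs) U)
    -- the true value and the model under it
    (θ₀ : IOU.Par pβ pγ) (hθ₀ : θ₀ ∈ IOU.parSet Θβ Θγ Θs)
    {Ω : Type*} [MeasurableSpace Ω] (P : Measure Ω) [IsProbabilityMeasure P]
    (b : ℕ → Ω → EuclideanSpace ℝ (Fin pb)) (ζ : ℕ → ℝ≥0 → Ω → ℝ) (ε : ∀ i, Ω → D.Obs i)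
    (hmodel : IOU.IsModel D G θ₀ P b ζ ε)
    -- abbreviations: the data, the normalized score at `θ₀`, and the information matrix
    (Y : ∀ N : ℕ, Ω → D.Sample N) (hY : Y = IOU.sample D (IOU.betaOf θ₀) b ζ ε)
    (Δ : ℕ → Ω → IOU.Par pβ pγ) (hΔ : ∀ N ω, Δ N ω = IOU.normScore D G N (Y N ω) θ₀)
    (I : Matrix (IOU.ParIdx pβ pγ) (IOU.ParIdx pβ pγ) ℝ)
    (hI : I = IOU.infoMat (A (IOU.covOf θ₀)) (U (IOU.covOf θ₀))) :
    -- (1) local asymptotic normality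
    ((∀ u : ℕ → IOU.Par pβ pγ, (∃ C : ℝ, ∀ N, ‖u N‖ ≤ C) →
        TendstoInMeasure P
          (fun N ω =>
            (IOU.logLik D G N (Y N ω) (θ₀ + (Real.sqrt N)⁻¹ • u N)
                - IOU.logLik D G N (Y N ω) θ₀)
              - ((⇑(Δ N ω) ⬝ᵥ ⇑(u N)) - (1 / 2 : ℝ) * (⇑(u N) ⬝ᵥ (I *ᵥ ⇑(u N)))))
          atTop (fun _ => (0 : ℝ))) ∧
      TendstoInDistribution Δ atTop id (fun _ => P) (multivariateGaussian 0 I)) ∧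
    -- (2) a local maximizer that is asymptotically linear and asymptotically normal
    ∃ θhat : ∀ N : ℕ, D.Sample N → IOU.Par pβ pγ,
      (∀ N, Measurable (θhat N)) ∧
      Tendsto (fun N => P {ω | ¬ (θhat N (Y N ω) ∈ IOU.parSet Θβ Θγ Θs ∧
          IsLocalMax (IOU.logLik D G N (Y N ω)) (θhat N (Y N ω)))}) atTop (𝓝 0) ∧
      TendstoInMeasure P
        (fun (N : ℕ) ω => Real.sqrt N • (θhat N (Y N ω) - θ₀) - WithLp.toLp 2 (I⁻¹ *ᵥ ⇑(Δ N ω)))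
        atTop (fun _ => (0 : IOU.Par pβ pγ)) ∧
      TendstoInDistribution (fun (N : ℕ) ω => Real.sqrt N • (θhat N (Y N ω) - θ₀)) atTop id
        (fun _ => P) (multivariateGaussian 0 I⁻¹) := by
  have hI0 : I.IsSymm := by
    rw [hI]
    exact IOU.infoMat_isSymm (hAsymm _ hθ₀.2) (hUsymm _ hθ₀.2)
  -- The compact set used is the single point `v₀`.
  have hsub : {IOU.covOf θ₀} ⊆ IOU.covSet Θγ Θs := Set.singleton_subset_iff.2 hθ₀.2
  obtain ⟨c₁, hc₁, hc₁A⟩ := hApd _ hsub isCompact_singleton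
  obtain ⟨c₂, hc₂, hc₂U⟩ := hUpd _ hsub isCompact_singleton
  have hIc := IOU.le_infoMat_quadraticForm (hc₁A _ rfl) (hc₂U _ rfl)
  have hlim := IOU.tendsto_average_indInfo (hA _ hθ₀.2) (hU _ hθ₀.2)
  rw [← hI] at hIc
  simp only [← hI] at hlim
  have hQpd := IOU.QMat_posDef hG hQ hθ₀.2
  obtain ⟨e, hem, hei, hel, hae⟩ := hmodel.exists_residuals (hpos _ hθ₀.2.2 0) (hpos _ hθ₀.2.2 2)
    (hG _ hθ₀.2.1) fun i => (hQpd i).posSemidef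
  obtain ⟨⟨hlan, hclt⟩, θhat, hmeas, hmax, hlin, hnorm⟩ := IOU.IsResidual.asymptotics hΘβ hΘγ hΘs
    hpos hG hG3 hQ hθ₀ ⟨hem, hei, hel⟩ hI0 (lt_min hc₁ hc₂) hIc hlim (fun _ _ => rfl) fun _ _ => rfl
  -- The sample agrees with the one built from the residuals on one event of probability one, for
  -- all `N` together; all assertions are stable under such a modification.
  have hYe : ∀ᵐ ω ∂P, ∀ N, IOU.obsOfResid D θ₀ N (fun i => e i ω) = Y N ω := by
    filter_upwards [hae] with ω hω N
    rw [hY]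
    funext i
    exact (hω i).symm
  refine ⟨⟨fun u hu => (hlan u hu).congr (fun N => ?_) (ae_eq_refl _),
    hclt.congr (fun N => ?_) (ae_eq_refl _)⟩, θhat, hmeas, hmax.congr fun N => ?_,
    hlin.congr (fun N => ?_) (ae_eq_refl _), hnorm.congr (fun N => ?_) (ae_eq_refl _)⟩
  · filter_upwards [hYe] with ω hω
    rw [hΔ, hω N]
  · filter_upwards [hYe] with ω hω
    rw [hΔ, hω N]
  · refine measure_congr (eventuallyEq_set.2 ?_)
    filter_upwards [hYe] with ω hω
    rw [hω N]
  · filter_upwards [hYe] with ω hω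
    rw [hΔ, hω N]
  · filter_upwards [hYe] with ω hω
    rw [hω N]
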